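/- **Model.** A network is a simple undirected connected graph $G=(V,E)$ with $n$ nodes. Nodes have distinct identifiers in $\{0,\dots,2^b-1\}$, where $b=O(\log n)$. In the CONGEST model computation proceeds in synchronous rounds. In each round every node may send a (possibly different) message of $O(\log n)$ bits to each neighbour, receives the messages sent to it, and performs unrestricted local computation using private random bits. Initially a node knows only its own identifier, those of its neighbours, the input labels of its incident edges, and the public parameters of the algorithm. **Paths.** Let $M\subseteq E$ be a matching. An alternating path is a simple path in which, of any two consecutive edges, exactly one is in $M$. An augmenting path is an alternating path connecting two distinct unmatched nodes. For $S\subseteq V$ let $r^0_{G-S}(u,v)$ be the length of a shortest alternating path of even length from $u$ to $v$ in $G-S$ with respect to the edges of $M$ in $G-S$ (the path of length $0$ counts as even), or $\infty$ if there is none. **Predecessor procedure.** For distinct unmatched nodes $f,g$, let $L$ be the length of a shortest augmenting path between $f$ and $g$. The procedure builds a sequence of nodes (the suffix), starting from the one-node suffix $(g)$; the first node $t$ of the suffix is the current target. In iteration $i=1,\dots,L$ it prepends a node $u$ to the suffix: * if $i$ is even, $u$ is the node matched to $t$ by $M$; * if $i$ is odd, $u$ is an arbitrary neighbour of $t$ with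 $tu\notin M$ and $r^0_{G-S}(f,u)=L-i$, where $S$ is the set of nodes of the current suffix. **Statement.** For all constants $a$ and $c$ there are a constant $C$ and a randomized CONGEST algorithm, with public parameters $b$ and $\ell$ and with the membership of each edge in $M$ as its input label, such that the following holds. Let $G$ be a connected graph on $n$ nodes whose identifiers are distinct and have at most $b\le a\lfloor\log_2 n\rfloor$ bits. Let $M$ be a matching of $G$ that leaves exactly two nodes $f\ne g$ unmatched, and suppose that there is an augmenting path of length at most $\ell$ between $f$ and $g$. Then: 1. The predecessor procedure never gets stuck: as long as fewer than $L$ iterations have been made, whatever the earlier choices were, there is an admissible node to prepend. After $L$ iterations, the suffix is the node sequence of an augmenting path from $f$ to $g$ of length $L$. 2. The algorithm uses messages of at most $C\lfloor\log_2 n\rfloor$ bits and stops after at most $C\ell^2$ rounds. With probability at least $1-n^{-c}$, there is an augmenting path $P$ between $f$ and $g$, which is the outcome of a complete run of the predecessor procedure, such that both ends of every edge of $G$ label that edge as lying on $P$ if and only if it does. -/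

import Mathlib

/-! ### Matchings and alternating paths -/

/-- `v` is unmatched: no edge of `M` is incident to `v`. -/
def Unmatched {V : Type*} {G : SimpleGraph V} (M : G.Subgraph) (v : V) : Prop :=
  ∀ w, ¬ M.Adj v w

/-- An alternating path: a simple path such that, of any two consecutive edges, exactly one
belongs to `M`. Paths of length `0` and `1` are alternating. -/
def IsAlternatingPath {V : Type*} {G : SimpleGraph V} (M : G.Subgraph) {u v : V}
    (p : G.Walk u v) : Prop :=
  p.IsPath ∧ p.edges.IsChain (fun e e' => ¬ (e ∈ M.edgeSet ↔ e' ∈ M.edgeSet))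

/-- An augmenting path: an alternating path connecting two (distinct) unmatched nodes. -/
def IsAugmentingPath {V : Type*} {G : SimpleGraph V} (M : G.Subgraph) {u v : V}
    (p : G.Walk u v) : Prop :=
  IsAlternatingPath M p ∧ u ≠ v ∧ Unmatched M u ∧ Unmatched M v

/-- `altDist M S θ u v` is the length of a shortest alternating path from `u` to `v` whose length
has parity `θ` in the graph `G - S` obtained by deleting the nodes of `S` (with the matching
consisting of the edges of `M` that survive); it is `⊤` if there is none. The alternating paths of
`G - S` are the alternating paths of `G` that visit no node of `S`. The path of length `0` has
parity `0`. -/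
noncomputable def altDist {V : Type*} {G : SimpleGraph V} (M : G.Subgraph) (S : Set V) (θ : ℕ)
    (u v : V) : ℕ∞ :=
  sInf {d : ℕ∞ | ∃ p : G.Walk u v,
    IsAlternatingPath M p ∧ p.length % 2 = θ ∧ (∀ x ∈ p.support, x ∉ S) ∧ d = (p.length : ℕ∞)}

/-! ### Backward construction of a path -/

/-- `PredecessorRun M f g L i P`: after `i` iterations of the predecessor-finding procedure with
target length `L`, the list `P` may be the suffix built so far (it ends in `g`, and its head is the
current target `t`). The procedure starts from the suffix `[g]`. In an even iteration, `t` prepends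
its partner in `M`. In an odd iteration number `i`, it prepends an arbitrary neighbour `u` joined to
`t` by an edge outside `M`, such that the shortest even alternating path from `f` to `u` in `G`
minus the nodes of the suffix has length exactly `L - i`. -/
inductive PredecessorRun {V : Type*} {G : SimpleGraph V} (M : G.Subgraph) (f g : V) (L : ℕ) :
    ℕ → List V → Prop
  | start : PredecessorRun M f g L 0 [g]
  | even_step (i : ℕ) (t u : V) (P : List V) :
      PredecessorRun M f g L i (t :: P) → i < L → Even (i + 1) → M.Adj t u →
      PredecessorRun M f g L (i + 1) (u :: t :: P)
  | odd_step (i d : ℕ) (t u : V) (P : List V) :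
      PredecessorRun M f g L i (t :: P) → i + 1 + d = L → Odd (i + 1) →
      G.Adj t u → ¬ M.Adj t u → altDist M {x | x ∈ t :: P} 0 f u = (d : ℕ∞) →
      PredecessorRun M f g L (i + 1) (u :: t :: P)

/-! ### The CONGEST model -/

/-- A randomized synchronous message-passing algorithm, run by every node of a network whose edges
carry a one-bit input label and receive a one-bit output label.

Every node starts from its own identifier, the identifiers of its neighbours, the identifiers of
those neighbours to which it is joined by an edge with input label `1`, and `coins` private random
bits. In each of the `rounds` rounds it sends to each neighbour a message of `bandwidth` bits
(which may depend on that neighbour) and updates its state from the messages that it received,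
which are indexed by the identifiers of the senders. Local computation is unrestricted. At the end
it outputs a label for each of its incident edges, indexed by the identifier of the other end. -/
structure CongestAlgorithm where
  State : Type
  bandwidth : ℕ
  coins : ℕ
  rounds : ℕ
  init : (self : ℕ) → (nbrs : Set ℕ) → (labelled : Set ℕ) → (Fin coins → Bool) → State
  send : State → (dest : ℕ) → (Fin bandwidth → Bool)
  receive : State → (inbox : ℕ → Option (Fin bandwidth → Bool)) → State
  output : State → (nbr : ℕ) → Bool

namespace CongestAlgorithm

open Classical in
/-- The messages that node `v` receives if the current states are `st`: at position `k`, the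
message sent to `v` by the neighbour with identifier `k`, if there is one. -/
noncomputable def inbox (A : CongestAlgorithm) {V : Type*} (G : SimpleGraph V) (ident : V → ℕ)
    (st : V → A.State) (v : V) (k : ℕ) : Option (Fin A.bandwidth → Bool) :=
  if h : ∃ w, G.Adj v w ∧ ident w = k then some (A.send (st h.choose) (ident v)) else none

/-- The states of all nodes after `t` rounds on the network `G` with identifiers `ident`, where the
edges of `M` are those with input label `1` and `ω v` are the random bits of node `v`. -/
noncomputable def stateAfter (A : CongestAlgorithm) {V : Type*} (G : SimpleGraph V)
    (M : G.Subgraph) (ident : V → ℕ) (ω : V → Fin A.coins → Bool) : ℕ → V → A.State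
  | 0 => fun v => A.init (ident v) (ident '' G.neighborSet v) (ident '' M.neighborSet v) (ω v)
  | t + 1 => fun v => A.receive (stateAfter A G M ident ω t v)
      (A.inbox G ident (stateAfter A G M ident ω t) v)

/-- The label that node `v` outputs for its incident edge to `w`. -/
noncomputable def edgeLabel (A : CongestAlgorithm) {V : Type*} (G : SimpleGraph V)
    (M : G.Subgraph) (ident : V → ℕ) (ω : V → Fin A.coins → Bool) (v w : V) : Bool :=
  A.output (A.stateAfter G M ident ω A.rounds v) (ident w)

/-- The algorithm outputs the path `p`: both ends of every edge `vw` label it with `true` if it lies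
on `p`, and with `false` otherwise. -/
def OutputsPath (A : CongestAlgorithm) {V : Type*} (G : SimpleGraph V) (M : G.Subgraph)
    (ident : V → ℕ) (ω : V → Fin A.coins → Bool) {u u' : V} (p : G.Walk u u') : Prop :=
  ∀ v w, G.Adj v w → (A.edgeLabel G M ident ω v w = true ↔ s(v, w) ∈ p.edges)

end CongestAlgorithm

/-- The probability of the event `E` for a uniformly random element of the finite type `Ω`. -/
noncomputable def uniformProb {Ω : Type*} (E : Ω → Prop) : ℝ :=
  (Nat.card {ω : Ω // E ω} : ℝ) / (Nat.card Ω : ℝ)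

/-!
The algorithm is deterministic; it uses no random bits and always labels a shortest augmenting path.

*The predecessor procedure.* The invariant is that after `i` iterations an alternating path of
length `L - i` leads from `f` to the target and avoids the rest of the suffix, so that the suffix is
the end of an augmenting path of length `L` (`PredecessorRun.isCut`). An odd iteration restores the
invariant by the choice of `u`; in an even one, the path must arrive at the target through its
partner. The predecessor of the target on this path is always admissible, as a shorter path to it that avoids the
suffix would give a shorter augmenting path (`PredecessorRun.exists_extend`). For the same reason
every shortest augmenting path is the outcome of a run (`IsShortestAug.predecessorRun`), so the
algorithm is free to find any of them.

*The search.* The unmatched node `f` with the smaller identifier becomes the root. A breadth first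
search from `f` gives every node at most one label of each parity, the length of a shortest
alternating path from `f` of this parity, if it is at most `N`. The smaller label (the rank) comes from a parent, so that there is a
search tree. A node `v` gets its larger label from an edge `xy` that leaves its subtree: if `x` and
`y` have labels `m` and `n` of the same parity that fit the edge, then going from `f` to `y`, across
the edge, and from `x` backwards to `v` has length `m + n + 1 - rank v`. The best edge of this kind
is the bridge of `v`. Two facts carry the argument. The path described by a label is simple, since
bridges with smaller keys cannot lead into a subtree whose own bridge has a larger key
(`SearchData.Seg.avoids`, `SearchData.Seg.altPath`, where the paths are those of
`SearchData.Valid.exists_seg`). And every alternating path of length `m` to `v` forces a label of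
`v` of this parity that is at most `m` (`SearchData.Valid.exists_lab_le`): otherwise, where the path
last enters the subtree of `v`, there is an edge that leaves this subtree and is short enough.

*Computing the labels.* In each of `N` levels the nodes exchange records with their neighbours. A
record contains the ancestors of a node and, for each length `k`, the smallest depth at which the
ancestors of the ends of an edge of the subtree with `m + n + 1 = k` diverge. This one number tells
every ancestor whether some such edge leaves its subtree (`searchData_diverge_le_iff`), and it moves
up the tree fast enough (`tok_complete`), so the records determine valid search data
(`searchData_valid`). A record has `O(N)` words of `O(b)` bits, which makes `O(N ^ 2)` rounds.

*Reading off the path.* The path that belongs to a label is unfolded by public queries, which every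
node of the search tree answers identically, as the answer is a minimum found by flooding in
`O(N)` rounds. Each query reveals one edge of the path, either one to a parent or a bridge
(`advance_seg`), so `O(N)` queries are enough. With `N = min ℓ (2 ^ b)` all of this takes
`6 * N ^ 2 + 17 * N + 10` rounds (`length_allRounds`).
-/

/-! ### Alternating paths as lists of nodes -/

/-- `LevelEdge M n x y`: an alternating path that starts with an edge outside `M` may use the edge
`xy` as its edge number `n` (counting from `0`). -/
def LevelEdge {V : Type*} {G : SimpleGraph V} (M : G.Subgraph) (n : ℕ) (x y : V) : Prop :=
  G.Adj x y ∧ (M.Adj x y ↔ n % 2 = 1)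

/-- `AltPath M k v n x l`: the list `l`, read backwards, is the node sequence of an alternating path
from `v` to `x`, where `v` has position `k` and `x` has position `n` in a path that starts with an
edge outside `M`. The head of `l` is the far end `x`. -/
inductive AltPath {V : Type*} {G : SimpleGraph V} (M : G.Subgraph) (k : ℕ) (v : V) :
    ℕ → V → List V → Prop
  | nil : AltPath M k v k v [v]
  | cons (n : ℕ) (x y : V) (l : List V) : AltPath M k v n y l → LevelEdge M n y x → x ∉ l →
      AltPath M k v (n + 1) x (x :: l)

section AltPath

variable {V : Type*} {G : SimpleGraph V} {M : G.Subgraph}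

theorem LevelEdge.symm {n : ℕ} {x y : V} (h : LevelEdge M n x y) : LevelEdge M n y x :=
  ⟨h.1.symm, by rw [M.adj_comm]; exact h.2⟩

theorem LevelEdge.congr {m n : ℕ} {x y : V} (h : LevelEdge M n x y) (e : m % 2 = n % 2) :
    LevelEdge M m x y := ⟨h.1, by rw [e]; exact h.2⟩

namespace AltPath

theorem head_mem {k n : ℕ} {v x : V} {l : List V} (h : AltPath M k v n x l) : x ∈ l := by
  cases h <;> simp

theorem start_mem {k n : ℕ} {v x : V} {l : List V} (h : AltPath M k v n x l) : v ∈ l := by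
  induction h with
  | nil => simp
  | cons n x y l _ _ _ ih => simp [ih]

theorem nodup {k n : ℕ} {v x : V} {l : List V} (h : AltPath M k v n x l) : l.Nodup := by
  induction h with
  | nil => simp
  | cons n x y l _ _ hx ih => simp [ih, hx]

theorem length_eq {k n : ℕ} {v x : V} {l : List V} (h : AltPath M k v n x l) :
    l.length + k = n + 1 := by
  induction h with
  | nil => simp; omega
  | cons n x y l _ _ _ ih => simp; omega

theorem le {k n : ℕ} {v x : V} {l : List V} (h : AltPath M k v n x l) : k ≤ n := by
  induction h with
  | nil => exact le_rfl
  | cons n x y l _ _ _ ih => omega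

theorem eq_cons {k n : ℕ} {v x : V} {l : List V} (h : AltPath M k v n x l) :
    ∃ l', l = x :: l' := by
  cases h <;> simp

/-- Every node of an alternating path is the end of an initial part of it. -/
theorem exists_prefix {k n : ℕ} {v x : V} {l : List V} (h : AltPath M k v n x l) {q : V}
    (hq : q ∈ l) : ∃ i l', AltPath M k v i q l' ∧ i ≤ n ∧ (q ≠ x → i < n) := by
  induction h with
  | nil =>
    simp only [List.mem_singleton] at hq
    subst hq
    exact ⟨k, _, .nil, le_rfl, fun h => absurd rfl h⟩
  | cons n x y l h e hx ih =>
    rcases List.mem_cons.1 hq with rfl | hq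
    · exact ⟨n + 1, _, .cons _ _ _ _ h e hx, le_rfl, fun h => absurd rfl h⟩
    · obtain ⟨i, l', h', hi, -⟩ := ih hq
      exact ⟨i, l', h', by omega, fun _ => by omega⟩

/-- Concatenation of two alternating paths that share only the node in between. -/
theorem append {k n m : ℕ} {u v x : V} {l B : List V} (hB : AltPath M n v m x B)
    (hl : AltPath M k u n v l) (hd : ∀ q ∈ B, q ∈ l → q = v) :
    ∃ B', B = B' ++ [v] ∧ AltPath M k u m x (B' ++ l) := by
  induction hB with
  | nil => exact ⟨[], rfl, hl⟩
  | cons m x y B hB e hx ih =>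
    obtain ⟨B', rfl, h⟩ := ih fun q hq => hd q (List.mem_cons_of_mem _ hq)
    refine ⟨x :: B', rfl, .cons _ _ _ _ h e ?_⟩
    intro hx'
    rcases List.mem_append.1 hx' with h1 | h1
    · exact hx (List.mem_append_left _ h1)
    · have := hd x (by simp) h1
      subst this
      exact hx (by simp)

/-- Splitting an alternating path at one of its positions. -/
theorem split {k m : ℕ} {u x : V} {l : List V} (h : AltPath M k u m x l) (i : ℕ) (hk : k ≤ i)
    (hi : i ≤ m) : ∃ v B l', AltPath M i v m x (B ++ [v]) ∧ AltPath M k u i v l' ∧ l = B ++ l' := by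
  induction h with
  | nil =>
    obtain rfl : i = k := by omega
    exact ⟨u, [], _, .nil, .nil, rfl⟩
  | cons m x y l h e hx ih =>
    by_cases him : i = m + 1
    · subst him
      exact ⟨x, [], _, .nil, .cons _ _ _ _ h e hx, rfl⟩
    · obtain ⟨v, B, l', h1, h2, rfl⟩ := ih (by omega)
      refine ⟨v, x :: B, l', .cons _ _ _ _ h1 e ?_, h2, rfl⟩
      intro hx'
      apply hx
      rcases List.mem_append.1 hx' with h3 | h3
      · exact List.mem_append_left _ h3
      · rw [List.mem_singleton.1 h3]
        exact List.mem_append_right _ h2.head_mem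

/-- Extending an alternating path at its start. -/
theorem snoc {k n : ℕ} {u v x : V} {B : List V} (h : AltPath M (k + 1) v n x B)
    (e : LevelEdge M k u v) (hu : u ∉ B) : AltPath M k u n x (B ++ [u]) := by
  induction h with
  | nil => exact .cons _ _ _ _ .nil e (by simpa [eq_comm] using hu)
  | cons n x y l h e' hx ih =>
    refine .cons _ _ _ _ (ih fun h => hu (by simp [h])) e' ?_
    intro hx'
    rcases List.mem_append.1 hx' with h1 | h1
    · exact hx h1
    · exact hu (by simp [List.mem_singleton.1 h1])

/-- An alternating path to a neighbour of the far end of a second one may be continued by the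
second one, traversed backwards, if the parities fit and the two paths are disjoint. -/
theorem append_reverse {k n : ℕ} {v x : V} {l : List V} (h : AltPath M k v n x l) :
    ∀ {i j : ℕ} {u y : V} {P : List V}, AltPath M i u j y P → LevelEdge M j y x →
      j % 2 = n % 2 → (∀ q ∈ l, q ∉ P) → AltPath M i u (j + 1 + (n - k)) v (l.reverse ++ P) := by
  induction h with
  | nil =>
    intro i j u y P hP e _ hd
    rw [Nat.sub_self]
    exact AltPath.cons _ _ _ _ hP e (hd v (by simp))
  | cons n x z l h e' hx ih =>
    intro i j u y P hP e hj hd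
    have h1 := AltPath.cons _ _ _ _ hP e (hd x (by simp))
    have h2 := ih h1 (e'.symm.congr (by omega)) (by omega) (by
      intro q hq hq'
      rcases List.mem_cons.1 hq' with rfl | hq'
      · exact hx hq
      · exact hd q (by simp [hq]) hq')
    have hle := h.le
    rw [show j + 1 + (n + 1 - k) = j + 1 + 1 + (n - k) by omega]
    simpa using h2

/-- Splitting an alternating path that ends in the set `T` where it enters `T` for the last
time. -/
theorem split_last_entry {k n : ℕ} {v x : V} {l : List V} (h : AltPath M k v n x l) (T : Set V)
    (hx : x ∈ T) (hv : v ∉ T) : ∃ j y z B P, AltPath M k v j z P ∧ z ∉ T ∧ LevelEdge M j z y ∧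
      AltPath M (j + 1) y n x B ∧ (∀ q ∈ B, q ∈ T) ∧ l = B ++ P := by
  induction h with
  | nil => exact absurd hx hv
  | cons n x y l h e hxl ih =>
    by_cases hy : y ∈ T
    · obtain ⟨j, y', z, B, P, h1, h2, h3, h4, h5, rfl⟩ := ih hy
      refine ⟨j, y', z, x :: B, P, h1, h2, h3, .cons _ _ _ _ h4 e fun h => hxl (by simp [h]), ?_,
        rfl⟩
      intro q hq
      rcases List.mem_cons.1 hq with rfl | hq
      · exact hx
      · exact h5 q hq
    · exact ⟨n, x, y, [x], l, h, hy, e, .nil, by simpa using hx, rfl⟩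

end AltPath

theorem altPath_of_isAlternatingPath {f v : V} (hf : Unmatched M f) {p : G.Walk f v}
    (hp : IsAlternatingPath M p) : AltPath M 0 f p.length v p.support.reverse := by
  have key : ∀ {v : V} (p : G.Walk f v), IsAlternatingPath M p →
      AltPath M 0 f p.length v p.support.reverse ∧
        ∀ e ∈ p.edges.getLast?, (e ∈ M.edgeSet ↔ p.length % 2 = 0) := by
    intro v p
    refine SimpleGraph.Walk.concatRec (motive := fun u v p => Unmatched M u → IsAlternatingPath M p →
      AltPath M 0 u p.length v p.support.reverse ∧
        ∀ e ∈ p.edges.getLast?, (e ∈ M.edgeSet ↔ p.length % 2 = 0)) ?_ ?_ p hf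
    · intro u _ _
      exact ⟨.nil, by simp⟩
    · intro u v w p h ih hu hp
      obtain ⟨h1, h2⟩ := hp
      rw [SimpleGraph.Walk.edges_concat, List.concat_eq_append, List.isChain_append] at h2
      rw [SimpleGraph.Walk.concat_isPath_iff] at h1
      obtain ⟨ih1, ih2⟩ := ih hu ⟨h1.1, h2.1⟩
      have hM : M.Adj v w ↔ p.length % 2 = 1 := by
        rcases hl : p.edges.getLast? with _ | e
        · have h0 : p.length = 0 := by
            rw [← SimpleGraph.Walk.length_edges, List.getLast?_eq_none_iff.1 hl]; rfl
          obtain rfl := SimpleGraph.Walk.eq_of_length_eq_zero h0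
          simp [h0, hu w]
        · have h3 := h2.2.2 e hl s(v, w) (by simp)
          rw [ih2 e hl, SimpleGraph.Subgraph.mem_edgeSet] at h3
          rcases Nat.mod_two_eq_zero_or_one p.length with h4 | h4 <;> simp_all
      refine ⟨?_, ?_⟩
      · rw [SimpleGraph.Walk.support_concat, SimpleGraph.Walk.length_concat]
        simpa using AltPath.cons _ _ _ _ ih1 ⟨h, hM⟩ (by simpa using h1.2)
      · rw [SimpleGraph.Walk.edges_concat, SimpleGraph.Walk.length_concat]
        intro e he
        simp only [List.concat_eq_append, List.getLast?_append, List.getLast?_singleton,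
          Option.some_or, Option.mem_some_iff] at he
        subst he
        rw [SimpleGraph.Subgraph.mem_edgeSet, hM]
        omega
  exact (key p hp).1

theorem AltPath.exists_walk {f v : V} {n : ℕ} {l : List V} (h : AltPath M 0 f n v l) :
    ∃ p : G.Walk f v, IsAlternatingPath M p ∧ p.length = n ∧ p.support = l.reverse := by
  suffices ∃ p : G.Walk f v, IsAlternatingPath M p ∧ p.length = n ∧ p.support = l.reverse ∧
      ∀ e ∈ p.edges.getLast?, (e ∈ M.edgeSet ↔ p.length % 2 = 0) by
    obtain ⟨p, h1, h2, h3, -⟩ := this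
    exact ⟨p, h1, h2, h3⟩
  induction h with
  | nil => exact ⟨.nil, ⟨by simp, by simp⟩, rfl, rfl, by simp⟩
  | cons n x y l h e hx ih =>
    obtain ⟨p, ⟨h1, h2⟩, rfl, h3, h4⟩ := ih
    refine ⟨p.concat e.1, ⟨?_, ?_⟩, by simp, by simp [SimpleGraph.Walk.support_concat, h3], ?_⟩
    · rw [SimpleGraph.Walk.concat_isPath_iff]
      exact ⟨h1, by simpa [h3] using hx⟩
    · rw [SimpleGraph.Walk.edges_concat, List.concat_eq_append, List.isChain_append]
      refine ⟨h2, by simp, fun e' he' e'' he'' => ?_⟩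
      simp only [List.head?_cons, Option.mem_some_iff] at he''
      subst he''
      rw [h4 e' he', SimpleGraph.Subgraph.mem_edgeSet, e.2]
      omega
    · rw [SimpleGraph.Walk.edges_concat, SimpleGraph.Walk.length_concat]
      intro e' he
      simp only [List.concat_eq_append, List.getLast?_append, List.getLast?_singleton,
        Option.some_or, Option.mem_some_iff] at he
      subst he
      rw [SimpleGraph.Subgraph.mem_edgeSet, e.2]
      omega

theorem altDist_eq_coe {f u : V} (hf : Unmatched M f) {S : Set V} {d : ℕ} {l : List V}
    (hl : AltPath M 0 f d u l) (hd : d % 2 = 0) (hS : ∀ q ∈ l, q ∉ S)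
    (hmin : ∀ d' l', AltPath M 0 f d' u l' → d' % 2 = 0 → (∀ q ∈ l', q ∉ S) → d ≤ d') :
    altDist M S 0 f u = (d : ℕ∞) := by
  apply le_antisymm
  · obtain ⟨p, h1, h2, h3⟩ := hl.exists_walk
    exact sInf_le ⟨p, h1, by omega, fun x hx => hS x (by simpa [h3] using hx), by rw [h2]⟩
  · apply le_sInf
    rintro _ ⟨p, h1, h2, h3, rfl⟩
    exact_mod_cast hmin _ _ (altPath_of_isAlternatingPath hf h1) h2 (by simpa using h3)

theorem exists_altPath_of_altDist {f u : V} (hf : Unmatched M f) {S : Set V} {d : ℕ}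
    (h : altDist M S 0 f u = (d : ℕ∞)) : ∃ l, AltPath M 0 f d u l ∧ ∀ q ∈ l, q ∉ S := by
  have hne : {d : ℕ∞ | ∃ p : G.Walk f u, IsAlternatingPath M p ∧ p.length % 2 = 0 ∧
      (∀ x ∈ p.support, x ∉ S) ∧ d = (p.length : ℕ∞)}.Nonempty := by
    by_contra h0
    rw [Set.not_nonempty_iff_eq_empty] at h0
    rw [altDist, h0, sInf_empty] at h
    exact ENat.natCast_ne_top d h.symm
  obtain ⟨p, h1, h2, h3, h4⟩ := csInf_mem hne
  have : d = p.length := by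
    have := h.symm.trans h4
    exact_mod_cast this
  subst this
  exact ⟨_, altPath_of_isAlternatingPath hf h1, by simpa using h3⟩

/-! ### Runs of the predecessor procedure -/

/-- `l` is the reversed node sequence of a shortest augmenting path from `f` to `g`, which has
length `L`. -/
def IsShortestAug (M : G.Subgraph) (f g : V) (L : ℕ) (l : List V) : Prop :=
  AltPath M 0 f L g l ∧ L % 2 = 1 ∧ ∀ L' l', AltPath M 0 f L' g l' → L ≤ L'

theorem AltPath.odd_of_unmatched {f g : V} {n : ℕ} {l : List V} (h : AltPath M 0 f n g l)
    (hfg : f ≠ g) (hg : Unmatched M g) : n % 2 = 1 := by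
  cases h with
  | nil => exact absurd rfl hfg
  | cons n x y l h e hx =>
    have := e.2.not.1 fun h => hg y h.symm
    omega

/-- The suffix `P` with head `t` has been cut off from a shortest augmenting path after `i`
steps. -/
def IsCut (M : G.Subgraph) (f g : V) (L i : ℕ) (P : List V) : Prop :=
  ∃ t l, AltPath M (L - i) t L g P.reverse ∧ AltPath M 0 f (L - i) t l ∧ (∀ q ∈ P, q ∈ l → q = t)

theorem AltPath.head_eq {k n : ℕ} {v x t : V} {P : List V}
    (h : AltPath M k v n x (t :: P).reverse) : v = t := by
  obtain ⟨B', h1, -⟩ := h.append (l := [v]) (u := v) (k := k) .nil (by simp)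
  · have h3 : B'.reverse.cons v = t :: P := by
      have := congrArg List.reverse h1
      simpa using this.symm
    exact (List.cons.inj h3).1

theorem PredecessorRun.isCut {f g : V} {L : ℕ} (hf : Unmatched M f) (hM : M.IsMatching)
    (hL : ∃ l, IsShortestAug M f g L l) {i : ℕ} {P : List V}
    (h : PredecessorRun M f g L i P) : IsCut M f g L i P := by
  obtain ⟨l₀, hl₀, hodd, hmin⟩ := hL
  induction h with
  | start => exact ⟨g, l₀, .nil, hl₀, by simp⟩
  | even_step i t u P h hi he hM' ih =>
    obtain ⟨t', l, h1, h2, h3⟩ := ih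
    obtain rfl := h1.head_eq
    have e1 : (L - i) % 2 = 0 := by
      obtain ⟨r, hr⟩ := he
      omega
    generalize hj : L - i = j at *
    cases h2 with
    | nil => omega
    | cons j x y l h2 e hx =>
      have : u = y := by
        have h4 : M.Adj y t' := e.2.2 (by omega)
        exact (hM (M.edge_vert h4.symm)).unique hM' h4.symm
      subst this
      have hu : u ∉ t' :: P := fun hu => by
        have := h3 u hu (List.mem_cons_of_mem _ h2.head_mem)
        subst this
        exact e.1.ne rfl
      have hj' : L - (i + 1) = j := by omega
      refine ⟨u, l, ?_, by rw [hj']; exact h2, ?_⟩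
      · rw [hj', List.reverse_cons]
        exact h1.snoc e (by simpa [and_comm] using hu)
      · intro q hq hql
        rcases List.mem_cons.1 hq with rfl | hq
        · rfl
        · have := h3 q hq (by simp [hql])
          subst this
          exact absurd hql hx
  | odd_step i d t u P h hi he hG hM' hd ih =>
    obtain ⟨t', l, h1, h2, h3⟩ := ih
    obtain rfl := h1.head_eq
    obtain ⟨l', h4, h5⟩ := exists_altPath_of_altDist hf hd
    have hu : u ∉ t' :: P := h5 u h4.head_mem
    have hj : L - i = d + 1 := by omega
    have hj' : L - (i + 1) = d := by omega
    have hdd : d % 2 = 0 := by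
      obtain ⟨r, hr⟩ := he
      omega
    refine ⟨u, l', ?_, by rw [hj']; exact h4, ?_⟩
    · rw [hj', List.reverse_cons]
      rw [hj] at h1
      refine h1.snoc ⟨hG.symm, ?_⟩ (by simpa [and_comm] using hu)
      rw [M.adj_comm]
      simp [hM', hdd]
    · intro q hq hql
      rcases List.mem_cons.1 hq with rfl | hq
      · rfl
      · exact absurd hq (h5 q hql)

/-- A run that has cut off a suffix of a shortest augmenting path may continue along that path: a
shorter even alternating path to the next node that avoids the suffix would give a shorter
augmenting path. -/
theorem PredecessorRun.extend {f g : V} {L : ℕ} (hf : Unmatched M f)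
    (hodd : L % 2 = 1) (hmin : ∀ L' l', AltPath M 0 f L' g l' → L ≤ L') {i : ℕ} {t u : V}
    {P l : List V} (h : PredecessorRun M f g L i (t :: P)) (hi : i < L)
    (h1 : AltPath M (L - i) t L g (t :: P).reverse) (h2 : AltPath M 0 f (L - (i + 1)) u l)
    (e : LevelEdge M (L - (i + 1)) u t) (h3 : ∀ q ∈ t :: P, q ∉ l) :
    PredecessorRun M f g L (i + 1) (u :: t :: P) := by
  rcases Nat.even_or_odd (i + 1) with he | he
  · refine .even_step _ _ _ _ h hi he (M.adj_symm (e.2.2 ?_))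
    obtain ⟨r, hr⟩ := he
    omega
  · have hd : (L - (i + 1)) % 2 = 0 := by
      obtain ⟨r, hr⟩ := he
      omega
    refine .odd_step i (L - (i + 1)) t u P h (by omega) he e.1.symm ?_ ?_
    · intro h
      have := e.2.1 h.symm
      omega
    · refine altDist_eq_coe hf h2 hd (fun q hq hq' => h3 q hq' hq) fun d' l' h4 h5 h6 => ?_
      have h7 : AltPath M 0 f (d' + 1) t (t :: l') :=
        .cons _ _ _ _ h4 (e.congr (by omega)) fun h => h6 _ h (by simp)
      have key : ∀ {m n x B}, AltPath M m t n x B → ∀ m', m' % 2 = m % 2 →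
          ∃ n', n' + m = n + m' ∧ AltPath M m' t n' x B := by
        intro m n x B hB m' hm
        induction hB with
        | nil => exact ⟨m', by omega, .nil⟩
        | cons n x y B hB e hx ih =>
          obtain ⟨n', h8, h9⟩ := ih
          exact ⟨n' + 1, by omega, .cons _ _ _ _ h9 (e.congr (by omega)) hx⟩
      obtain ⟨n', h8, h9⟩ := key h1 (d' + 1) (by omega)
      obtain ⟨B', -, h10⟩ := h9.append h7 (by
        intro q hq hq'
        rcases List.mem_cons.1 hq' with rfl | hq'
        · rfl
        · exact absurd (by simpa [or_comm] using hq) (h6 q hq'))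
      have := hmin _ _ h10
      omega

theorem IsCut.exists_next {f g : V} {L : ℕ} {i : ℕ} {P : List V} (hc : IsCut M f g L i P)
    (hi : i < L) : ∃ t u P' l, P = t :: P' ∧ AltPath M (L - i) t L g P.reverse ∧
      AltPath M 0 f (L - (i + 1)) u l ∧ LevelEdge M (L - (i + 1)) u t ∧ ∀ q ∈ P, q ∉ l := by
  obtain ⟨t, l, h1, h2, h3⟩ := hc
  have hP : P ≠ [] := by
    rintro rfl
    obtain ⟨l', hl'⟩ := h1.eq_cons
    simp at hl'
  obtain ⟨t', P', rfl⟩ := List.exists_cons_of_ne_nil hP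
  obtain rfl := h1.head_eq
  have hj : L - i = (L - (i + 1)) + 1 := by omega
  rw [hj] at h2
  cases h2 with
  | cons _ _ y l h2 e hx =>
    refine ⟨t, y, P', l, rfl, h1, h2, e, fun q hq hql => ?_⟩
    have := h3 q hq (by simp [hql])
    subst this
    exact hx hql

theorem PredecessorRun.exists_extend {f g : V} {L : ℕ} (hf : Unmatched M f) (hM : M.IsMatching)
    (hL : ∃ l, IsShortestAug M f g L l) {i : ℕ} {P : List V} (hi : i < L)
    (h : PredecessorRun M f g L i P) : ∃ u, PredecessorRun M f g L (i + 1) (u :: P) := by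
  obtain ⟨t, u, P', l, rfl, h1, h2, h3, h4⟩ := (h.isCut hf hM hL).exists_next hi
  obtain ⟨l₀, hl₀, hodd, hmin⟩ := hL
  exact ⟨u, h.extend hf hodd hmin hi h1 h2 h3 h4⟩

theorem PredecessorRun.altPath {f g : V} {L : ℕ} (hf : Unmatched M f) (hM : M.IsMatching)
    (hL : ∃ l, IsShortestAug M f g L l) {P : List V}
    (h : PredecessorRun M f g L L P) : AltPath M 0 f L g P.reverse := by
  obtain ⟨t, l, h1, h2, h3⟩ := h.isCut hf hM hL
  rw [Nat.sub_self] at h1 h2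
  cases h2 with
  | nil => exact h1

/-- Every shortest augmenting path is the outcome of a complete run. -/
theorem IsShortestAug.predecessorRun {f g : V} {L : ℕ} {l : List V} (hf : Unmatched M f)
    (h : IsShortestAug M f g L l) : PredecessorRun M f g L L l.reverse := by
  obtain ⟨h1, hodd, hmin⟩ := h
  have key : ∀ i ≤ L, ∀ t B l', AltPath M (L - i) t L g (B ++ [t]) → AltPath M 0 f (L - i) t l' →
      l = B ++ l' → PredecessorRun M f g L i (t :: B.reverse) := by
    intro i
    induction i with
    | zero =>
      intro _ t B l' h2 h3 _
      generalize hj : L - 0 = j at *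
      obtain rfl : L = j := by omega
      have := h2.length_eq
      obtain rfl : B = [] := by
        rw [← List.length_eq_zero_iff]
        rw [List.length_append, List.length_singleton] at this
        omega
      cases h2 with
      | nil => exact .start
      | cons n x y l h => have := h.le; omega
    | succ i ih =>
      intro hi t B l' h2 h3 hl
      have hnd := h1.nodup
      rw [hl, List.nodup_append] at hnd
      -- the node before `t` on the path towards `g`
      obtain ⟨s, B', l'', h4, h5, h6⟩ := h2.split (L - i) (by omega) (by omega)
      have hj : L - i = (L - (i + 1)) + 1 := by omega
      rw [hj] at h5
      generalize hr : L - (i + 1) = r at *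
      cases h5 with
      | cons _ _ y l3 h5 e hx =>
        generalize hr' : r = r' at h5
        cases h5 with
        | cons n _ _ _ h _ _ => have := h.le; omega
        | nil =>
          have hB : B = B' ++ [s] := by
            have h7 : B ++ [t] = (B' ++ [s]) ++ [t] := by simpa using h6
            exact List.append_cancel_right h7
          subst hB
          have h8 : s ∉ l' := fun hs => hnd.2.2 s (by simp) s hs rfl
          have h9 := ih (by omega) s B' (s :: l') h4 (by
            rw [hj]
            exact .cons _ _ _ _ h3 e h8) (by simp [hl])
          have := h9.extend hf hodd hmin (by omega) (by simpa using h4) (by rw [hr]; exact h3)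
            (by rw [hr]; exact e) (by
            intro q hq hql
            refine hnd.2.2 q ?_ q hql rfl
            simpa [or_comm] using hq)
          simpa using this
  obtain ⟨t, B, l', h2, h3, rfl⟩ := h1.split 0 le_rfl (Nat.zero_le _)
  cases h3 with
  | nil =>
    simpa using key L le_rfl f B [f] (by rw [Nat.sub_self]; exact h2)
      (by rw [Nat.sub_self]; exact .nil) rfl

end AltPath

/-! ### Labels, search tree and bridges -/

/-- The data that the search from the unmatched node `f` leaves behind. Every node `v` has at most
one label `n` of each parity, meaning that an alternating path of length `n` leads from `f` to `v`.
The smaller label is the *rank* of `v`; `par v` is the predecessor through which it was found, so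
that the parents form a tree rooted at `f`. The other label comes from an edge leaving the subtree
of `v`, namely from the edge between `bridgeIn v`, in the subtree, and `bridgeOut v`, outside of
it. All labels are at most `N`, and `K > N` serves as the base of lexicographic keys. -/
structure SearchData {V : Type*} {G : SimpleGraph V} (M : G.Subgraph) (f : V) (N K : ℕ) where
  lab : V → ℕ → Prop
  rank : V → ℕ
  par : V → V
  bridgeIn : V → V
  bridgeOut : V → V
  labIn : V → ℕ
  labOut : V → ℕ

namespace SearchData

variable {V : Type*} {G : SimpleGraph V} {M : G.Subgraph} {f : V} {N K : ℕ}

/-- `x` belongs to the subtree of `v`. -/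
inductive Desc (D : SearchData M f N K) (v : V) : V → Prop
  | refl : Desc D v v
  | step (x : V) : x ≠ f → Desc D v (D.par x) → Desc D v x

/-- The edge `xy`, with label `m` at `x` and label `n` at `y`, leaves the subtree of `v`. The labels
are such that the edge closes an alternating walk from `f` to `f` of length `m + n + 1`. -/
structure Outgoing (D : SearchData M f N K) (v x y : V) (m n : ℕ) : Prop where
  inside : D.Desc v x
  outside : ¬ D.Desc v y
  lab_in : D.lab x m
  lab_out : D.lab y n
  parity : m % 2 = n % 2
  edge : LevelEdge M m x y

/-- Edges are compared by the length `m + n + 1` of the walk that they close, and then by the larger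
one of the two labels. -/
def key (K m n : ℕ) : ℕ := (m + n + 1) * K + max m n

/-- The properties of the search data from which both the correctness of the labels and the
reconstruction of the paths follow. -/
structure Valid (D : SearchData M f N K) : Prop where
  lt_base : N < K
  lab_le : ∀ {v n}, D.lab v n → n ≤ N
  lab_root : ∀ {n}, D.lab f n ↔ n = 0
  lab_unique : ∀ {v m n}, D.lab v m → D.lab v n → m % 2 = n % 2 → m = n
  lab_rank : ∀ {v n}, D.lab v n → D.lab v (D.rank v)
  rank_le : ∀ {v n}, D.lab v n → D.rank v ≤ n
  lab_par : ∀ {v n}, D.lab v n → v ≠ f →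
    ∃ k, D.rank v = k + 1 ∧ D.lab (D.par v) k ∧ LevelEdge M k (D.par v) v
  extend : ∀ {y v n}, D.lab y n → n + 1 ≤ N → LevelEdge M n y v → ∃ m, D.lab v m ∧ m ≤ n + 1
  exists_second : ∀ {v x y m n}, D.Outgoing v x y m n → m + n + 1 ≤ N + D.rank v →
    ∃ j, D.lab v j ∧ j ≠ D.rank v ∧ j + D.rank v ≤ m + n + 1
  exists_outgoing : ∀ {v j}, D.lab v j → j ≠ D.rank v →
    ∃ x y m n, D.Outgoing v x y m n ∧ m + n + 1 = j + D.rank v ∧ m < j ∧ n < j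
  bridge_outgoing : ∀ {v j}, D.lab v j → j ≠ D.rank v →
    D.Outgoing v (D.bridgeIn v) (D.bridgeOut v) (D.labIn v) (D.labOut v)
  bridge_min : ∀ {v x y j m n}, D.lab v j → j ≠ D.rank v → D.Outgoing v x y m n →
    key K (D.labIn v) (D.labOut v) ≤ key K m n

variable {D : SearchData M f N K}

namespace Desc

theorem trans {u v x : V} (h : D.Desc v x) (h' : D.Desc u v) : D.Desc u x := by
  induction h with
  | refl => exact h'
  | step x hx _ ih => exact .step x hx ih

theorem comparable {u v z : V} (hv : D.Desc v z) (hu : D.Desc u z) : D.Desc v u ∨ D.Desc u v := by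
  induction hv with
  | refl => exact .inr hu
  | step z hz h ih =>
    cases hu with
    | refl => exact .inl (.step _ hz h)
    | step _ _ h' => exact ih h'

theorem par_of_ne {v x : V} (h : D.Desc v x) (hne : x ≠ v) : D.Desc v (D.par x) := by
  cases h with
  | refl => exact absurd rfl hne
  | step _ _ h => exact h

theorem ne_root {v x : V} (h : D.Desc v x) (hne : x ≠ v) : x ≠ f := by
  cases h with
  | refl => exact absurd rfl hne
  | step _ h _ => exact h

theorem eq_root {v : V} (h : D.Desc v f) : v = f := by
  cases h with
  | refl => rfl
  | step _ h _ => exact absurd rfl h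

end Desc

theorem key_lt_of {m n m' n' : ℕ} (h : m + n + 1 < m' + n' + 1 ∨
    (m + n + 1 = m' + n' + 1 ∧ max m n < max m' n')) (hK : max m n < K) :
    key K m n < key K m' n' := by
  unfold key
  rcases h with h | ⟨h, h'⟩
  · calc (m + n + 1) * K + max m n < (m + n + 1) * K + K := by omega
      _ = (m + n + 1 + 1) * K := by ring
      _ ≤ (m' + n' + 1) * K := Nat.mul_le_mul_right _ h
      _ ≤ _ := Nat.le_add_right _ _
  · rw [h]; omega

theorem key_comm (m n : ℕ) : key K m n = key K n m := by
  unfold key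
  rw [max_comm, Nat.add_comm m n]

theorem Outgoing.symm_of {v x y : V} {m n : ℕ} (hx : ¬ D.Desc v x) (hy : D.Desc v y)
    (lx : D.lab x m) (ly : D.lab y n) (p : m % 2 = n % 2) (e : LevelEdge M m x y) :
    D.Outgoing v y x n m :=
  ⟨hy, hx, ly, lx, p.symm, e.symm.congr p.symm⟩

/-- The key of the last bridge used by the path that belongs to the label `n` of `x` (`0` if there
is none). -/
def lastKey (D : SearchData M f N K) : ℕ → V → ℕ
  | 0, _ => 0
  | n + 1, x => if D.rank x = n + 1 then lastKey D n (D.par x) else key K (D.labIn x) (D.labOut x)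

/-- `D.Seg v x n Q`: the reversed list `Q` is the part after `v` of the path that belongs to the
label `n` of the node `x` in the subtree of `v`. If `n` is the rank of `x`, the path comes from the
parent of `x`. Otherwise it goes to the outer end of the bridge of `x`, and then backwards along the
path from `x` to the inner end. -/
inductive Seg (D : SearchData M f N K) : V → V → ℕ → List V → Prop
  | nil (v : V) : D.lab v (D.rank v) → Seg D v v (D.rank v) []
  | first (v x : V) (n : ℕ) (Q : List V) : x ≠ v → x ≠ f → D.lab x (n + 1) → D.rank x = n + 1 →
      Seg D v (D.par x) n Q → Seg D v x (n + 1) (x :: Q)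
  | second (v x : V) (j : ℕ) (Q Q' : List V) : x ≠ v → x ≠ f → D.lab x j → j ≠ D.rank x →
      D.Desc v x → Seg D v (D.bridgeOut x) (D.labOut x) Q → Seg D x (D.bridgeIn x) (D.labIn x) Q' →
      Seg D v x j (x :: (Q'.reverse ++ Q))

theorem lastKey_of_first {x : V} {n : ℕ} (hr : D.rank x = n + 1) :
    D.lastKey (n + 1) x = D.lastKey n (D.par x) := by
  simp [lastKey, hr]

namespace Valid

theorem parity_ne (h : D.Valid) {v : V} {j : ℕ} (hj : D.lab v j) (hne : j ≠ D.rank v) :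
    j % 2 ≠ D.rank v % 2 :=
  fun e => hne (h.lab_unique hj (h.lab_rank hj) e)

theorem reached_of_desc (h : D.Valid) {v x : V} (hd : D.Desc v x) :
    ∀ {n}, D.lab x n → D.lab v (D.rank v) ∧ (x ≠ v → D.rank v < D.rank x) := by
  induction hd with
  | refl => exact fun hl => ⟨h.lab_rank hl, fun hn => absurd rfl hn⟩
  | step x hx _ ih =>
    intro n hl
    obtain ⟨k, hk, hlk, -⟩ := h.lab_par hl hx
    obtain ⟨h1, h2⟩ := ih hlk
    refine ⟨h1, fun _ => ?_⟩
    have h3 := h.rank_le hlk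
    by_cases he : D.par x = v
    · rw [he] at h3; omega
    · have := h2 he; omega

theorem desc_root (h : D.Valid) : ∀ (r : ℕ) {x : V} {n : ℕ}, D.lab x n → D.rank x = r →
    D.Desc f x := by
  intro r
  induction r using Nat.strong_induction_on with
  | _ r ih =>
    intro x n hl hr
    by_cases hx : x = f
    · subst hx; exact .refl
    · obtain ⟨k, hk, hlk, -⟩ := h.lab_par hl hx
      have h3 := h.rank_le hlk
      exact .step x hx (ih _ (by omega) hlk rfl)

theorem desc_antisymm (h : D.Valid) {v x : V} {n : ℕ} (hl : D.lab x n) (h1 : D.Desc v x)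
    (h2 : D.Desc x v) : x = v := by
  by_contra hne
  obtain ⟨h3, h4⟩ := h.reached_of_desc h1 hl
  have := (h.reached_of_desc h2 h3).2 (Ne.symm hne)
  have := h4 hne
  omega

/-- The two labels of a node determine the length of the walk closed by its bridge. -/
theorem bridge_spec (h : D.Valid) {v : V} {j : ℕ} (hl : D.lab v j) (hj : j ≠ D.rank v) :
    D.labIn v + D.labOut v + 1 = j + D.rank v ∧ D.labIn v < j ∧ D.labOut v < j := by
  have ho := h.bridge_outgoing hl hj
  obtain ⟨x, y, m, n, h1, h2, h3, h4⟩ := h.exists_outgoing hl hj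
  have hmin := h.bridge_min hl hj h1
  have hN := h.lab_le hl
  have hge : j + D.rank v ≤ D.labIn v + D.labOut v + 1 := by
    by_contra hlt
    obtain ⟨j', h5, h6, h7⟩ := h.exists_second ho (by omega)
    have h8 := h.parity_ne hl hj
    have h9 := h.parity_ne h5 h6
    have := h.lab_unique hl h5 (by omega)
    omega
  have hB := h.lt_base
  have a1 := h.lab_le h1.lab_in
  have a2 := h.lab_le h1.lab_out
  have hle : ¬ key K m n < key K (D.labIn v) (D.labOut v) := by omega
  have h5 : ¬ (m + n + 1 < D.labIn v + D.labOut v + 1 ∨ (m + n + 1 = D.labIn v + D.labOut v + 1 ∧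
      max m n < max (D.labIn v) (D.labOut v))) :=
    fun h6 => hle (key_lt_of h6 (by omega))
  omega

theorem rank_le_of_edge (h : D.Valid) {x y : V} {k m n : ℕ} (hx : D.lab x m) (hy : D.lab y n)
    (e : LevelEdge M k x y) (hk : k % 2 = n % 2) : D.rank x ≤ n + 1 := by
  by_cases hn : n + 1 ≤ N
  · obtain ⟨m', h1, h2⟩ := h.extend hy hn (e.symm.congr hk.symm)
    exact (h.rank_le h1).trans h2
  · have := h.lab_le (h.lab_rank hx)
    omega

theorem lastKey_of_second (h : D.Valid) {x : V} {n : ℕ} (hl : D.lab x n) (hr : n ≠ D.rank x) :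
    D.lastKey n x = key K (D.labIn x) (D.labOut x) := by
  have := h.rank_le hl
  obtain ⟨n, rfl⟩ : ∃ k, n = k + 1 := ⟨n - 1, by omega⟩
  simp [lastKey, Ne.symm hr]

theorem lastKey_le (h : D.Valid) : ∀ {n : ℕ} {x : V}, D.lab x n → D.lastKey n x ≤ 2 * n * K := by
  intro n
  induction n with
  | zero => intro x _; simp [lastKey]
  | succ n ih =>
    intro x hl
    by_cases hr : D.rank x = n + 1
    · rw [lastKey_of_first hr]
      have hx : x ≠ f := by
        rintro rfl
        have := h.lab_root.1 hl
        omega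
      obtain ⟨k, hk, hlk, -⟩ := h.lab_par hl hx
      obtain rfl : k = n := by omega
      exact (ih hlk).trans (Nat.mul_le_mul_right _ (by omega))
    · rw [h.lastKey_of_second hl (Ne.symm hr)]
      obtain ⟨h1, h2, h3⟩ := h.bridge_spec hl (Ne.symm hr)
      have h4 := h.rank_le hl
      have hN := h.lab_le hl
      have hB := h.lt_base
      unfold key
      calc (D.labIn x + D.labOut x + 1) * K + max (D.labIn x) (D.labOut x)
          ≤ (2 * n + 1) * K + K := Nat.add_le_add (Nat.mul_le_mul_right _ (by omega)) (by omega)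
        _ = 2 * (n + 1) * K := by ring

/-- The bridges of the paths that meet at an edge have smaller keys than this edge. It is for this
fact that keys have a second component. -/
theorem lastKey_lt (h : D.Valid) {x y : V} {m n : ℕ} (hx : D.lab x m) (hy : D.lab y n)
    (hp : m % 2 = n % 2) (e : LevelEdge M m x y) : D.lastKey m x < key K m n := by
  have hr := h.rank_le_of_edge hx hy e hp
  have hB := h.lt_base
  have hN := h.lab_le hx
  by_cases hm : m = D.rank x
  · rcases m with _ | m
    · simp only [lastKey]
      unfold key
      have : 0 < (0 + n + 1) * K := Nat.mul_pos (by omega) (by omega)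
      omega
    · rw [lastKey_of_first hm.symm]
      have hxf : x ≠ f := by
        rintro rfl
        have := h.lab_root.1 hx
        omega
      obtain ⟨k, hk, hlk, -⟩ := h.lab_par hx hxf
      obtain rfl : k = m := by omega
      have h1 := h.lastKey_le hlk
      have h2 : 2 * k * K + K ≤ (k + 1 + n + 1) * K := by
        calc 2 * k * K + K = (2 * k + 1) * K := by ring
          _ ≤ _ := Nat.mul_le_mul_right _ (by omega)
      unfold key
      omega
  · rw [h.lastKey_of_second hx hm]
    obtain ⟨h1, h2, h3⟩ := h.bridge_spec hx hm
    refine key_lt_of ?_ (by omega)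
    omega

theorem lastKey_bridgeIn (h : D.Valid) {x : V} {j : ℕ} (hl : D.lab x j) (hj : j ≠ D.rank x) :
    D.lastKey (D.labIn x) (D.bridgeIn x) < key K (D.labIn x) (D.labOut x) := by
  have ho := h.bridge_outgoing hl hj
  exact h.lastKey_lt ho.lab_in ho.lab_out ho.parity ho.edge

theorem lastKey_bridgeOut (h : D.Valid) {x : V} {j : ℕ} (hl : D.lab x j) (hj : j ≠ D.rank x) :
    D.lastKey (D.labOut x) (D.bridgeOut x) < key K (D.labIn x) (D.labOut x) := by
  have ho := h.bridge_outgoing hl hj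
  rw [key_comm]
  exact h.lastKey_lt ho.lab_out ho.lab_in ho.parity.symm (ho.edge.symm.congr ho.parity.symm)

end Valid

/-- Every edge leaving the subtree of `v` has a key greater than `k`. -/
def KeyBelow (D : SearchData M f N K) (v : V) (k : ℕ) : Prop :=
  ∀ x y m n, D.Outgoing v x y m n → k < key K m n

namespace Valid

theorem keyBelow_of_second (h : D.Valid) {x : V} {j k : ℕ} (hl : D.lab x j) (hj : j ≠ D.rank x)
    (hk : k < key K (D.labIn x) (D.labOut x)) : D.KeyBelow x k :=
  fun _ _ _ _ ho => hk.trans_le (h.bridge_min hl hj ho)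

theorem eq_rank_of_keyBelow (h : D.Valid) {v : V} {n : ℕ} (hl : D.lab v n)
    (hk : D.KeyBelow v (D.lastKey n v)) : n = D.rank v := by
  by_contra hn
  have := hk _ _ _ _ (h.bridge_outgoing hl hn)
  rw [h.lastKey_of_second hl hn] at this
  omega

/-- A path that belongs to a label of `x` passes through the ancestor `v` of `x`, provided that its
last bridge is too small to lead into the subtree of `v`. -/
theorem exists_seg (h : D.Valid) : ∀ (n : ℕ) {x : V}, D.lab x n → ∀ {v : V}, D.Desc v x →
    D.KeyBelow v (D.lastKey n x) → ∃ Q, D.Seg v x n Q := by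
  intro n
  induction n using Nat.strong_induction_on with
  | _ n ih =>
    intro x hl v hd hk
    by_cases hxv : x = v
    · subst hxv
      obtain rfl := h.eq_rank_of_keyBelow hl hk
      exact ⟨[], .nil x hl⟩
    · have hxf := hd.ne_root hxv
      by_cases hr : n = D.rank x
      · obtain ⟨k, hk', hlk, -⟩ := h.lab_par hl hxf
        obtain rfl : n = k + 1 := by omega
        rw [lastKey_of_first hk'] at hk
        obtain ⟨Q, hQ⟩ := ih k (by omega) hlk (hd.par_of_ne hxv) hk
        exact ⟨x :: Q, .first v x k Q hxv hxf hl hk' hQ⟩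
      · have ho := h.bridge_outgoing hl hr
        obtain ⟨h1, h2, h3⟩ := h.bridge_spec hl hr
        rw [h.lastKey_of_second hl hr] at hk
        have hout : D.Desc v (D.bridgeOut x) := by
          by_contra hn
          exact lt_irrefl _ (hk _ _ _ _ ⟨ho.inside.trans hd, hn, ho.lab_in, ho.lab_out, ho.parity,
            ho.edge⟩)
        obtain ⟨Q, hQ⟩ := ih _ h3 ho.lab_out hout fun _ _ _ _ ho' =>
          (h.lastKey_bridgeOut hl hr).trans (hk _ _ _ _ ho')
        obtain ⟨Q', hQ'⟩ := ih _ h2 ho.lab_in ho.inside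
          (h.keyBelow_of_second hl hr (h.lastKey_bridgeIn hl hr))
        exact ⟨_, .second v x n Q Q' hxv hxf hl hr hd hQ hQ'⟩

end Valid

namespace Seg

theorem desc {v x : V} {n : ℕ} {Q : List V} (hs : D.Seg v x n Q) : D.Desc v x := by
  induction hs with
  | nil => exact .refl
  | first v x n Q _ hxf _ _ _ ih => exact .step x hxf ih
  | second v x j Q Q' _ _ _ _ hd _ _ _ _ => exact hd

theorem desc_of_mem (h : D.Valid) {v x : V} {n : ℕ} {Q : List V} (hs : D.Seg v x n Q) :
    ∀ q ∈ Q, D.Desc v q ∧ q ≠ v := by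
  induction hs with
  | nil => simp
  | first v x n Q hxv hxf hl hr hs ih =>
    intro q hq
    rcases List.mem_cons.1 hq with rfl | hq
    · exact ⟨.step q hxf hs.desc, hxv⟩
    · exact ih q hq
  | second v x j Q Q' hxv hxf hl hr hd hs hs' ih ih' =>
    intro q hq
    simp only [List.mem_cons, List.mem_append, List.mem_reverse] at hq
    rcases hq with rfl | hq | hq
    · exact ⟨hd, hxv⟩
    · obtain ⟨h1, -⟩ := ih' q hq
      refine ⟨h1.trans hd, ?_⟩
      rintro rfl
      exact hxv (h.desc_antisymm hl hd h1)
    · exact ih q hq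

/-- A path avoids the subtree of `v` if it ends outside of it and its last bridge is too small to
lead into the subtree. -/
theorem avoids (h : D.Valid) {u y : V} {n : ℕ} {Q : List V} (hs : D.Seg u y n Q) :
    ∀ {v : V}, ¬ D.Desc v y → D.KeyBelow v (D.lastKey n y) → ∀ q ∈ Q, ¬ D.Desc v q := by
  induction hs with
  | nil => simp
  | first u x n Q hxu hxf hl hr hs ih =>
    intro v hv hk q hq
    rcases List.mem_cons.1 hq with rfl | hq
    · exact hv
    · rw [lastKey_of_first hr] at hk
      exact ih (fun hd => hv (.step x hxf hd)) hk q hq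
  | second u x j Q Q' hxu hxf hl hr hd hs hs' ih ih' =>
    intro v hv hk q hq
    have ho := h.bridge_outgoing hl hr
    rw [h.lastKey_of_second hl hr] at hk
    have h1 : D.Desc v (D.bridgeIn x) ↔ D.Desc v (D.bridgeOut x) := by
      constructor
      · intro h2
        by_contra h3
        exact lt_irrefl _ (hk _ _ _ _ ⟨h2, h3, ho.lab_in, ho.lab_out, ho.parity, ho.edge⟩)
      · intro h2
        by_contra h3
        have := hk _ _ _ _ (Outgoing.symm_of h3 h2 ho.lab_in ho.lab_out ho.parity ho.edge)
        rw [key_comm] at this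
        exact lt_irrefl _ this
    have h2 : ¬ D.Desc v (D.bridgeIn x) := by
      intro h2
      rcases h2.comparable ho.inside with h3 | h3
      · exact hv h3
      · exact ho.outside ((h1.1 h2).trans h3)
    simp only [List.mem_cons, List.mem_append, List.mem_reverse] at hq
    rcases hq with rfl | hq | hq
    · exact hv
    · exact ih' h2 (fun _ _ _ _ ho' => (h.lastKey_bridgeIn hl hr).trans (hk _ _ _ _ ho')) q hq
    · exact ih (fun h3 => h2 (h1.2 h3))
        (fun _ _ _ _ ho' => (h.lastKey_bridgeOut hl hr).trans (hk _ _ _ _ ho')) q hq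

theorem rank_le_of_mem (h : D.Valid) {v x : V} {n : ℕ} {Q : List V} (hs : D.Seg v x n Q) :
    ∀ q ∈ Q, D.rank q ≤ n := by
  induction hs with
  | nil => simp
  | first v x n Q _ _ hl hr hs ih =>
    intro q hq
    rcases List.mem_cons.1 hq with rfl | hq
    · omega
    · have := ih q hq; omega
  | second v x j Q Q' _ _ hl hr _ _ _ ih ih' =>
    intro q hq
    obtain ⟨-, h2, h3⟩ := h.bridge_spec hl hr
    simp only [List.mem_cons, List.mem_append, List.mem_reverse] at hq
    rcases hq with rfl | hq | hq
    · exact h.rank_le hl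
    · have := ih' q hq; omega
    · have := ih q hq; omega

theorem altPath (h : D.Valid) {v x : V} {n : ℕ} {Q : List V} (hs : D.Seg v x n Q) :
    AltPath M (D.rank v) v n x (Q ++ [v]) := by
  induction hs with
  | nil => exact .nil
  | first v x n Q hxv hxf hl hr hs ih =>
    obtain ⟨k, hk, hlk, e⟩ := h.lab_par hl hxf
    obtain rfl : k = n := by omega
    refine .cons _ _ _ _ ih e ?_
    intro hx
    rcases List.mem_append.1 hx with hx | hx
    · -- the nodes of `Q` are labelled by smaller numbers than the rank of `x`
      have := hs.rank_le_of_mem h x hx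
      omega
    · exact hxv (List.mem_singleton.1 hx)
  | second v x j Q Q' hxv hxf hl hr hd hs hs' ih ih' =>
    have ho := h.bridge_outgoing hl hr
    obtain ⟨h1, h2, h3⟩ := h.bridge_spec hl hr
    have h4 := ih'.append_reverse ih (ho.edge.symm.congr ho.parity.symm) ho.parity.symm (by
      intro q hq hq'
      have hq1 : D.Desc x q := by
        rcases List.mem_append.1 hq with hq | hq
        · exact (hs'.desc_of_mem h q hq).1
        · rw [List.mem_singleton.1 hq]; exact .refl
      rcases List.mem_append.1 hq' with hq' | hq'
      · exact hs.avoids h ho.outside (h.keyBelow_of_second hl hr (h.lastKey_bridgeOut hl hr)) q hq'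
          hq1
      · rw [List.mem_singleton.1 hq'] at hq1
        exact hxv (h.desc_antisymm hl hd hq1))
    have h5 : D.labOut x + 1 + (D.labIn x - D.rank x) = j := by
      have := ih'.le
      omega
    rw [h5] at h4
    simpa using h4

theorem length_eq (h : D.Valid) {v x : V} {n : ℕ} {Q : List V} (hs : D.Seg v x n Q) :
    Q.length + D.rank v = n := by
  have := (hs.altPath h).length_eq
  simp only [List.length_append, List.length_singleton] at this
  omega

end Seg

namespace Valid

theorem rank_root (h : D.Valid) : D.rank f = 0 :=
  h.lab_root.1 (h.lab_rank (h.lab_root.2 rfl))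

theorem exists_seg_root (h : D.Valid) {x : V} {n : ℕ} (hl : D.lab x n) : ∃ Q, D.Seg f x n Q := by
  refine h.exists_seg n hl (h.desc_root _ hl rfl) ?_
  intro y z m n ho
  exact absurd (h.desc_root _ ho.lab_out rfl) ho.outside

/-- Labels are lengths of alternating paths. -/
theorem exists_altPath (h : D.Valid) {x : V} {n : ℕ} (hl : D.lab x n) :
    ∃ l, AltPath M 0 f n x l := by
  obtain ⟨Q, hQ⟩ := h.exists_seg_root hl
  have := hQ.altPath h
  rw [h.rank_root] at this
  exact ⟨_, this⟩

/-- Labels bound the lengths of alternating paths from below. If the last edge `yv` of a shortest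
counterexample comes from within the subtree of `v`, let `z'z` be the edge by which the path enters
this subtree for the last time. Going to `v` first and then backwards to `z` is a shorter path, so
`z` has labels of both parities, and the edge `z'z` provides the label of `v`. -/
theorem exists_lab_le (h : D.Valid) : ∀ {m : ℕ}, m ≤ N → ∀ {v : V} {l : List V},
    AltPath M 0 f m v l → ∃ j, D.lab v j ∧ j % 2 = m % 2 ∧ j ≤ m := by
  intro m
  induction m using Nat.strong_induction_on with
  | _ m ih =>
    intro hm v l hp
    cases hp with
    | nil => exact ⟨0, h.lab_root.2 rfl, rfl, le_rfl⟩
    | cons m v y l hp e hv =>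
      obtain ⟨d, hd, hd2, hdm⟩ := ih m (by omega) (by omega) hp
      obtain ⟨i, hi, him⟩ := h.extend hd (by omega) (e.congr hd2)
      have hvl := h.lab_rank hi
      have hrm : D.rank v ≤ m + 1 := (h.rank_le hi).trans (by omega)
      have hvf : v ≠ f := fun hvf => hv (hvf ▸ hp.start_mem)
      by_cases hpar : D.rank v % 2 = (m + 1) % 2
      · exact ⟨_, hvl, hpar, hrm⟩
      · have hsecond : ∀ x y a b, D.Outgoing v x y a b → a + b + 1 ≤ D.rank v + (m + 1) →
            ∃ j, D.lab v j ∧ j % 2 = (m + 1) % 2 ∧ j ≤ m + 1 := by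
          intro x y a b ho hab
          obtain ⟨j, h1, h2, h3⟩ := h.exists_second ho (by omega)
          have := h.parity_ne h1 h2
          exact ⟨j, h1, by omega, by omega⟩
        by_cases hy : D.Desc v y
        · obtain ⟨j, z, z', B, P, h1, h2, h3, h4, h5, rfl⟩ :=
            hp.split_last_entry {x | D.Desc v x} hy fun hd => hvf (Desc.eq_root hd)
          have hle := h4.le
          obtain ⟨P₁, hP₁⟩ := h.exists_altPath hvl
          have h6 := h4.append_reverse hP₁ (e.symm.congr (by omega)) (by omega) (by
            intro q hq hq'
            have hqv : q ≠ v := by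
              rintro rfl
              exact hv (List.mem_append_left _ hq)
            obtain ⟨i, l', h7, -, h8⟩ := hP₁.exists_prefix hq'
            have h9 := h8 hqv
            obtain ⟨i', h10, -, h11⟩ := ih i (by omega) (by omega) h7
            have h12 := (h.reached_of_desc (h5 q hq) h10).2 hqv
            have h13 := h.rank_le h10
            omega)
          have hz : AltPath M 0 f (j + 1) z (z :: P) := by
            refine .cons _ _ _ _ h1 h3 fun hz => ?_
            have := hp.nodup
            rw [List.nodup_append] at this
            exact this.2.2 z h4.start_mem z hz rfl
          obtain ⟨a, h7, -, h8⟩ := ih (j + 1) (by omega) (by omega) hz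
          have hzv : z ≠ v := by
            rintro rfl
            exact hv (List.mem_append_left _ h4.start_mem)
          have h9 := (h.reached_of_desc (h5 z h4.start_mem) h7).2 hzv
          have h10 := h.rank_le h7
          obtain ⟨b, h11, h12, h13⟩ := ih _ (by omega) (by omega) h6
          obtain ⟨c, h14, h15, h16⟩ := ih j (by omega) (by omega) h1
          refine hsecond z z' b c ⟨h5 z h4.start_mem, h2, h11, h14, by omega,
            h3.symm.congr (by omega)⟩ (by omega)
        · exact hsecond v y _ d ⟨.refl, hy, hvl, hd, by omega, e.symm.congr (by omega)⟩ (by omega)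

/-- The label of the other unmatched node is the length of a shortest augmenting path. -/
theorem isShortestAug (h : D.Valid) {g : V} {L : ℕ}
    (hL : ∃ l, IsShortestAug M f g L l) (hN : L ≤ N) :
    D.lab g L ∧ ∀ Q, D.Seg f g L Q → IsShortestAug M f g L (Q ++ [f]) := by
  obtain ⟨l, h1, h2, h3⟩ := hL
  obtain ⟨j, h4, h5, h6⟩ := h.exists_lab_le hN h1
  obtain ⟨l', h7⟩ := h.exists_altPath h4
  obtain rfl : j = L := le_antisymm h6 (h3 _ _ h7)
  refine ⟨h4, fun Q hQ => ⟨?_, h2, h3⟩⟩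
  have := hQ.altPath h
  rwa [h.rank_root] at this

end Valid

end SearchData

/-! ### Computing the labels by exchanging records -/

open Classical in
/-- What the node `v` hears if every node `w` tells its neighbours the value `x w`, indexed by the
identifiers of the senders. -/
noncomputable def heard {V α : Type*} (G : SimpleGraph V) (ident : V → ℕ) (x : V → α) (v : V)
    (k : ℕ) : Option α :=
  if h : ∃ w, G.Adj v w ∧ ident w = k then some (x h.choose) else none

theorem heard_eq_some {V α : Type*} {G : SimpleGraph V} {ident : V → ℕ}
    (hid : Function.Injective ident) {x : V → α} {v : V} {k : ℕ} {a : α} :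
    heard G ident x v k = some a ↔ ∃ w, G.Adj v w ∧ ident w = k ∧ x w = a := by
  unfold heard
  split_ifs with h
  · have h1 := h.choose_spec
    constructor
    · intro h2
      exact ⟨_, h1.1, h1.2, Option.some.inj h2⟩
    · rintro ⟨w, h2, h3, rfl⟩
      rw [hid (h3.trans h1.2.symm)]
  · simp only [false_iff]
    rintro ⟨w, h2, h3, -⟩
    exact h ⟨w, h2, h3⟩

/-- The record that a node keeps during the search: its two labels, its depth in the search tree,
its ancestors (`anc i` is the identifier of the ancestor of depth `i`, increased by one, and `0`
beyond the depth of the node), and a table of the edges that leave subtrees: `tok k` is the smallest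
depth at which the ancestors of the two ends of an edge `xy` diverge, among the known edges that
have `x` in the subtree of the node and close a walk of length `k`. -/
@[ext] structure Rec where
  fst : Option ℕ
  snd : Option ℕ
  dep : ℕ
  anc : ℕ → ℕ
  tok : ℕ → ℕ

namespace Rec

/-- `n` is one of the two labels in the record. -/
def Has (R : Rec) (n : ℕ) : Prop := R.fst = some n ∨ R.snd = some n

/-- The edge to the neighbour `k` may be edge number `m` of an alternating path, where `lb` is the
set of the neighbours to which there is an edge of the matching. -/
def Fits (lb : Set ℕ) (m k : ℕ) : Prop := k ∈ lb ↔ m % 2 = 1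

/-- The depth at which two lists of ancestors diverge. -/
noncomputable def diverge (A B : ℕ → ℕ) : ℕ := sInf {i | A i ≠ B i}

/-- `R'` is the record of a child of the node `self` with record `R`. -/
def IsChild (self : ℕ) (R R' : Rec) : Prop := R'.dep = R.dep + 1 ∧ R'.anc R.dep = self + 1

/-- The neighbour `k` has the label `s`, which may be extended by an edge to the present node. -/
def Offers (lb : Set ℕ) (s : ℕ) (nbr : ℕ → Option Rec) (k : ℕ) : Prop :=
  ∃ R', nbr k = some R' ∧ R'.Has s ∧ Fits lb s k

/-- An edge that leaves the subtree of the node gives it the second label `s + 1`. -/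
def GetsSecond (self : ℕ) (lb : Set ℕ) (s : ℕ) (R : Rec) (nbr : ℕ → Option Rec) : Prop :=
  ∃ m, R.fst = some m ∧ ∃ k R', nbr k = some R' ∧
    ((R'.Has s ∧ m % 2 = s % 2 ∧ Fits lb m k ∧ diverge R.anc R'.anc ≤ R.dep) ∨
      (IsChild self R R' ∧ R'.tok (s + 1 + m) ≤ R.dep))

open Classical in
/-- The node looks for the label `s + 1`, given the records of its neighbours. -/
noncomputable def relabel (self : ℕ) (lb : Set ℕ) (s : ℕ) (R : Rec) (nbr : ℕ → Option Rec) : Rec :=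
  if R.fst = none then
    if ∃ k, Offers lb s nbr k then
      let R' := (nbr (sInf {k | Offers lb s nbr k})).getD R
      { fst := some (s + 1), snd := none, dep := R'.dep + 1,
        anc := fun i => if i = R'.dep + 1 then self + 1 else R'.anc i, tok := R.tok }
    else R
  else if R.snd = none ∧ GetsSecond self lb s R nbr then { R with snd := some (s + 1) }
  else R

/-- The depth `β` at which the ancestors of the ends of some edge diverge, where the edge has one
end in the subtree of the node and closes a walk of length `k`. -/
def IsToken (self : ℕ) (lb : Set ℕ) (R : Rec) (nbr : ℕ → Option Rec) (k β : ℕ) : Prop :=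
  ∃ q R', nbr q = some R' ∧
    ((∃ m n, R.Has m ∧ R'.Has n ∧ m % 2 = n % 2 ∧ Fits lb m q ∧ k = m + n + 1 ∧
      β = diverge R.anc R'.anc) ∨ (IsChild self R R' ∧ β = R'.tok k))

/-- One level of the search. The table uses the new labels of the node itself, but the old ones of
its neighbours. The value `top` stands for the absence of an edge. -/
noncomputable def update (top self : ℕ) (lb : Set ℕ) (s : ℕ) (R : Rec) (nbr : ℕ → Option Rec) :
    Rec :=
  { relabel self lb s R nbr with
    tok := fun k => sInf {β | β = top ∨ IsToken self lb (relabel self lb s R nbr) nbr k β} }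

/-- The record of the root, respectively of the other nodes, before the search. -/
def start (top self : ℕ) (root : Prop) [Decidable root] : Rec :=
  if root then { fst := some 0, snd := none, dep := 0, anc := fun i => if i = 0 then self + 1 else 0,
                 tok := fun _ => top }
  else { fst := none, snd := none, dep := 0, anc := fun _ => 0, tok := fun _ => top }

end Rec

open Rec

open Classical in
/-- The records after `s` levels of the search from `f`. -/
noncomputable def recAt {V : Type*} {G : SimpleGraph V} (M : G.Subgraph) (ident : V → ℕ) (f : V)
    (top : ℕ) : ℕ → V → Rec
  | 0, v => Rec.start top (ident v) (v = f)
  | s + 1, v => update top (ident v) (ident '' M.neighborSet v) s (recAt M ident f top s v)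
      (heard G ident (recAt M ident f top s) v)

section Search

variable {V : Type*} {G : SimpleGraph V} {M : G.Subgraph} {ident : V → ℕ} {f : V} {top : ℕ}

theorem fits_iff (hid : Function.Injective ident) {v w : V} {m : ℕ} (h : G.Adj v w) :
    Fits (ident '' M.neighborSet v) m (ident w) ↔ LevelEdge M m v w := by
  unfold Fits LevelEdge
  simp [h, hid.eq_iff]

local notation "ρ" => recAt M ident f top

theorem recAt_zero_fst {v : V} {n : ℕ} : (ρ 0 v).fst = some n ↔ v = f ∧ n = 0 := by
  simp only [recAt, Rec.start]
  split_ifs with h <;> simp [h, eq_comm]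

theorem recAt_zero_snd {v : V} : (ρ 0 v).snd = none := by
  simp only [recAt, Rec.start]
  split_ifs with h <;> simp

theorem recAt_succ_tok (s : ℕ) (v : V) (k : ℕ) : (ρ (s + 1) v).tok k = sInf {β | β = top ∨
    IsToken (ident v) (ident '' M.neighborSet v) (ρ (s + 1) v) (heard G ident (ρ s) v) k β} := rfl

/-- The ways in which a record changes from one level to the next. -/
theorem recAt_succ_cases (hid : Function.Injective ident) (s : ℕ) (v : V) :
    ((ρ s v).fst = none ∧ (∀ w, LevelEdge M s v w → ¬ (ρ s w).Has s) ∧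
      (ρ (s + 1) v).fst = none ∧ (ρ (s + 1) v).snd = (ρ s v).snd ∧
      (ρ (s + 1) v).dep = (ρ s v).dep ∧ (ρ (s + 1) v).anc = (ρ s v).anc) ∨
    ((ρ s v).fst = none ∧ (ρ (s + 1) v).fst = some (s + 1) ∧ (ρ (s + 1) v).snd = none ∧
      ∃ w, LevelEdge M s v w ∧ (ρ s w).Has s ∧ (ρ (s + 1) v).dep = (ρ s w).dep + 1 ∧
        ∀ i, (ρ (s + 1) v).anc i =
          if i = (ρ s w).dep + 1 then ident v + 1 else (ρ s w).anc i) ∨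
    (∃ m, (ρ s v).fst = some m ∧ (ρ (s + 1) v).fst = some m ∧
      (ρ (s + 1) v).dep = (ρ s v).dep ∧ (ρ (s + 1) v).anc = (ρ s v).anc ∧
      (((ρ s v).snd = none ∧ (ρ (s + 1) v).snd = some (s + 1) ∧ GetsSecond (ident v)
          (ident '' M.neighborSet v) s (ρ s v) (heard G ident (ρ s) v)) ∨
        ((ρ (s + 1) v).snd = (ρ s v).snd ∧ ((ρ s v).snd = none → ¬ GetsSecond (ident v)
          (ident '' M.neighborSet v) s (ρ s v) (heard G ident (ρ s) v))))) := by
  set lb := ident '' M.neighborSet v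
  set nbr := heard G ident (ρ s) v with hnbr
  have e1 : (ρ (s + 1) v).fst = (relabel (ident v) lb s (ρ s v) nbr).fst := rfl
  have e2 : (ρ (s + 1) v).snd = (relabel (ident v) lb s (ρ s v) nbr).snd := rfl
  have e3 : (ρ (s + 1) v).dep = (relabel (ident v) lb s (ρ s v) nbr).dep := rfl
  have e4 : (ρ (s + 1) v).anc = (relabel (ident v) lb s (ρ s v) nbr).anc := rfl
  rw [e1, e2, e3, e4]
  have hoff : ∀ k, Offers lb s nbr k ↔ ∃ w, LevelEdge M s v w ∧ (ρ s w).Has s ∧ ident w = k := by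
    intro k
    unfold Offers
    constructor
    · rintro ⟨R', h1, h2, h3⟩
      obtain ⟨w, h4, rfl, rfl⟩ := (heard_eq_some hid).1 h1
      exact ⟨w, (fits_iff hid h4).1 h3, h2, rfl⟩
    · rintro ⟨w, h1, h2, rfl⟩
      exact ⟨_, (heard_eq_some hid).2 ⟨w, h1.1, rfl, rfl⟩, h2, (fits_iff hid h1.1).2 h1⟩
  rcases hf : (ρ s v).fst with _ | m
  · by_cases hex : ∃ k, Offers lb s nbr k
    · right; left
      obtain ⟨w, h1, h2, h3⟩ := (hoff _).1 (Nat.sInf_mem (s := {k | Offers lb s nbr k}) hex)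
      have h4 : nbr (sInf {k | Offers lb s nbr k}) = some (ρ s w) :=
        (heard_eq_some hid).2 ⟨w, h1.1, h3, rfl⟩
      refine ⟨rfl, ?_, ?_, w, h1, h2, ?_, ?_⟩ <;> simp [relabel, hf, hex, h4]
    · left
      refine ⟨rfl, fun w h1 h2 => hex ⟨_, (hoff _).2 ⟨w, h1, h2, rfl⟩⟩, ?_, ?_, ?_, ?_⟩ <;>
        simp [relabel, hf, hex]
  · right; right
    by_cases hs : (ρ s v).snd = none ∧ GetsSecond (ident v) lb s (ρ s v) nbr
    · refine ⟨m, rfl, ?_, ?_, ?_, .inl ⟨hs.1, ?_, hs.2⟩⟩ <;> simp [relabel, hf, hs.1, hs.2]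
    · refine ⟨m, rfl, ?_, ?_, ?_, .inr ⟨?_, fun h1 h2 => hs ⟨h1, h2⟩⟩⟩ <;>
        simp only [relabel, hf, hs, reduceCtorEq, if_false]

theorem recAt_fst_succ (hid : Function.Injective ident) {s m : ℕ} {v : V}
    (h : (ρ s v).fst = some m) : (ρ (s + 1) v).fst = some m ∧
      (ρ (s + 1) v).dep = (ρ s v).dep ∧ (ρ (s + 1) v).anc = (ρ s v).anc := by
  rcases recAt_succ_cases (M := M) (f := f) (top := top) hid s v with
    ⟨h1, -⟩ | ⟨h1, -⟩ | ⟨m', h1, h2, h3, h4, -⟩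
  · rw [h] at h1; cases h1
  · rw [h] at h1; cases h1
  · rw [h] at h1
    exact ⟨h2.trans h1.symm, h3, h4⟩

theorem recAt_persist (hid : Function.Injective ident) {s m : ℕ} {v : V}
    (h : (ρ s v).fst = some m) {t : ℕ} (hst : s ≤ t) : (ρ t v).fst = some m ∧
      (ρ t v).dep = (ρ s v).dep ∧ (ρ t v).anc = (ρ s v).anc := by
  induction t, hst using Nat.le_induction with
  | base => exact ⟨h, rfl, rfl⟩
  | succ t _ ih =>
    obtain ⟨h1, h2, h3⟩ := recAt_fst_succ hid ih.1
    exact ⟨h1, h2.trans ih.2.1, h3.trans ih.2.2⟩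

theorem recAt_snd_persist (hid : Function.Injective ident) {s j : ℕ} {v : V}
    (h : (ρ s v).snd = some j) {t : ℕ} (hst : s ≤ t) : (ρ t v).snd = some j := by
  induction t, hst using Nat.le_induction with
  | base => exact h
  | succ t _ ih =>
    rcases recAt_succ_cases (M := M) (f := f) (top := top) hid t v with
      ⟨-, -, -, h1, -⟩ | ⟨h0, h1, h2, -⟩ | ⟨m', -, -, -, -, h1 | h1⟩
    · rw [h1, ih]
    · exfalso
      -- a second label presupposes a first one
      have key : ∀ t, (ρ t v).fst = none → (ρ t v).snd = none := by
        intro t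
        induction t with
        | zero => exact fun _ => recAt_zero_snd
        | succ t ih' =>
          intro h3
          rcases recAt_succ_cases (M := M) (f := f) (top := top) hid t v with
            ⟨h4, -, -, h5, -⟩ | ⟨-, h4, -⟩ | ⟨m', -, h4, -⟩
          · rw [h5, ih' h4]
          · rw [h3] at h4; cases h4
          · rw [h3] at h4; cases h4
      rw [key t h0] at ih
      cases ih
    · rw [h1.1] at ih; cases ih
    · rw [h1.1, ih]

theorem recAt_label_le (hid : Function.Injective ident) {s n : ℕ} {v : V}
    (h : (ρ s v).Has n) : n ≤ s := by
  induction s generalizing n with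
  | zero =>
    rcases h with h | h
    · exact (recAt_zero_fst.1 h).2.le
    · rw [recAt_zero_snd] at h; cases h
  | succ s ih =>
    rcases recAt_succ_cases (M := M) (f := f) (top := top) hid s v with
      ⟨-, -, h1, h2, -⟩ | ⟨-, h1, h2, -⟩ | ⟨m', h0, h1, -, -, h2 | h2⟩
    · rcases h with h | h
      · rw [h1] at h; cases h
      · rw [h2] at h; exact (ih (.inr h)).trans (Nat.le_succ s)
    · rcases h with h | h
      · rw [h1] at h; cases h; exact le_rfl
      · rw [h2] at h; cases h
    · rcases h with h | h
      · rw [h1] at h; rw [h] at h0; exact (ih (.inl h0)).trans (Nat.le_succ s)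
      · rw [h2.2.1] at h; cases h; exact le_rfl
    · rcases h with h | h
      · rw [h1] at h; rw [h] at h0; exact (ih (.inl h0)).trans (Nat.le_succ s)
      · rw [h2.1] at h; exact (ih (.inr h)).trans (Nat.le_succ s)

/-- A label is found at the level given by its value, so the records of level `s` contain exactly
the labels up to `s`. -/
theorem recAt_fst_of_le (hid : Function.Injective ident) {t n : ℕ} {v : V}
    (h : (ρ t v).fst = some n) {s : ℕ} (hn : n ≤ s) : (ρ s v).fst = some n := by
  suffices (ρ n v).fst = some n from (recAt_persist hid this hn).1
  induction t with
  | zero =>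
    obtain ⟨-, rfl⟩ := recAt_zero_fst.1 h
    exact h
  | succ t ih =>
    rcases recAt_succ_cases (M := M) (f := f) (top := top) hid t v with
      ⟨-, -, h1, -⟩ | ⟨-, h1, -⟩ | ⟨m', h1, h2, -⟩
    · rw [h1] at h; cases h
    · have := h1.symm.trans h
      cases this
      exact h
    · exact ih (h1.trans (h2.symm.trans h))

theorem recAt_snd_of_le (hid : Function.Injective ident) {t n : ℕ} {v : V}
    (h : (ρ t v).snd = some n) {s : ℕ} (hn : n ≤ s) : (ρ s v).snd = some n := by
  suffices (ρ n v).snd = some n from recAt_snd_persist hid this hn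
  induction t with
  | zero => rw [recAt_zero_snd] at h; cases h
  | succ t ih =>
    rcases recAt_succ_cases (M := M) (f := f) (top := top) hid t v with
      ⟨-, -, -, h1, -⟩ | ⟨-, -, h1, -⟩ | ⟨m', -, -, -, -, h1 | h1⟩
    · exact ih (h1.symm.trans h)
    · rw [h1] at h; cases h
    · have := h1.2.1.symm.trans h
      cases this
      exact h
    · exact ih (h1.1.symm.trans h)

theorem recAt_has_iff (hid : Function.Injective ident) {N s n : ℕ} (hs : s ≤ N) {v : V} :
    (ρ s v).Has n ↔ (ρ N v).Has n ∧ n ≤ s := by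
  constructor
  · intro h
    refine ⟨?_, recAt_label_le hid h⟩
    rcases h with h | h
    · exact .inl (recAt_persist hid h hs).1
    · exact .inr (recAt_snd_persist hid h hs)
  · rintro ⟨h | h, hn⟩
    · exact .inl (recAt_fst_of_le hid h hn)
    · exact .inr (recAt_snd_of_le hid h hn)

theorem recAt_snd_none (hid : Function.Injective ident) {s : ℕ} {v : V}
    (h : (ρ s v).fst = none) : (ρ s v).snd = none := by
  induction s with
  | zero => exact recAt_zero_snd
  | succ t ih' =>
    rcases recAt_succ_cases (M := M) (f := f) (top := top) hid t v with
      ⟨h4, -, -, h5, -⟩ | ⟨-, h4, -⟩ | ⟨m', -, h4, -⟩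
    · rw [h5, ih' h4]
    · rw [h] at h4; cases h4
    · rw [h] at h4; cases h4

theorem recAt_fst_of_has (hid : Function.Injective ident) {s n : ℕ} {v : V}
    (h : (ρ s v).Has n) : ∃ m, (ρ s v).fst = some m := by
  rcases hf : (ρ s v).fst with _ | m
  · rcases h with h | h
    · rw [hf] at h; cases h
    · rw [recAt_snd_none hid hf] at h; cases h
  · exact ⟨m, rfl⟩

theorem recAt_blank (hid : Function.Injective ident) {s : ℕ} {v : V} (h : (ρ s v).fst = none) :
    (ρ s v).dep = 0 ∧ ∀ i, (ρ s v).anc i = 0 := by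
  induction s with
  | zero =>
    have hv : v ≠ f := fun hv => by
      have := (recAt_zero_fst (M := M) (ident := ident) (top := top) (n := 0)).2 ⟨hv, rfl⟩
      rw [h] at this
      cases this
    simp [recAt, Rec.start, hv]
  | succ s ih =>
    rcases recAt_succ_cases (M := M) (f := f) (top := top) hid s v with
      ⟨h1, -, -, -, h2, h3⟩ | ⟨-, h1, -⟩ | ⟨m', -, h1, -⟩
    · rw [h2, h3]; exact ih h1
    · rw [h] at h1; cases h1
    · rw [h] at h1; cases h1

theorem recAt_root (hid : Function.Injective ident) (s : ℕ) : (ρ s f).fst = some 0 ∧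
    (ρ s f).dep = 0 ∧ ∀ i, (ρ s f).anc i = if i = 0 then ident f + 1 else 0 := by
  have h0 : (ρ 0 f).fst = some 0 := recAt_zero_fst.2 ⟨rfl, rfl⟩
  obtain ⟨h1, h2, h3⟩ := recAt_persist hid h0 (Nat.zero_le s)
  refine ⟨h1, ?_, ?_⟩
  · rw [h2]; simp [recAt, Rec.start]
  · rw [h3]; simp [recAt, Rec.start]

/-- Every labelled node other than the root has found its smaller label through a neighbour that
became its parent. -/
theorem recAt_exists_parent (hid : Function.Injective ident) {t m : ℕ} {v : V}
    (h : (ρ t v).fst = some m) (hv : v ≠ f) : ∃ k w, m = k + 1 ∧ (ρ t w).Has k ∧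
      LevelEdge M k w v ∧ (ρ t v).dep = (ρ t w).dep + 1 ∧
      ∀ i, (ρ t v).anc i = if i = (ρ t w).dep + 1 then ident v + 1 else (ρ t w).anc i := by
  induction t with
  | zero => exact absurd (recAt_zero_fst.1 h).1 hv
  | succ t ih =>
    rcases recAt_succ_cases (M := M) (f := f) (top := top) hid t v with
      ⟨-, -, h1, -⟩ | ⟨-, h1, -, w, h2, h3, h4, h5⟩ | ⟨m', h1, h2, h3, h4, -⟩
    · rw [h1] at h; cases h
    · rw [h1] at h
      cases h
      obtain ⟨m, hm⟩ := recAt_fst_of_has hid h3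
      obtain ⟨-, h6, h7⟩ := recAt_persist hid hm (Nat.le_succ t)
      refine ⟨t, w, rfl, ((recAt_has_iff hid (Nat.le_succ t)).1 h3).1, h2.symm, ?_, ?_⟩
      · rw [h6]; exact h4
      · rw [h6, h7]; exact h5
    · rw [h2] at h
      cases h
      obtain ⟨k, w, h5, h6, h7, h8, h9⟩ := ih h1
      obtain ⟨m, hm⟩ := recAt_fst_of_has hid h6
      obtain ⟨-, h10, h11⟩ := recAt_persist hid hm (Nat.le_succ t)
      refine ⟨k, w, h5, ((recAt_has_iff hid (Nat.le_succ t)).1 h6).1, h7, ?_, ?_⟩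
      · rw [h3, h10]; exact h8
      · rw [h4, h10, h11]; exact h9

end Search

/-! ### The records determine valid search data -/

section Result

variable {V : Type*} {G : SimpleGraph V} {M : G.Subgraph} {ident : V → ℕ} {f : V} {N K : ℕ}
  {bi bo : V → V} {li lo : V → ℕ}

open Classical in
/-- The search data read off from the records after `N` levels. The bridges remain to be chosen. -/
noncomputable def searchData (M : G.Subgraph) (ident : V → ℕ) (f : V) (N K : ℕ) (bi bo : V → V)
    (li lo : V → ℕ) : SearchData M f N K where
  lab v n := (recAt M ident f (N + 2) N v).Has n
  rank v := (recAt M ident f (N + 2) N v).fst.getD 0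
  par v :=
    if h : ∃ w, ident w + 1 = (recAt M ident f (N + 2) N v).anc
      ((recAt M ident f (N + 2) N v).dep - 1) then h.choose else v
  bridgeIn := bi
  bridgeOut := bo
  labIn := li
  labOut := lo

local notation "ρ" => recAt M ident f (N + 2)
local notation "𝒟" => searchData M ident f N K bi bo li lo

theorem searchData_rank {v : V} {m : ℕ} (h : (ρ N v).fst = some m) : (𝒟).rank v = m := by
  simp [searchData, h]

theorem searchData_fst (hid : Function.Injective ident) {v : V} {n : ℕ} (h : (𝒟).lab v n) :
    (ρ N v).fst = some ((𝒟).rank v) := by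
  obtain ⟨m, hm⟩ := recAt_fst_of_has hid h
  rw [searchData_rank hm, hm]

theorem searchData_lab_rank (hid : Function.Injective ident) {v : V} {n : ℕ} (h : (𝒟).lab v n) :
    (𝒟).lab v ((𝒟).rank v) := .inl (searchData_fst hid h)

theorem searchData_snd_of_ne {v : V} {n : ℕ} (h : (𝒟).lab v n)
    (hn : n ≠ (𝒟).rank v) : (ρ N v).snd = some n := by
  rcases h with h' | h'
  · exact absurd (searchData_rank h').symm hn
  · exact h'

theorem searchData_rank_root (hid : Function.Injective ident) : (𝒟).rank f = 0 :=
  searchData_rank (recAt_root hid N).1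

theorem searchData_anc_self (hid : Function.Injective ident) {v : V} {n : ℕ} (h : (𝒟).lab v n) :
    (ρ N v).anc (ρ N v).dep = ident v + 1 := by
  by_cases hv : v = f
  · subst hv
    obtain ⟨-, h1, h2⟩ := recAt_root (M := M) (f := v) (top := N + 2) hid N
    rw [h2, h1]; rfl
  · obtain ⟨k, w, -, -, -, h1, h2⟩ := recAt_exists_parent hid (searchData_fst hid h) hv
    rw [h2, h1, if_pos rfl]

theorem searchData_par_spec (hid : Function.Injective ident) {v : V} {n : ℕ} (h : (𝒟).lab v n)
    (hv : v ≠ f) : ∃ k, (𝒟).rank v = k + 1 ∧ (𝒟).lab ((𝒟).par v) k ∧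
      LevelEdge M k ((𝒟).par v) v ∧ (ρ N v).dep = (ρ N ((𝒟).par v)).dep + 1 ∧
      ∀ i, (ρ N v).anc i =
        if i = (ρ N ((𝒟).par v)).dep + 1 then ident v + 1 else (ρ N ((𝒟).par v)).anc i := by
  obtain ⟨k, w, h1, h2, h3, h4, h5⟩ := recAt_exists_parent hid (searchData_fst hid h) hv
  have hw : ident w + 1 = (ρ N v).anc ((ρ N v).dep - 1) := by
    rw [h5, h4, if_neg (by omega)]
    exact (searchData_anc_self (K := K) (bi := bi) (bo := bo) (li := li) (lo := lo) hid h2).symm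
  have hpar : (𝒟).par v = w := by
    have hex : ∃ w, ident w + 1 = (ρ N v).anc ((ρ N v).dep - 1) := ⟨w, hw⟩
    have h6 : (𝒟).par v = hex.choose := dif_pos hex
    rw [h6]
    have := hex.choose_spec
    exact hid (by omega)
  rw [hpar]
  exact ⟨k, h1, h2, h3, h4, h5⟩

theorem searchData_rank_le (hid : Function.Injective ident) {v : V} {n : ℕ} (h : (𝒟).lab v n) :
    (𝒟).rank v ≤ n := by
  have h1 := searchData_fst hid h
  have key : ∀ t ≤ N, ∀ j, (ρ t v).snd = some j → ∃ m, (ρ t v).fst = some m ∧ m ≤ j := by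
    intro t
    induction t with
    | zero => intro _ j hj; rw [recAt_zero_snd] at hj; cases hj
    | succ t ih =>
      intro ht j hj
      rcases recAt_succ_cases (M := M) (f := f) (top := N + 2) hid t v with
        ⟨h2, -, -, h3, -⟩ | ⟨-, -, h2, -⟩ | ⟨m, h2, h3, -, -, h4 | h4⟩
      · rw [h3, recAt_snd_none hid h2] at hj; cases hj
      · rw [h2] at hj; cases hj
      · rw [h4.2.1] at hj
        cases hj
        exact ⟨m, h3, (recAt_label_le hid (.inl h2)).trans (Nat.le_succ t)⟩
      · obtain ⟨m', h5, h6⟩ := ih (by omega) j (h4.1.symm.trans hj)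
        exact ⟨m', h3.trans (h2.symm.trans h5), h6⟩
  by_cases hn : n = (𝒟).rank v
  · exact hn.ge
  · obtain ⟨m, h2, h3⟩ := key N le_rfl n (searchData_snd_of_ne h hn)
    rw [searchData_rank h2]
    exact h3

theorem searchData_dep_le (hid : Function.Injective ident) : ∀ (r : ℕ) {v : V} {n : ℕ},
    (𝒟).lab v n → (𝒟).rank v = r → (ρ N v).dep ≤ r := by
  intro r
  induction r using Nat.strong_induction_on with
  | _ r ih =>
    intro v n h hr
    by_cases hv : v = f
    · subst hv
      rw [(recAt_root hid N).2.1]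
      exact Nat.zero_le r
    · obtain ⟨k, h1, h2, -, h3, -⟩ := searchData_par_spec hid h hv
      have h4 := searchData_rank_le hid h2
      have := ih _ (by omega) h2 rfl
      omega

theorem searchData_anc_zero (hid : Function.Injective ident) : ∀ (r : ℕ) {x : V} {n : ℕ},
    (𝒟).lab x n → (𝒟).rank x = r → (ρ N x).anc 0 = ident f + 1 := by
  intro r
  induction r using Nat.strong_induction_on with
  | _ r ih =>
    intro x n hx hr
    by_cases hxf : x = f
    · subst hxf
      rw [(recAt_root hid N).2.2 0, if_pos rfl]
    · obtain ⟨k, h1, h2, -, h3, h5⟩ := searchData_par_spec hid hx hxf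
      have h7 := searchData_rank_le hid h2
      rw [h5, if_neg (by omega)]
      exact ih _ (by omega) h2 rfl

/-- An ancestor has the same ancestors. -/
theorem searchData_anc_of_desc (hid : Function.Injective ident) {v x : V}
    (hd : (𝒟).Desc v x) : ∀ {n}, (𝒟).lab x n → (ρ N v).dep ≤ (ρ N x).dep ∧
      ∀ i ≤ (ρ N v).dep, (ρ N x).anc i = (ρ N v).anc i := by
  induction hd with
  | refl => exact fun _ => ⟨le_rfl, fun _ _ => rfl⟩
  | step x hx _ ih =>
    intro n h
    obtain ⟨k, h1, h2, -, h3, h5⟩ := searchData_par_spec hid h hx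
    obtain ⟨h6, h7⟩ := ih h2
    refine ⟨by omega, fun i hi => ?_⟩
    rw [h5, if_neg (by omega), h7 i hi]

theorem searchData_reached_of_desc (hid : Function.Injective ident) {v x : V}
    (hd : (𝒟).Desc v x) :
    ∀ {n}, (𝒟).lab x n → (𝒟).lab v ((𝒟).rank v) ∧ (x ≠ v → (𝒟).rank v < (𝒟).rank x) := by
  induction hd with
  | refl => exact fun h => ⟨searchData_lab_rank hid h, fun hn => absurd rfl hn⟩
  | step x hx _ ih =>
    intro n h
    obtain ⟨k, h1, h2, -⟩ := searchData_par_spec hid h hx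
    obtain ⟨h3, h4⟩ := ih h2
    refine ⟨h3, fun _ => ?_⟩
    have h5 := searchData_rank_le hid h2
    by_cases he : (𝒟).par x = v
    · rw [he] at h5; omega
    · have := h4 he; omega

theorem searchData_desc_iff (hid : Function.Injective ident) {v x : V} {m n : ℕ}
    (hv : (𝒟).lab v m) (hx : (𝒟).lab x n) :
    (𝒟).Desc v x ↔ (ρ N x).anc (ρ N v).dep = ident v + 1 := by
  constructor
  · intro hd
    rw [(searchData_anc_of_desc hid hd hx).2 _ le_rfl]
    exact searchData_anc_self hid hv
  · have key : ∀ (r : ℕ) {x : V} {n : ℕ}, (𝒟).lab x n → (𝒟).rank x = r →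
        (ρ N x).anc (ρ N v).dep = ident v + 1 → (𝒟).Desc v x := by
      intro r
      induction r using Nat.strong_induction_on with
      | _ r ih =>
        intro x n hx hr h
        by_cases hxf : x = f
        · subst hxf
          obtain ⟨-, -, h2⟩ := recAt_root (M := M) (f := x) (top := N + 2) hid N
          rw [h2] at h
          split_ifs at h
          obtain rfl : x = v := hid (by omega)
          exact .refl
        · obtain ⟨k, h1, h2, -, h3, h5⟩ := searchData_par_spec hid hx hxf
          rw [h5] at h
          split_ifs at h with h6
          · obtain rfl : x = v := hid (by omega)
            exact .refl
          · have h7 := searchData_rank_le hid h2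
            exact .step x hxf (ih _ (by omega) h2 rfl h)
    exact key _ hx rfl

/-- Membership in a subtree is visible in the list of ancestors. -/
theorem searchData_desc_iff_exists (hid : Function.Injective ident) {v x : V} {n : ℕ}
    (hx : (𝒟).lab x n) : (𝒟).Desc v x ↔ ∃ i, (ρ N x).anc i = ident v + 1 := by
  constructor
  · intro hd
    exact ⟨_, (searchData_desc_iff hid (searchData_reached_of_desc hid hd hx).1 hx).1 hd⟩
  · have key : ∀ (r : ℕ) {x : V} {n : ℕ}, (𝒟).lab x n → (𝒟).rank x = r → ∀ i,
        (ρ N x).anc i = ident v + 1 → (𝒟).Desc v x := by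
      intro r
      induction r using Nat.strong_induction_on with
      | _ r ih =>
        intro x n hx hr i h
        by_cases hxf : x = f
        · subst hxf
          obtain ⟨-, -, h2⟩ := recAt_root (M := M) (f := x) (top := N + 2) hid N
          rw [h2] at h
          split_ifs at h
          obtain rfl : x = v := hid (by omega)
          exact .refl
        · obtain ⟨k, h1, h2, -, h3, h5⟩ := searchData_par_spec hid hx hxf
          rw [h5] at h
          split_ifs at h with h6
          · obtain rfl : x = v := hid (by omega)
            exact .refl
          · have h7 := searchData_rank_le hid h2
            exact .step x hxf (ih _ (by omega) h2 rfl i h)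
    rintro ⟨i, h⟩
    exact key _ hx rfl i h

/-- An edge leaves the subtree of an ancestor `v` of one of its ends if and only if the ancestors of
its ends diverge at the depth of `v` or above. -/
theorem searchData_diverge_le_iff (hid : Function.Injective ident) {v x y : V} {m n : ℕ}
    (hx : (𝒟).lab x m) (hy : (𝒟).lab y n) (hxy : x ≠ y) (hd : (𝒟).Desc v x) :
    diverge (ρ N x).anc (ρ N y).anc ≤ (ρ N v).dep ↔ ¬ (𝒟).Desc v y := by
  have hv := (searchData_reached_of_desc hid hd hx).1
  constructor
  · intro hle hd'
    have hne : ({i | (ρ N x).anc i ≠ (ρ N y).anc i} : Set ℕ).Nonempty := by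
      by_contra h0
      rw [Set.not_nonempty_iff_eq_empty, Set.eq_empty_iff_forall_notMem] at h0
      simp only [Set.mem_ofPred_eq, not_not] at h0
      have h1 : (𝒟).Desc x y :=
        (searchData_desc_iff hid hx hy).2 ((h0 _).symm.trans (searchData_anc_self hid hx))
      have h2 : (𝒟).Desc y x :=
        (searchData_desc_iff hid hy hx).2 ((h0 _).trans (searchData_anc_self hid hy))
      have h3 := (searchData_reached_of_desc hid h1 hy).2 hxy.symm
      have h4 := (searchData_reached_of_desc hid h2 hx).2 hxy
      omega
    refine Nat.sInf_mem hne ?_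
    change (ρ N x).anc (diverge _ _) = (ρ N y).anc (diverge _ _)
    rw [(searchData_anc_of_desc hid hd hx).2 _ hle, (searchData_anc_of_desc hid hd' hy).2 _ hle]
  · intro hd'
    refine Nat.sInf_le ?_
    intro h
    rw [(searchData_desc_iff hid hv hx).1 hd] at h
    exact hd' ((searchData_desc_iff hid hv hy).2 h.symm)

theorem searchData_exists_child {u x : V} (hd : (𝒟).Desc u x)
    (hne : x ≠ u) : ∃ c, (𝒟).Desc c x ∧ c ≠ f ∧ (𝒟).par c = u := by
  induction hd with
  | refl => exact absurd rfl hne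
  | step x hx h ih =>
    by_cases hp : (𝒟).par x = u
    · exact ⟨x, .refl, hx, hp⟩
    · obtain ⟨c, h1, h2, h3⟩ := ih hp
      exact ⟨c, .step x hx h1, h2, h3⟩

theorem recAt_eq_of_reached (hid : Function.Injective ident) {s n : ℕ} {v : V} (hs : s ≤ N)
    (h : (ρ s v).Has n) : (ρ s v).dep = (ρ N v).dep ∧ (ρ s v).anc = (ρ N v).anc := by
  obtain ⟨m, hm⟩ := recAt_fst_of_has hid h
  obtain ⟨-, h1, h2⟩ := recAt_persist hid hm hs
  exact ⟨h1.symm, h2.symm⟩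

theorem isChild_iff (hid : Function.Injective ident) {s t m : ℕ} {u c : V} (hs : s ≤ N)
    (ht : t ≤ N) (hu : (ρ s u).Has m) :
    IsChild (ident u) (ρ s u) (ρ t c) ↔ ((∃ n, (ρ t c).Has n) ∧ (𝒟).Desc u c ∧
      (ρ N c).dep = (ρ N u).dep + 1) := by
  have hu' : (𝒟).lab u m := ((recAt_has_iff hid hs).1 hu).1
  unfold IsChild
  rw [(recAt_eq_of_reached hid hs hu).1]
  rcases hc : (ρ t c).fst with _ | k
  · rw [(recAt_blank hid hc).1]
    constructor
    · rintro ⟨h, -⟩; omega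
    · rintro ⟨⟨n, hn⟩, -⟩
      obtain ⟨m, hm⟩ := recAt_fst_of_has hid hn
      rw [hc] at hm; cases hm
  · have hc' : (ρ t c).Has k := .inl hc
    have hcl : (𝒟).lab c k := ((recAt_has_iff hid ht).1 hc').1
    rw [(recAt_eq_of_reached hid ht hc').1, (recAt_eq_of_reached hid ht hc').2,
      ← searchData_desc_iff hid hu' hcl]
    constructor
    · exact fun h => ⟨⟨k, hc'⟩, h.2, h.1⟩
    · exact fun h => ⟨h.2.2, h.2.1⟩

/-- The entries of the tables come from edges with an end in the subtree. -/
theorem tok_sound (hid : Function.Injective ident) : ∀ {s : ℕ}, s ≤ N → ∀ {u : V} {i : ℕ},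
    (ρ s u).Has i → ∀ {k : ℕ}, (ρ s u).tok k ≠ N + 2 → ∃ x y m n, (𝒟).Desc u x ∧ (𝒟).lab x m ∧
      (𝒟).lab y n ∧ m % 2 = n % 2 ∧ LevelEdge M m x y ∧ k = m + n + 1 ∧ m ≤ s ∧ n < s ∧
      (ρ s u).tok k = diverge (ρ N x).anc (ρ N y).anc := by
  intro s
  induction s with
  | zero =>
    intro _ u i _ k hk
    refine absurd ?_ hk
    simp only [recAt, Rec.start]
    split_ifs <;> rfl
  | succ s ih =>
    intro hs u i hu k hk
    rw [recAt_succ_tok] at hk ⊢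
    have hne : ({β | β = N + 2 ∨ IsToken (ident u) (ident '' M.neighborSet u) (ρ (s + 1) u)
        (heard G ident (ρ s) u) k β} : Set ℕ).Nonempty := ⟨_, .inl rfl⟩
    rcases Nat.sInf_mem hne with h | ⟨q, R', h1, h2⟩
    · exact absurd h hk
    · obtain ⟨w, hw, rfl, rfl⟩ := (heard_eq_some hid).1 h1
      rcases h2 with ⟨m, n, h3, h4, h5, h6, h7, h8⟩ | ⟨h3, h4⟩
      · refine ⟨u, w, m, n, .refl, ((recAt_has_iff hid hs).1 h3).1,
          ((recAt_has_iff hid (by omega)).1 h4).1, h5, (fits_iff hid hw).1 h6, h7,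
          recAt_label_le hid h3, Nat.lt_succ_of_le (recAt_label_le hid h4), ?_⟩
        rw [h8, (recAt_eq_of_reached hid hs hu).2,
          (recAt_eq_of_reached hid (by omega) h4).2]
      · obtain ⟨⟨j, hj⟩, h5, -⟩ := (isChild_iff (K := K) (bi := bi) (bo := bo) (li := li) (lo := lo)
          hid hs (by omega) hu).1 h3
        rw [h4] at hk ⊢
        obtain ⟨x, y, m, n, h6, h7, h8, h9, h10, h11, h12, h13, h14⟩ := ih (by omega) hj hk
        exact ⟨x, y, m, n, h6.trans h5, h7, h8, h9, h10, h11, by omega, by omega, h14⟩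

theorem tok_succ_le (s : ℕ) (u : V) {k β : ℕ} (h : IsToken (ident u) (ident '' M.neighborSet u)
    (ρ (s + 1) u) (heard G ident (ρ s) u) k β) : (ρ (s + 1) u).tok k ≤ β := by
  rw [recAt_succ_tok]
  exact Nat.sInf_le (.inr h)

/-- An edge becomes visible in the table of `x` once `x` and its neighbour `y` have their labels,
and moves up the tree by one node per level. -/
theorem tok_complete (hid : Function.Injective ident) {x y : V} {m n : ℕ} (hx : (𝒟).lab x m)
    (hy : (𝒟).lab y n) (hp : m % 2 = n % 2) (e : LevelEdge M m x y) :
    ∀ (d : ℕ) {u : V}, (𝒟).Desc u x → (𝒟).rank x - (𝒟).rank u = d → ∀ {s}, s ≤ N →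
      max m (n + 1) + d ≤ s → (ρ s u).tok (m + n + 1) ≤ diverge (ρ N x).anc (ρ N y).anc := by
  intro d
  induction d using Nat.strong_induction_on with
  | _ d ih =>
    intro u hd hr s hs hms
    have hrx := searchData_rank_le hid hx
    obtain ⟨s, rfl⟩ : ∃ t, s = t + 1 := ⟨s - 1, by omega⟩
    by_cases hxu : x = u
    · subst hxu
      have h1 : (ρ (s + 1) x).Has m := (recAt_has_iff hid hs).2 ⟨hx, by omega⟩
      have h2 : (ρ s y).Has n := (recAt_has_iff hid (by omega : s ≤ N)).2 ⟨hy, by omega⟩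
      apply tok_succ_le
      refine ⟨ident y, ρ s y, (heard_eq_some hid).2 ⟨y, e.1, rfl, rfl⟩, .inl ⟨m, n, h1, h2, hp,
        (fits_iff hid e.1).2 e, rfl, ?_⟩⟩
      rw [(recAt_eq_of_reached hid hs h1).2, (recAt_eq_of_reached hid (by omega) h2).2]
    · obtain ⟨c, h1, h2, rfl⟩ := searchData_exists_child hd hxu
      obtain ⟨hc, hcx⟩ := searchData_reached_of_desc hid h1 hx
      have hcx' : (𝒟).rank c ≤ (𝒟).rank x := by
        by_cases hne : x = c
        · rw [hne]
        · exact (hcx hne).le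
      obtain ⟨k, h3, h4, h5, h6, -⟩ := searchData_par_spec hid hc h2
      have hk := searchData_rank_le hid h4
      refine le_trans (tok_succ_le s _ (β := (ρ s c).tok (m + n + 1)) ?_)
        (ih _ (by omega) h1 rfl (by omega) (by omega))
      have h7 : (ρ (s + 1) ((𝒟).par c)).Has k := (recAt_has_iff hid hs).2 ⟨h4, by omega⟩
      have h8 : (ρ s c).Has ((𝒟).rank c) :=
        (recAt_has_iff hid (by omega : s ≤ N)).2 ⟨hc, by omega⟩
      refine ⟨ident c, ρ s c, (heard_eq_some hid).2 ⟨c, h5.1, rfl, rfl⟩, .inr ⟨?_, rfl⟩⟩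
      exact (isChild_iff hid hs (by omega) h7).2 ⟨⟨_, h8⟩, .step c h2 .refl, h6⟩

/-- A node gets a second label `j` only on account of an edge that leaves its subtree. -/
theorem exists_outgoing_of_snd (hid : Function.Injective ident) {v : V} {j : ℕ}
    (h : (ρ N v).snd = some j) : ∃ x y m n, (𝒟).Outgoing v x y m n ∧
      m + n + 1 = j + (𝒟).rank v ∧ m < j ∧ n < j := by
  have key : ∀ t ≤ N, (ρ t v).snd = some j → ∃ x y m n, (𝒟).Outgoing v x y m n ∧
      m + n + 1 = j + (𝒟).rank v ∧ m < j ∧ n < j := by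
    intro t
    induction t with
    | zero => intro _ h; rw [recAt_zero_snd] at h; cases h
    | succ t ih =>
      intro ht h
      rcases recAt_succ_cases (M := M) (f := f) (top := N + 2) hid t v with
        ⟨-, -, -, h1, -⟩ | ⟨-, -, h1, -⟩ | ⟨r, h0, h1, -, -, h2 | h2⟩
      · exact ih (by omega) (h1.symm.trans h)
      · rw [h1] at h; cases h
      · have h3 := h2.2.1.symm.trans h
        cases h3
        obtain ⟨m, h3, k, R', h4, h5⟩ := h2.2.2
        have := h0.symm.trans h3
        cases this
        obtain ⟨w, hw, rfl, rfl⟩ := (heard_eq_some hid).1 h4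
        have hv : (ρ t v).Has r := .inl h0
        have hvl : (𝒟).lab v r := ((recAt_has_iff hid (by omega)).1 hv).1
        have hr : (𝒟).rank v = r := searchData_rank (recAt_persist hid h1 ht).1
        have hrt := recAt_label_le hid hv
        obtain ⟨e1, e2⟩ := recAt_eq_of_reached hid (by omega) hv
        rw [hr]
        rcases h5 with ⟨h6, h7, h8, h9⟩ | ⟨h6, h7⟩
        · have hwl : (𝒟).lab w t := ((recAt_has_iff hid (by omega)).1 h6).1
          refine ⟨v, w, r, t, ⟨.refl, ?_, hvl, hwl, h7, (fits_iff hid hw).1 h8⟩, by omega, by omega,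
            by omega⟩
          rw [e1, e2, (recAt_eq_of_reached hid (by omega) h6).2] at h9
          exact (searchData_diverge_le_iff hid hvl hwl hw.ne .refl).1 h9
        · obtain ⟨⟨i, hi⟩, h8, -⟩ := (isChild_iff (K := K) (bi := bi) (bo := bo) (li := li)
            (lo := lo) hid (by omega) (by omega) hv).1 h6
          rw [e1] at h7
          have hdep := searchData_dep_le hid _ hvl rfl
          obtain ⟨x, y, m, n, h9, h10, h11, h12, h13, h14, h15, h16, h17⟩ :=
            tok_sound (K := K) (bi := bi) (bo := bo) (li := li) (lo := lo) hid (by omega) hi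
              (k := t + 1 + r) (by omega)
          rw [h17] at h7
          refine ⟨x, y, m, n, ⟨h9.trans h8, ?_, h10, h11, h12, h13⟩, by omega, by omega, by omega⟩
          exact (searchData_diverge_le_iff hid h10 h11 h13.1.ne (h9.trans h8)).1 h7
      · exact ih (by omega) (h2.1.symm.trans h)
  exact key N le_rfl h

theorem searchData_extend (hid : Function.Injective ident) {y v : V} {n : ℕ} (hy : (𝒟).lab y n)
    (hn : n + 1 ≤ N) (e : LevelEdge M n y v) : ∃ m, (𝒟).lab v m ∧ m ≤ n + 1 := by
  have hy' : (ρ n y).Has n := (recAt_has_iff hid (by omega : n ≤ N)).2 ⟨hy, le_rfl⟩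
  have lift : ∀ {m s}, s ≤ N → (ρ s v).Has m → (𝒟).lab v m :=
    fun hs h => ((recAt_has_iff hid hs).1 h).1
  rcases recAt_succ_cases (M := M) (f := f) (top := N + 2) hid n v with
    ⟨-, h1, -⟩ | ⟨-, h1, -⟩ | ⟨m, h1, -⟩
  · exact absurd hy' (h1 y e.symm)
  · exact ⟨n + 1, lift hn (.inl h1), le_rfl⟩
  · exact ⟨m, lift (by omega) (.inl h1), (recAt_label_le hid (.inl h1)).trans (Nat.le_succ n)⟩

/-- Every edge that leaves the subtree of `v` gives a second label to `v`, in time. -/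
theorem searchData_exists_second (hid : Function.Injective ident) {v x y : V} {m n : ℕ}
    (ho : (𝒟).Outgoing v x y m n) (hN : m + n + 1 ≤ N + (𝒟).rank v) :
    ∃ j, (𝒟).lab v j ∧ j ≠ (𝒟).rank v ∧ j + (𝒟).rank v ≤ m + n + 1 := by
  obtain ⟨hd, hout, hx, hy, hp, e⟩ := ho
  obtain ⟨hv, hvx⟩ := searchData_reached_of_desc hid hd hx
  have hrx := searchData_rank_le hid hx
  have hnN : n ≤ N := recAt_label_le hid hy
  have hmN : m ≤ N := recAt_label_le hid hx
  have hrx' : (𝒟).rank x ≤ n + 1 := by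
    by_cases hn : n + 1 ≤ N
    · obtain ⟨i, h1, h2⟩ := searchData_extend hid hy hn (e.symm.congr hp.symm)
      exact (searchData_rank_le hid h1).trans h2
    · omega
  by_cases hxm : x = v ∧ m ≠ (𝒟).rank v
  · obtain ⟨rfl, hm⟩ := hxm
    exact ⟨m, hx, hm, by omega⟩
  · -- the level at which the edge gives a label to `v`
    obtain ⟨s, hs⟩ : ∃ s, s + 1 + (𝒟).rank v = m + n + 1 ∧ (𝒟).rank v ≤ s ∧ n ≤ s := by
      by_cases hxv : x = v
      · have hm : m = (𝒟).rank v := by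
          by_contra hm
          exact hxm ⟨hxv, hm⟩
        refine ⟨n, by omega, ?_, le_rfl⟩
        have : (𝒟).rank v ≤ n + 1 := hxv ▸ hrx'
        omega
      · have := hvx hxv
        exact ⟨m + n - (𝒟).rank v, by omega, by omega, by omega⟩
    obtain ⟨hs1, hs2, hs3⟩ := hs
    have hvs : (ρ s v).fst = some ((𝒟).rank v) :=
      recAt_fst_of_le hid (searchData_fst hid hv) hs2
    have hvs' : (ρ s v).Has ((𝒟).rank v) := .inl hvs
    obtain ⟨e1, e2⟩ := recAt_eq_of_reached hid (by omega : s ≤ N) hvs'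
    have hsnd : ∀ j, (ρ N v).snd = some j → j ≠ (𝒟).rank v := by
      intro j hj hjr
      obtain ⟨x', y', m', n', h1, h2, h3, h4⟩ := exists_outgoing_of_snd (K := K) (bi := bi)
        (bo := bo) (li := li) (lo := lo) hid hj
      have := h1.parity
      omega
    have hdiv := (searchData_diverge_le_iff hid hx hy e.1.ne hd).2 hout
    have hget : GetsSecond (ident v) (ident '' M.neighborSet v) s (ρ s v)
        (heard G ident (ρ s) v) := by
      refine ⟨_, hvs, ?_⟩
      by_cases hxv : x = v
      · subst hxv
        have hm : m = (𝒟).rank x := by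
          by_contra hm
          exact hxm ⟨rfl, hm⟩
        obtain rfl : n = s := by omega
        have hys : (ρ n y).Has n := (recAt_has_iff hid hnN).2 ⟨hy, le_rfl⟩
        refine ⟨ident y, ρ n y, (heard_eq_some hid).2 ⟨y, e.1, rfl, rfl⟩, .inl ⟨hys, by omega,
          (fits_iff hid e.1).2 (hm ▸ e), ?_⟩⟩
        rw [e1, e2, (recAt_eq_of_reached hid hnN hys).2]
        exact hdiv
      · obtain ⟨c, h1, h2, rfl⟩ := searchData_exists_child hd hxv
        obtain ⟨hc, hcx⟩ := searchData_reached_of_desc hid h1 hx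
        have hcx' : (𝒟).rank c ≤ (𝒟).rank x := by
          by_cases hne : x = c
          · rw [hne]
          · exact (hcx hne).le
        obtain ⟨k, h3, h4, h5, h6, -⟩ := searchData_par_spec hid hc h2
        have hk := searchData_rank_le hid h4
        have htok := tok_complete hid hx hy hp e _ h1 rfl (by omega : s ≤ N) (by omega)
        have h8 : (ρ s c).Has ((𝒟).rank c) :=
          (recAt_has_iff hid (by omega : s ≤ N)).2 ⟨hc, by omega⟩
        refine ⟨ident c, ρ s c, (heard_eq_some hid).2 ⟨c, h5.1, rfl, rfl⟩, .inr ⟨?_, ?_⟩⟩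
        · exact (isChild_iff hid (by omega) (by omega) hvs').2 ⟨⟨_, h8⟩, .step c h2 .refl, h6⟩
        · rw [hs1, e1]
          exact htok.trans hdiv
    have hfin : ∀ j, (ρ (s + 1) v).snd = some j →
        ∃ j, (𝒟).lab v j ∧ j ≠ (𝒟).rank v ∧ j + (𝒟).rank v ≤ m + n + 1 := by
      intro j hj
      have h1 : (ρ (s + 1) v).Has j := .inr hj
      have h2 := recAt_label_le hid h1
      have h3 := recAt_snd_persist hid hj (by omega : s + 1 ≤ N)
      exact ⟨j, .inr h3, hsnd j h3, by omega⟩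
    rcases recAt_succ_cases (M := M) (f := f) (top := N + 2) hid s v with
      ⟨h1, -⟩ | ⟨h1, -⟩ | ⟨r, -, -, -, -, h1 | h1⟩
    · rw [hvs] at h1; cases h1
    · rw [hvs] at h1; cases h1
    · exact hfin _ h1.2.1
    · rcases hsv : (ρ s v).snd with _ | j
      · exact absurd hget (h1.2 hsv)
      · exact hfin j (h1.1.trans hsv)

/-- The records determine valid search data, for every admissible choice of the bridges. -/
theorem searchData_valid (hid : Function.Injective ident) (hK : N < K)
    (hout : ∀ {v j}, (𝒟).lab v j → j ≠ (𝒟).rank v → (𝒟).Outgoing v (bi v) (bo v) (li v) (lo v))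
    (hmin : ∀ {v x y j m n}, (𝒟).lab v j → j ≠ (𝒟).rank v → (𝒟).Outgoing v x y m n →
      SearchData.key K (li v) (lo v) ≤ SearchData.key K m n) : (𝒟).Valid where
  lt_base := hK
  lab_le h := recAt_label_le hid h
  lab_root := by
    intro n
    constructor
    · intro h
      by_contra hn
      obtain ⟨x, y, m, k, ho, -⟩ := exists_outgoing_of_snd (K := K) (bi := bi)
        (bo := bo) (li := li) (lo := lo) hid (searchData_snd_of_ne h (by
          rw [searchData_rank_root hid]; exact hn))
      refine ho.outside ((searchData_desc_iff_exists hid ho.lab_out).2 ⟨0, ?_⟩)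
      exact searchData_anc_zero hid _ ho.lab_out rfl
    · rintro rfl
      exact .inl (recAt_root hid N).1
  lab_unique := by
    intro v m n hm hn hp
    by_cases h1 : m = (𝒟).rank v <;> by_cases h2 : n = (𝒟).rank v
    · omega
    · obtain ⟨x, y, a, b, ho, h3, -⟩ := exists_outgoing_of_snd (K := K) (bi := bi)
        (bo := bo) (li := li) (lo := lo) hid (searchData_snd_of_ne hn h2)
      have := ho.parity
      omega
    · obtain ⟨x, y, a, b, ho, h3, -⟩ := exists_outgoing_of_snd (K := K) (bi := bi)
        (bo := bo) (li := li) (lo := lo) hid (searchData_snd_of_ne hm h1)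
      have := ho.parity
      omega
    · have := (searchData_snd_of_ne hm h1).symm.trans (searchData_snd_of_ne hn h2)
      cases this
      rfl
  lab_rank h := searchData_lab_rank hid h
  rank_le h := searchData_rank_le hid h
  lab_par h hv := by
    obtain ⟨k, h1, h2, h3, -⟩ := searchData_par_spec hid h hv
    exact ⟨k, h1, h2, h3⟩
  extend h hn e := searchData_extend hid h hn e
  exists_second ho hN := searchData_exists_second hid ho hN
  exists_outgoing h hj := exists_outgoing_of_snd hid (searchData_snd_of_ne h hj)
  bridge_outgoing := hout
  bridge_min := hmin

end Result

/-! ### Reconstructing the path by public queries -/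

/-- A public query: for the two unmatched nodes, or for the part of a path between the node with
identifier `v` and the node with identifier `x`. The path belongs to the smaller or to the larger
label of `x`, according to whether `second` is `false` or `true`. -/
inductive Query where
  | start
  | seg (v x : ℕ) (second : Bool)

/-- The public knowledge during the reconstruction: a stack of queries, and the edges of the path
that are known already, as pairs of identifiers. -/
structure Board where
  pending : List Query
  edges : Set (Sym2 ℕ)

/-- Answers to queries are coded by numbers, with digits to the base `K`. The order of the codes
refines the order of the leading entry `a`. -/
def answerCode (K a z y c : ℕ) : ℕ := ((a * K + z) * K + y) * K + c

theorem answerCode_mod {K a z y c : ℕ} (hc : c < K) : answerCode K a z y c % K = c := by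
  unfold answerCode
  rw [Nat.mul_add_mod_of_lt hc]

theorem answerCode_div {K a z y c : ℕ} (hy : y < K) (hc : c < K) :
    answerCode K a z y c / K % K = y := by
  unfold answerCode
  rw [Nat.mul_comm, Nat.mul_add_div (by omega), Nat.div_eq_of_lt hc, Nat.add_zero,
    Nat.mul_add_mod_of_lt hy]

theorem answerCode_div_div {K a z y c : ℕ} (hz : z < K) (hy : y < K) (hc : c < K) :
    answerCode K a z y c / K / K % K = z := by
  unfold answerCode
  rw [Nat.mul_comm, Nat.mul_add_div (by omega), Nat.div_eq_of_lt hc, Nat.add_zero,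
    Nat.mul_comm, Nat.mul_add_div (by omega), Nat.div_eq_of_lt hy, Nat.add_zero,
    Nat.mul_add_mod_of_lt hz]

theorem answerCode_lt {K a z y c : ℕ} (ha : a < K ^ 2) (hz : z < K) (hy : y < K) (hc : c < K) :
    answerCode K a z y c < K ^ 5 := by
  unfold answerCode
  have step : ∀ {p q r : ℕ}, p < q → r < K → p * K + r < q * K := by
    intro p q r hp hr
    calc p * K + r < p * K + K := by omega
      _ = (p + 1) * K := by ring
      _ ≤ q * K := Nat.mul_le_mul_right _ hp
  calc ((a * K + z) * K + y) * K + c < K ^ 2 * K * K * K := step (step (step ha hz) hy) hc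
    _ = K ^ 5 := by ring

theorem le_of_answerCode_le {K a z y c a' z' y' c' : ℕ} (hz' : z' < K) (hy' : y' < K)
    (hc' : c' < K) (h : answerCode K a z y c ≤ answerCode K a' z' y' c') : a ≤ a' := by
  by_contra hlt
  have step : ∀ {p q r : ℕ}, p < q → r < K → p * K + r < q * K := by
    intro p q r hp hr
    calc p * K + r < p * K + K := by omega
      _ = (p + 1) * K := by ring
      _ ≤ q * K := Nat.mul_le_mul_right _ hp
  have h1 : answerCode K a' z' y' c' < a * K * K * K :=
    step (step (step (not_le.1 hlt) hz') hy') hc'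
  have h2 : a * K * K * K ≤ answerCode K a z y c := by
    unfold answerCode
    exact Nat.le_add_right_of_le (Nat.mul_le_mul_right _ (Nat.le_add_right_of_le
      (Nat.mul_le_mul_right _ (Nat.le_add_right _ _))))
  omega

theorem key_lt_sq {K m n : ℕ} (h : m + n + 1 < K) : SearchData.key K m n < K ^ 2 := by
  unfold SearchData.key
  have : (m + n + 1 + 1) * K ≤ K * K := Nat.mul_le_mul_right _ h
  calc (m + n + 1) * K + max m n < (m + n + 1) * K + K := by omega
    _ = (m + n + 1 + 1) * K := by ring
    _ ≤ K * K := this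
    _ = K ^ 2 := by ring

/-- The flag of a label: `0` for the smaller label of a node, `1` for the larger one. -/
def Rec.flag (R : Rec) (m : ℕ) : ℕ := if R.fst = some m then 0 else 1

/-- Put a query for the path between `v` and `x` on the stack, unless the path is trivial. -/
def pushQuery (v x : ℕ) (second : Bool) (l : List Query) : List Query :=
  if x = v then l else .seg v x second :: l

/-- The effect of the answer `c` on the board. For a path to the smaller label of `x`, the answer
contains the parent of `x`. For the larger label it contains the ends of the bridge of `x`, where
two shorter paths remain. -/
def Board.next (K c : ℕ) (B : Board) : Board :=
  match B.pending with
  | [] => B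
  | .start :: l => ⟨pushQuery (c / K / K % K) (c / K % K) (decide (c % K = 1)) l, B.edges⟩
  | .seg v x false :: l => ⟨pushQuery v (c / K / K % K) (decide (c % K = 1)) l,
      insert s(x, c / K / K % K) B.edges⟩
  | .seg v x true :: l => ⟨pushQuery v (c / K % K) (decide (c % K % 2 = 1))
      (pushQuery x (c / K / K % K) (decide (c % K / 2 = 1)) l),
      insert s(c / K / K % K, c / K % K) B.edges⟩

/-- The node with identifier `self` and record `R` offers the answer `c` to a query. The node knows
the records of its neighbours; `lone` says that it is the unmatched node other than the root. -/
def Offered (K self : ℕ) (lb : Set ℕ) (lone : Prop) (R : Rec) (nbr : ℕ → Option Rec) :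
    Query → ℕ → Prop
  | .start, c => lone ∧ ∃ m, R.Has m ∧ m % 2 = 1 ∧
      c = answerCode K 0 (R.anc 0 - 1) self (R.flag m)
  | .seg _ x false, c => x = self ∧ ∃ k q R', R.fst = some (k + 1) ∧ nbr q = some R' ∧
      q + 1 = R.anc (R.dep - 1) ∧ c = answerCode K 0 q 0 (R'.flag k)
  | .seg _ x true, c => ∃ m n q R', R.Has m ∧ nbr q = some R' ∧ R'.Has n ∧ m % 2 = n % 2 ∧
      Fits lb m q ∧ (∃ i, R.anc i = x + 1) ∧ (¬ ∃ i, R'.anc i = x + 1) ∧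
      c = answerCode K (SearchData.key K m n) self q (2 * R.flag m + R'.flag n)

/-- The best answer of a node to the query on top of the stack, where `K ^ 5` stands for no
answer. -/
noncomputable def offer (K self : ℕ) (lb : Set ℕ) (lone : Prop) (R : Rec) (nbr : ℕ → Option Rec)
    (pending : List Query) : ℕ :=
  sInf {c | c = K ^ 5 ∨ ∃ q l, pending = q :: l ∧ Offered K self lb lone R nbr q c}

/-- The edges between consecutive entries of a list. -/
def pathEdges {α : Type*} : List α → Set (Sym2 α)
  | x :: y :: l => insert s(x, y) (pathEdges (y :: l))
  | _ => ∅

theorem pathEdges_append {α : Type*} (A B : List α) (x y : α) :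
    pathEdges (A ++ x :: y :: B) = pathEdges (A ++ [x]) ∪ {s(x, y)} ∪ pathEdges (y :: B) := by
  induction A with
  | nil => simp [pathEdges]
  | cons a A ih =>
    cases A with
    | nil =>
      simp only [List.cons_append, List.nil_append, pathEdges] at *
      ext e; simp; tauto
    | cons a' A =>
      simp only [List.cons_append, pathEdges] at *
      rw [ih]
      ext e; simp only [Set.mem_insert_iff, Set.mem_union, Set.mem_singleton_iff]; tauto

theorem pathEdges_reverse {α : Type*} (l : List α) : pathEdges l.reverse = pathEdges l := by
  induction l with
  | nil => rfl
  | cons x l ih =>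
    cases l with
    | nil => rfl
    | cons y l =>
      have : (x :: y :: l).reverse = l.reverse ++ y :: x :: [] := by simp
      rw [this, pathEdges_append]
      have h2 : l.reverse ++ [y] = (y :: l).reverse := by simp
      rw [h2, ih]
      ext e
      simp only [pathEdges, Set.mem_union, Set.mem_insert_iff, Set.mem_singleton_iff,
        Set.mem_empty_iff_false, or_false, Sym2.eq_swap (a := y)]
      tauto

theorem pathEdges_map {α β : Type*} (φ : α → β) (l : List α) :
    pathEdges (l.map φ) = Sym2.map φ '' pathEdges l := by
  induction l with
  | nil => simp [pathEdges]
  | cons x l ih =>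
    cases l with
    | nil => simp [pathEdges]
    | cons y l =>
      simp only [List.map_cons, pathEdges] at *
      rw [ih, Set.image_insert_eq]
      rfl

theorem pathEdges_support {V : Type*} {G : SimpleGraph V} {u v : V} (p : G.Walk u v) :
    pathEdges p.support = {e | e ∈ p.edges} := by
  induction p with
  | nil => simp [pathEdges]
  | cons h p ih =>
    rw [SimpleGraph.Walk.support_cons, ← SimpleGraph.Walk.cons_tail_support p, pathEdges,
      SimpleGraph.Walk.cons_tail_support, ih]
    ext e
    simp

section Reconstruction

variable {V : Type*} {G : SimpleGraph V} {M : G.Subgraph} {ident : V → ℕ} {f : V} {N K : ℕ}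
  {lone : V → Prop}

local notation "ρ" => recAt M ident f (N + 2)

/-- The answer of a network in which every node knows its record and those of its neighbours: the
least code that is offered by some node. -/
noncomputable def answer (M : G.Subgraph) (ident : V → ℕ) (f : V) (N K : ℕ) (lone : V → Prop)
    (pending : List Query) : ℕ :=
  sInf {c | c = K ^ 5 ∨ ∃ w q l, pending = q :: l ∧ Offered K (ident w)
    (ident '' M.neighborSet w) (lone w) (recAt M ident f (N + 2) N w)
    (heard G ident (recAt M ident f (N + 2) N) w) q c}

/-- The board after one more query has been answered. -/
noncomputable def advance (M : G.Subgraph) (ident : V → ℕ) (f : V) (N K : ℕ) (lone : V → Prop)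
    (B : Board) : Board :=
  B.next K (answer M ident f N K lone B.pending)

/-- The edge from `z` to `y` leaves the subtree of `x`, as seen in the records. -/
def RecOutgoing (M : G.Subgraph) (ident : V → ℕ) (f : V) (N : ℕ) (x z y : V) (m n : ℕ) : Prop :=
  (recAt M ident f (N + 2) N z).Has m ∧ (recAt M ident f (N + 2) N y).Has n ∧ m % 2 = n % 2 ∧
    LevelEdge M m z y ∧ (∃ i, (recAt M ident f (N + 2) N z).anc i = ident x + 1) ∧
    ¬ ∃ i, (recAt M ident f (N + 2) N y).anc i = ident x + 1

/-- The code by which an edge is offered as a bridge. -/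
noncomputable def bridgeCode (M : G.Subgraph) (ident : V → ℕ) (f : V) (N K : ℕ) (z y : V)
    (m n : ℕ) : ℕ :=
  answerCode K (SearchData.key K m n) (ident z) (ident y)
    (2 * (recAt M ident f (N + 2) N z).flag m + (recAt M ident f (N + 2) N y).flag n)

open Classical in
/-- The edge of least code that leaves the subtree of `x`, with the labels of its ends. -/
noncomputable def bridge (M : G.Subgraph) (ident : V → ℕ) (f : V) (N K : ℕ) (x : V) :
    V × V × ℕ × ℕ :=
  if h : ∃ e : V × V × ℕ × ℕ, RecOutgoing M ident f N x e.1 e.2.1 e.2.2.1 e.2.2.2 ∧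
    ∀ z y m n, RecOutgoing M ident f N x z y m n →
      bridgeCode M ident f N K e.1 e.2.1 e.2.2.1 e.2.2.2 ≤ bridgeCode M ident f N K z y m n
  then h.choose else (x, x, 0, 0)

theorem bridge_spec {x z y : V} {m n : ℕ} (h : RecOutgoing M ident f N x z y m n) :
    RecOutgoing M ident f N x (bridge M ident f N K x).1 (bridge M ident f N K x).2.1
      (bridge M ident f N K x).2.2.1 (bridge M ident f N K x).2.2.2 ∧
    ∀ z y m n, RecOutgoing M ident f N x z y m n →
      bridgeCode M ident f N K (bridge M ident f N K x).1 (bridge M ident f N K x).2.1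
        (bridge M ident f N K x).2.2.1 (bridge M ident f N K x).2.2.2 ≤
        bridgeCode M ident f N K z y m n := by
  have hex : ∃ e : V × V × ℕ × ℕ, RecOutgoing M ident f N x e.1 e.2.1 e.2.2.1 e.2.2.2 ∧
    ∀ z y m n, RecOutgoing M ident f N x z y m n →
      bridgeCode M ident f N K e.1 e.2.1 e.2.2.1 e.2.2.2 ≤ bridgeCode M ident f N K z y m n := by
    have hne : ({c | ∃ z y m n, RecOutgoing M ident f N x z y m n ∧
        bridgeCode M ident f N K z y m n = c} : Set ℕ).Nonempty := ⟨_, z, y, m, n, h, rfl⟩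
    obtain ⟨z', y', m', n', h1, h2⟩ := Nat.sInf_mem hne
    refine ⟨(z', y', m', n'), h1, fun a b c d hr => ?_⟩
    change bridgeCode M ident f N K z' y' m' n' ≤ _
    rw [h2]
    exact Nat.sInf_le ⟨a, b, c, d, hr, rfl⟩
  have : bridge M ident f N K x = hex.choose := dif_pos hex
  rw [this]
  exact hex.choose_spec

/-- The search data with the bridges that the answers to the queries produce. -/
noncomputable abbrev finalData (M : G.Subgraph) (ident : V → ℕ) (f : V) (N K : ℕ) :
    SearchData M f N K :=
  searchData M ident f N K (fun x => (bridge M ident f N K x).1)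
    (fun x => (bridge M ident f N K x).2.1) (fun x => (bridge M ident f N K x).2.2.1)
    (fun x => (bridge M ident f N K x).2.2.2)

local notation "𝒟" => finalData M ident f N K

theorem outgoing_iff (hid : Function.Injective ident) {x z y : V} {m n : ℕ} :
    (𝒟).Outgoing x z y m n ↔ RecOutgoing M ident f N x z y m n := by
  constructor
  · rintro ⟨h1, h2, h3, h4, h5, h6⟩
    exact ⟨h3, h4, h5, h6, (searchData_desc_iff_exists hid h3).1 h1,
      fun h => h2 ((searchData_desc_iff_exists hid h4).2 h)⟩
  · rintro ⟨h3, h4, h5, h6, h1, h2⟩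
    exact ⟨(searchData_desc_iff_exists hid h3).2 h1,
      fun h => h2 ((searchData_desc_iff_exists hid h4).1 h), h3, h4, h5, h6⟩

theorem flag_le (R : Rec) (m : ℕ) : R.flag m ≤ 1 := by
  unfold Rec.flag
  split_ifs <;> omega

theorem finalData_valid (hid : Function.Injective ident) (hK : 2 * N + 3 < K)
    (hident : ∀ v, ident v < K) : (𝒟).Valid := by
  have key : ∀ {v j}, (𝒟).lab v j → j ≠ (𝒟).rank v →
      ∃ z y m n, RecOutgoing M ident f N v z y m n := by
    intro v j hl hj
    obtain ⟨z, y, m, n, h1, -⟩ := exists_outgoing_of_snd (K := K)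
      (bi := fun x => (bridge M ident f N K x).1) (bo := fun x => (bridge M ident f N K x).2.1)
      (li := fun x => (bridge M ident f N K x).2.2.1)
      (lo := fun x => (bridge M ident f N K x).2.2.2) hid (searchData_snd_of_ne hl hj)
    exact ⟨z, y, m, n, (outgoing_iff hid).1 h1⟩
  refine searchData_valid hid (by omega) ?_ ?_
  · intro v j hl hj
    obtain ⟨z, y, m, n, h⟩ := key hl hj
    exact (outgoing_iff hid).2 (bridge_spec h).1
  · intro v x y j m n _ _ ho
    have h1 := (outgoing_iff hid).1 ho
    have h2 := flag_le (recAt M ident f (N + 2) N x) m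
    have h3 := flag_le (recAt M ident f (N + 2) N y) n
    exact le_of_answerCode_le (hident x) (hident y) (by omega) ((bridge_spec h1).2 _ _ _ _ h1)

theorem answer_eq {q : Query} {l : List Query} {c : ℕ} (hc : c < K ^ 5)
    (h : ∃ w, Offered K (ident w) (ident '' M.neighborSet w) (lone w) (ρ N w)
      (heard G ident (ρ N) w) q c)
    (hmin : ∀ w c', Offered K (ident w) (ident '' M.neighborSet w) (lone w) (ρ N w)
      (heard G ident (ρ N) w) q c' → c ≤ c') : answer M ident f N K lone (q :: l) = c := by
  obtain ⟨w, hw⟩ := h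
  apply le_antisymm
  · exact Nat.sInf_le (.inr ⟨w, q, l, rfl, hw⟩)
  · refine le_csInf ⟨_, .inl rfl⟩ ?_
    rintro c' (rfl | ⟨w', q', l', h1, h2⟩)
    · exact hc.le
    · cases h1
      exact hmin w' c' h2

theorem offered_second_iff (hid : Function.Injective ident) {w x : V} {v c : ℕ} :
    Offered K (ident w) (ident '' M.neighborSet w) (lone w) (ρ N w) (heard G ident (ρ N) w)
      (.seg v (ident x) true) c ↔
    ∃ y m n, RecOutgoing M ident f N x w y m n ∧ c = bridgeCode M ident f N K w y m n := by
  constructor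
  · rintro ⟨m, n, q, R', h1, h2, h3, h4, h5, h6, h7, h8⟩
    obtain ⟨y, hy, rfl, rfl⟩ := (heard_eq_some hid).1 h2
    exact ⟨y, m, n, ⟨h1, h3, h4, (fits_iff hid hy).1 h5, h6, h7⟩, h8⟩
  · rintro ⟨y, m, n, ⟨h1, h2, h3, h4, h5, h6⟩, rfl⟩
    exact ⟨m, n, ident y, _, h1, (heard_eq_some hid).2 ⟨y, h4.1, rfl, rfl⟩, h2, h3,
      (fits_iff hid h4.1).2 h4, h5, h6, rfl⟩

theorem flag_eq (hid : Function.Injective ident) {v : V} {n : ℕ} (h : (𝒟).lab v n) :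
    (ρ N v).flag n = if n = (𝒟).rank v then 0 else 1 := by
  unfold Rec.flag
  rw [searchData_fst hid h]
  simp [eq_comm]

/-- The queries for a path collect its edges, one at a time. -/
theorem advance_seg (hid : Function.Injective ident) (hK : 2 * N + 3 < K)
    (hident : ∀ v, ident v < K) {v x : V} {n : ℕ} {Q : List V} (hs : (𝒟).Seg v x n Q) :
    ∀ (l : List Query) (E : Set (Sym2 ℕ)), (advance M ident f N K lone)^[Q.length]
      ⟨pushQuery (ident v) (ident x) (decide (n ≠ (𝒟).rank x)) l, E⟩ =
      ⟨l, pathEdges ((Q ++ [v]).map ident) ∪ E⟩ := by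
  have hval : (𝒟).Valid := finalData_valid hid hK hident
  induction hs with
  | nil v => intro l E; simp [pushQuery, pathEdges]
  | first v x n Q hxv hxf hl hr hs ih =>
    intro l E
    obtain ⟨k, hk, hlk, e, -, hanc⟩ := searchData_par_spec hid hl hxf
    obtain rfl : k = n := Nat.succ.inj (hk.symm.trans hr)
    have hpar : ident ((𝒟).par x) + 1 = (ρ N x).anc ((ρ N x).dep - 1) := by
      obtain ⟨k', -, hlk', -, hdep, hanc⟩ := searchData_par_spec hid hl hxf
      rw [hanc, hdep, if_neg (by omega)]
      exact (searchData_anc_self hid hlk').symm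
    have hfl := flag_le (ρ N ((𝒟).par x)) k
    have hans : answer M ident f N K lone (.seg (ident v) (ident x) false :: l) =
        answerCode K 0 (ident ((𝒟).par x)) 0 ((ρ N ((𝒟).par x)).flag k) := by
      refine answer_eq (answerCode_lt (pow_pos (by omega) 2) (hident _) (by omega) (by omega))
        ⟨x, rfl, k, _, _, ?_, (heard_eq_some hid).2 ⟨_, e.1.symm, rfl, rfl⟩, hpar, rfl⟩ ?_
      · rw [searchData_fst hid hl, hr]
      · rintro w c' ⟨h1, k', q, R', h2, h3, h4, rfl⟩
        obtain rfl := hid h1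
        obtain ⟨y, hy, rfl, rfl⟩ := (heard_eq_some hid).1 h3
        obtain rfl : y = (𝒟).par x := hid (by omega)
        rw [searchData_fst hid hl, hr] at h2
        have := Option.some.inj h2
        obtain rfl : k' = k := by omega
        exact le_rfl
    rw [List.length_cons, Function.iterate_succ_apply]
    have hpush : pushQuery (ident v) (ident x) (decide (k + 1 ≠ (𝒟).rank x)) l =
        .seg (ident v) (ident x) false :: l := by
      simp [pushQuery, hid.eq_iff, hxv, hr]
    rw [hpush]
    have hadv : advance M ident f N K lone ⟨.seg (ident v) (ident x) false :: l, E⟩ =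
        ⟨pushQuery (ident v) (ident ((𝒟).par x)) (decide (k ≠ (𝒟).rank ((𝒟).par x))) l,
          insert s(ident x, ident ((𝒟).par x)) E⟩ := by
      unfold advance Board.next
      simp only [hans, answerCode_mod (show (ρ N ((𝒟).par x)).flag k < K by omega),
        answerCode_div_div (hident ((𝒟).par x)) (show 0 < K by omega)
          (show (ρ N ((𝒟).par x)).flag k < K by omega)]
      congr 2
      rw [flag_eq hid hlk]
      simp
    rw [hadv, ih]
    congr 1
    have hQ : ∃ Q', Q ++ [v] = (𝒟).par x :: Q' := (hs.altPath hval).eq_cons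
    obtain ⟨Q', hQ'⟩ := hQ
    rw [List.cons_append, hQ']
    simp only [List.map_cons, pathEdges]
    ext e; simp only [Set.mem_union, Set.mem_insert_iff]; tauto
  | second v x j Q Q' hxv hxf hl hr hd hs hs' ih ih' =>
    intro l E
    have ho := hval.bridge_outgoing hl hr
    obtain ⟨hb1, hb2⟩ := bridge_spec (K := K) ((outgoing_iff hid).1 ho)
    set z := (𝒟).bridgeIn x with hz
    set y := (𝒟).bridgeOut x with hy
    set a := (𝒟).labIn x with ha
    set b := (𝒟).labOut x with hb
    have hfz := flag_le (ρ N z) a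
    have hfy := flag_le (ρ N y) b
    have haN := hval.lab_le ho.lab_in
    have hbN := hval.lab_le ho.lab_out
    have hans : answer M ident f N K lone (.seg (ident v) (ident x) true :: l) =
        bridgeCode M ident f N K z y a b := by
      refine answer_eq (answerCode_lt (key_lt_sq (by omega)) (hident _) (hident _) (by omega))
        ⟨z, (offered_second_iff hid).2 ⟨y, a, b, hb1, rfl⟩⟩ ?_
      intro w c' hc'
      obtain ⟨y', m, n, h1, rfl⟩ := (offered_second_iff hid).1 hc'
      exact hb2 _ _ _ _ h1
    have hpush : pushQuery (ident v) (ident x) (decide (j ≠ (𝒟).rank x)) l =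
        .seg (ident v) (ident x) true :: l := by
      simp [pushQuery, hid.eq_iff, hxv, hr]
    have hlen : (x :: (Q'.reverse ++ Q)).length = Q'.length + Q.length + 1 := by simp
    rw [hlen, Function.iterate_succ_apply, hpush]
    have hadv : advance M ident f N K lone ⟨.seg (ident v) (ident x) true :: l, E⟩ =
        ⟨pushQuery (ident v) (ident y) (decide (b ≠ (𝒟).rank y))
          (pushQuery (ident x) (ident z) (decide (a ≠ (𝒟).rank z)) l),
          insert s(ident z, ident y) E⟩ := by
      have hc : 2 * (ρ N z).flag a + (ρ N y).flag b < K := by omega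
      unfold advance Board.next
      simp only [hans]
      unfold bridgeCode
      simp only [answerCode_mod hc, answerCode_div (hident y) hc,
        answerCode_div_div (hident z) (hident y) hc]
      have e1 : (2 * (ρ N z).flag a + (ρ N y).flag b) % 2 = (ρ N y).flag b := by omega
      have e2 : (2 * (ρ N z).flag a + (ρ N y).flag b) / 2 = (ρ N z).flag a := by omega
      rw [e1, e2, flag_eq hid ho.lab_out, flag_eq hid ho.lab_in]
      simp
    rw [hadv, Function.iterate_add_apply, ih, ih']
    congr 1
    obtain ⟨A, hA⟩ : ∃ A, Q' ++ [x] = z :: A := (hs'.altPath hval).eq_cons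
    obtain ⟨C, hC⟩ : ∃ C, Q ++ [v] = y :: C := (hs.altPath hval).eq_cons
    have hlist : x :: (Q'.reverse ++ Q) ++ [v] = A.reverse ++ z :: y :: C := by
      have h1 : x :: Q'.reverse = A.reverse ++ [z] := by
        have := congrArg List.reverse hA
        simpa using this
      calc x :: (Q'.reverse ++ Q) ++ [v] = (x :: Q'.reverse) ++ (Q ++ [v]) := by simp
        _ = _ := by rw [h1, hC]; simp
    have hrev : pathEdges ((A.reverse ++ [z]).map ident) = pathEdges ((Q' ++ [x]).map ident) := by
      rw [hA, ← pathEdges_reverse ((z :: A).map ident)]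
      simp
    have happ : pathEdges ((A.reverse ++ z :: y :: C).map ident) =
        pathEdges ((A.reverse ++ [z]).map ident) ∪ {s(ident z, ident y)} ∪
          pathEdges ((y :: C).map ident) := by
      simp only [List.map_append, List.map_cons, List.map_nil]
      exact pathEdges_append _ _ _ _
    rw [hlist, happ, hrev, hC]
    ext e
    simp only [Set.mem_union, Set.mem_insert_iff, Set.mem_singleton_iff]
    tauto

/-- After all queries have been answered, the board shows the edges of a shortest augmenting
path. -/
theorem advance_start (hid : Function.Injective ident) (hK : 2 * N + 3 < K)
    (hident : ∀ v, ident v < K) {g : V} (hfg : f ≠ g) (hlone : ∀ w, lone w ↔ w = g) {L : ℕ}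
    (hL : ∃ l, IsShortestAug M f g L l) (hN : L ≤ N) :
    ∃ l, IsShortestAug M f g L l ∧ (∀ v ∈ l, ∃ n, (ρ N v).fst = some n) ∧
      (advance M ident f N K lone)^[N + 1] ⟨[.start], ∅⟩ = ⟨[], pathEdges (l.map ident)⟩ := by
  have hval : (𝒟).Valid := finalData_valid hid hK hident
  have hodd : L % 2 = 1 := hL.choose_spec.2.1
  obtain ⟨hl, hshort⟩ := hval.isShortestAug hL hN
  obtain ⟨Q, hQ⟩ := hval.exists_seg_root hl
  have hanc := searchData_anc_zero hid _ hl rfl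
  have hfl := flag_le (ρ N g) L
  refine ⟨Q ++ [f], hshort Q hQ, ?_, ?_⟩
  · have key : ∀ {v x : V} {n : ℕ} {Q : List V}, (𝒟).Seg v x n Q → ∀ q ∈ Q, ∃ k, (𝒟).lab q k := by
      intro v x n Q hs
      induction hs with
      | nil => simp
      | first v x n Q _ _ hl _ _ ih =>
        intro q hq
        rcases List.mem_cons.1 hq with rfl | hq
        · exact ⟨_, hl⟩
        · exact ih q hq
      | second v x j Q Q' _ _ hl _ _ _ _ ih ih' =>
        intro q hq
        simp only [List.mem_cons, List.mem_append, List.mem_reverse] at hq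
        rcases hq with rfl | hq | hq
        · exact ⟨_, hl⟩
        · exact ih' q hq
        · exact ih q hq
    intro v hv
    rcases List.mem_append.1 hv with hv | hv
    · obtain ⟨k, hk⟩ := key hQ v hv
      exact ⟨_, searchData_fst hid hk⟩
    · rw [List.mem_singleton.1 hv]
      exact ⟨_, (recAt_root hid N).1⟩
  · have hans : answer M ident f N K lone [.start] =
        answerCode K 0 (ident f) (ident g) ((ρ N g).flag L) := by
      refine answer_eq (answerCode_lt (pow_pos (by omega) 2) (hident _) (hident _) (by omega))
        ⟨g, (hlone g).2 rfl, L, hl, hodd, ?_⟩ ?_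
      · rw [hanc, Nat.add_sub_cancel]
      · rintro w c' ⟨h1, m, h2, h3, rfl⟩
        obtain rfl := (hlone w).1 h1
        obtain rfl := hval.lab_unique h2 hl (by omega)
        rw [hanc, Nat.add_sub_cancel]
    have hadv : advance M ident f N K lone ⟨[.start], ∅⟩ =
        ⟨pushQuery (ident f) (ident g) (decide (L ≠ (𝒟).rank g)) [], ∅⟩ := by
      have hc : (ρ N g).flag L < K := by omega
      unfold advance Board.next
      simp only [hans, answerCode_mod hc, answerCode_div (hident g) hc,
        answerCode_div_div (hident f) (hident g) hc]
      rw [flag_eq hid hl]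
      simp
    have hlen : Q.length = L := by
      have := hQ.length_eq hval
      rw [hval.rank_root] at this
      omega
    have hempty : ∀ (k : ℕ) (E : Set (Sym2 ℕ)),
        (advance M ident f N K lone)^[k] ⟨[], E⟩ = ⟨[], E⟩ := by
      intro k E
      induction k with
      | zero => rfl
      | succ k ih => rw [Function.iterate_succ_apply]; exact ih
    have hseg := advance_seg (lone := lone) hid hK hident hQ [] ∅
    rw [hlen] at hseg
    rw [show N + 1 = (N - L) + L + 1 by omega, Function.iterate_succ_apply, hadv,
      Function.iterate_add_apply, hseg, hempty, Set.union_empty]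

end Reconstruction

/-! ### Programs for the CONGEST model -/

/-- One round of a program: every node tells all of its neighbours the number `out s`, and updates
its state from the numbers that it hears. -/
structure Round (S : Type) where
  out : S → ℕ
  upd : S → (ℕ → Option ℕ) → S

/-- The effect of a round on the states of all nodes; the numbers are cut off to `w` bits. -/
noncomputable def Round.run {V : Type*} {S : Type} (G : SimpleGraph V) (ident : V → ℕ) (w : ℕ)
    (r : Round S) (cfg : V → S) : V → S :=
  fun v => r.upd (cfg v) (heard G ident (fun u => r.out (cfg u) % 2 ^ w) v)

/-- The effect of a sequence of rounds on the states of all nodes. -/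
noncomputable def runRounds {V : Type*} {S : Type} (G : SimpleGraph V) (ident : V → ℕ) (w : ℕ) :
    List (Round S) → (V → S) → V → S
  | [], cfg => cfg
  | r :: prog, cfg => runRounds G ident w prog (r.run G ident w cfg)

/-- The deterministic algorithm that executes a sequence of rounds. Its state contains the rounds
that remain to be executed. -/
def CongestAlgorithm.ofRounds {S : Type} (w : ℕ) (prog : List (Round S))
    (init : ℕ → Set ℕ → Set ℕ → S) (output : S → ℕ → Bool) : CongestAlgorithm where
  State := S × List (Round S)
  bandwidth := w
  coins := 0
  rounds := prog.length
  init self nbrs labelled _ := (init self nbrs labelled, prog)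
  send s _ i := match s.2 with
    | [] => false
    | r :: _ => (r.out s.1).testBit i
  receive s inbox := match s.2 with
    | [] => s
    | r :: l => (r.upd s.1 fun k => (inbox k).map Nat.ofBits, l)
  output s k := output s.1 k

section Program

variable {V : Type*} {S : Type} {G : SimpleGraph V} {M : G.Subgraph} {ident : V → ℕ} {w : ℕ}

theorem runRounds_append (p q : List (Round S)) (cfg : V → S) :
    runRounds G ident w (p ++ q) cfg = runRounds G ident w q (runRounds G ident w p cfg) := by
  induction p generalizing cfg with
  | nil => rfl
  | cons r p ih => exact ih _

theorem stateAfter_ofRounds (prog : List (Round S)) (init : ℕ → Set ℕ → Set ℕ → S)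
    (output : S → ℕ → Bool)
    (ω : V → Fin (CongestAlgorithm.ofRounds w prog init output).coins → Bool) :
    ∀ (p q : List (Round S)), prog = p ++ q → ∀ v,
      (CongestAlgorithm.ofRounds w prog init output).stateAfter G M ident ω p.length v =
      (runRounds G ident w p (fun v => init (ident v) (ident '' G.neighborSet v)
        (ident '' M.neighborSet v)) v, q) := by
  intro p
  induction p using List.reverseRecOn with
  | nil =>
    rintro q rfl v
    rfl
  | append_singleton p r ih =>
    rintro q hq v
    have ih' := ih (r :: q) (by simpa using hq)
    rw [List.length_append, List.length_singleton, runRounds_append]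
    have hin : ∀ k, ((CongestAlgorithm.ofRounds w prog init output).inbox G ident
        ((CongestAlgorithm.ofRounds w prog init output).stateAfter G M ident ω p.length) v k).map
          Nat.ofBits = heard G ident (fun u => r.out (runRounds G ident w p
            (fun v => init (ident v) (ident '' G.neighborSet v) (ident '' M.neighborSet v)) u)
              % 2 ^ w) v k := by
      intro k
      unfold CongestAlgorithm.inbox heard
      split_ifs with h
      · rw [ih' h.choose]
        simp only [Option.map_some]
        exact congrArg some (Nat.ofBits_testBit _ _)
      · rfl
    change (CongestAlgorithm.ofRounds w prog init output).receive _ _ = _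
    rw [ih' v]
    change (r.upd _ (fun k => ((CongestAlgorithm.ofRounds w prog init output).inbox G ident
      ((CongestAlgorithm.ofRounds w prog init output).stateAfter G M ident ω p.length) v k).map
          Nat.ofBits), q) = _
    simp only [hin]
    rfl

end Program

/-! ### The rounds of the algorithm -/

/-- The state of a node: its identifier, the identifiers of its neighbours and of those to which it
is joined by an edge of the matching, a register for the computation of minima, its record, the
words received from the neighbours (`buf j k` is word number `j` from the neighbour `k`), and the
public board. -/
structure NodeState where
  self : ℕ
  lb : Set ℕ
  nb : Set ℕ
  cur : ℕ
  record : Rec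
  buf : ℕ → ℕ → ℕ
  board : Board

/-- Word number `j` of a record. -/
def Rec.encode (R : Rec) (j : ℕ) : ℕ :=
  if j = 0 then R.fst.elim 0 (· + 1) else if j = 1 then R.snd.elim 0 (· + 1)
  else if j = 2 then R.dep else if j % 2 = 1 then R.anc ((j - 3) / 2) else R.tok ((j - 4) / 2)

/-- The record with the given words. -/
def Rec.decode (N : ℕ) (u : ℕ → ℕ) : Rec where
  fst := if u 0 = 0 then none else some (u 0 - 1)
  snd := if u 1 = 0 then none else some (u 1 - 1)
  dep := u 2
  anc i := if i < 2 * N + 2 then u (3 + 2 * i) else 0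
  tok k := if k < 2 * N + 2 then u (4 + 2 * k) else N + 2

/-- The number of words of a record. -/
def wordCount (N : ℕ) : ℕ := 4 * N + 7

namespace NodeState

/-- The records of the neighbours, as received. -/
noncomputable def nbrRecs (N : ℕ) (s : NodeState) (k : ℕ) : Option Rec :=
  open Classical in if k ∈ s.nb then some (decode N fun j => s.buf j k) else none

/-- The node is unmatched, but not the root. -/
def Lone (s : NodeState) : Prop := s.lb = ∅ ∧ s.record.fst ≠ some 0

/-- The number that the node offers as an answer to the next query. -/
noncomputable def offerCode (N K : ℕ) (s : NodeState) : ℕ :=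
  offer K s.self s.lb s.Lone s.record (s.nbrRecs N) s.board.pending

end NodeState

/-- A round of the computation of a minimum by flooding. -/
noncomputable def floodRound : Round NodeState where
  out s := s.cur
  upd s inbox := { s with cur := sInf {c | c = s.cur ∨ ∃ k, inbox k = some c} }

/-- The round in which word number `j` of the records is sent. -/
def wordRound (j : ℕ) : Round NodeState where
  out s := s.record.encode j
  upd s inbox := { s with buf := fun i k => if i = j then (inbox k).getD 0 else s.buf i k }

/-- A round of local computation. -/
def localRound (φ : NodeState → NodeState) : Round NodeState where
  out _ := 0
  upd s _ := φ s

open Classical in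
/-- The unmatched node that has found no smaller identifier of an unmatched node becomes the
root. -/
noncomputable def setRoot (N : ℕ) (s : NodeState) : NodeState :=
  { s with record := Rec.start (N + 2) s.self (s.lb = ∅ ∧ s.cur = s.self) }

/-- All nodes send their records. -/
def exchangeRounds (N : ℕ) : List (Round NodeState) := (List.range (wordCount N)).map wordRound

/-- One level of the search. -/
noncomputable def levelRounds (N s : ℕ) : List (Round NodeState) :=
  exchangeRounds N ++ [localRound fun t =>
    { t with record := update (N + 2) t.self t.lb s t.record (t.nbrRecs N) }]

/-- One public query. The best answer is found by flooding for `2 * N` rounds, because any two nodes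
of the search tree are joined by a walk of this length through the root. -/
noncomputable def queryRounds (N K : ℕ) : List (Round NodeState) :=
  localRound (fun t => { t with cur := t.offerCode N K }) :: (List.replicate (2 * N) floodRound ++
      [localRound fun t => { t with board := t.board.next K t.cur }])

/-- The whole program: the choice of the root, `N` levels of the search, a last exchange of the
records, and `N + 1` queries, of which the first one is for the far end of the path and each other
one yields at most one edge. -/
noncomputable def allRounds (N K : ℕ) : List (Round NodeState) :=
  List.replicate N floodRound ++ localRound (setRoot N) ::
    ((List.range N).flatMap (levelRounds N) ++ (exchangeRounds N ++
      (List.replicate (N + 1) (queryRounds N K)).flatten))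

open Classical in
/-- In the beginning, the unmatched nodes put their identifiers into the register for the
minimum, and the matched ones a number above all identifiers. -/
noncomputable def initState (N K self : ℕ) (nbrs labelled : Set ℕ) : NodeState where
  self := self
  lb := labelled
  nb := nbrs
  cur := if labelled = ∅ then self else K ^ 5
  record := Rec.start (N + 2) self False
  buf _ _ := 0
  board := ⟨[.start], ∅⟩

open Classical in
/-- The edges on the board are labelled, except by nodes outside of the search tree. -/
noncomputable def outputLabel (s : NodeState) (k : ℕ) : Bool :=
  decide (s.record.fst ≠ none ∧ s(s.self, k) ∈ s.board.edges)

/-- The algorithm for identifiers of `b` bits and augmenting paths of length at most `ℓ`. Such a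
path has fewer than `2 ^ b` edges, so `min ℓ (2 ^ b)` levels are enough. Answers to queries are
numbers up to `(2 ^ (b + 2)) ^ 5`, hence the word size. -/
noncomputable def pathAlgorithm (b ℓ : ℕ) : CongestAlgorithm :=
  .ofRounds (5 * (b + 2) + 1) (allRounds (min ℓ (2 ^ b)) (2 ^ (b + 2)))
    (initState (min ℓ (2 ^ b)) (2 ^ (b + 2))) outputLabel

theorem length_allRounds (N K : ℕ) : (allRounds N K).length = 6 * N ^ 2 + 17 * N + 10 := by
  have h1 : ((List.range N).flatMap (levelRounds N)).length = N * (wordCount N + 1) := by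
    rw [List.length_flatMap]
    simp [levelRounds, exchangeRounds]
  simp only [allRounds, List.length_append, List.length_cons, List.length_replicate, h1,
    List.length_flatten, List.map_replicate, List.sum_replicate, exchangeRounds, queryRounds,
    List.length_map, List.length_range, wordCount, smul_eq_mul, List.length_nil]
  ring

/-! ### Correctness of the rounds -/

section Rounds

variable {V : Type*} {G : SimpleGraph V} {M : G.Subgraph} {ident : V → ℕ} {f : V} {N K w : ℕ}

/-- Flooding changes only the registers: afterwards, the register of `v` contains the number that
some node had, and nothing larger than what any node at distance at most `n` had. -/
theorem runRounds_flood (hid : Function.Injective ident) {cfg : V → NodeState}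
    (hw : ∀ v, (cfg v).cur < 2 ^ w) (n : ℕ) : ∃ c : V → ℕ,
      (∀ v, runRounds G ident w (List.replicate n floodRound) cfg v = { cfg v with cur := c v }) ∧
      (∀ v, ∃ u, c v = (cfg u).cur) ∧
      ∀ (u v : V) (p : G.Walk u v), p.length ≤ n → c v ≤ (cfg u).cur := by
  induction n with
  | zero =>
    refine ⟨fun v => (cfg v).cur, fun v => rfl, fun v => ⟨v, rfl⟩, fun u v p hp => ?_⟩
    obtain rfl := SimpleGraph.Walk.eq_of_length_eq_zero (Nat.le_zero.1 hp)
    exact le_rfl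
  | succ n ih =>
    obtain ⟨c, h1, h2, h3⟩ := ih
    have hc : ∀ v, c v < 2 ^ w := fun v => by
      obtain ⟨u, hu⟩ := h2 v
      rw [hu]; exact hw u
    have hset : ∀ v k a, heard G ident (fun u => floodRound.out (runRounds G ident w
        (List.replicate n floodRound) cfg u) % 2 ^ w) v k = some a ↔
        ∃ u, G.Adj v u ∧ ident u = k ∧ c u = a := by
      intro v k a
      rw [heard_eq_some hid]
      change (∃ u, G.Adj v u ∧ ident u = k ∧
        (runRounds G ident w (List.replicate n floodRound) cfg u).cur % 2 ^ w = a) ↔ _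
      simp only [h1, Nat.mod_eq_of_lt (hc _)]
    refine ⟨fun v => sInf {a | a = c v ∨ ∃ u, G.Adj v u ∧ c u = a}, ?_, ?_, ?_⟩
    · intro v
      rw [List.replicate_succ', runRounds_append]
      change floodRound.upd _ _ = _
      rw [h1]
      simp only [floodRound]
      congr 3
      ext a
      refine or_congr Iff.rfl ⟨?_, ?_⟩
      · rintro ⟨k, hk⟩
        obtain ⟨u, h4, -, h5⟩ := (hset v k a).1 hk
        exact ⟨u, h4, h5⟩
      · rintro ⟨u, h4, h5⟩
        exact ⟨ident u, (hset v _ a).2 ⟨u, h4, rfl, h5⟩⟩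
    · intro v
      have hne : ({a | a = c v ∨ ∃ u, G.Adj v u ∧ c u = a} : Set ℕ).Nonempty := ⟨_, .inl rfl⟩
      change ∃ u, sInf {a | a = c v ∨ ∃ u, G.Adj v u ∧ c u = a} = (cfg u).cur
      rcases Nat.sInf_mem hne with h | ⟨u, -, h⟩
      · rw [h]; exact h2 v
      · rw [← h]; exact h2 u
    · intro u v p hp
      induction p using SimpleGraph.Walk.concatRec with
      | Hnil => exact (Nat.sInf_le (.inl rfl)).trans (h3 _ _ .nil (Nat.zero_le _))
      | Hconcat p h _ =>
        rw [SimpleGraph.Walk.length_concat] at hp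
        exact (Nat.sInf_le (.inr ⟨_, h.symm, rfl⟩)).trans (h3 _ _ p (by omega))

theorem runRounds_words (cfg : V → NodeState) (n : ℕ) (v : V) :
    runRounds G ident w ((List.range n).map wordRound) cfg v = { cfg v with
      buf := fun i k => if i < n then
        (heard G ident (fun u => (cfg u).record.encode i % 2 ^ w) v k).getD 0
        else (cfg v).buf i k } := by
  induction n generalizing v with
  | zero => simp [runRounds]
  | succ n ih =>
    rw [List.range_succ, List.map_append, runRounds_append]
    change (wordRound n).upd _ _ = _
    simp only [ih, wordRound]
    congr 1
    funext i k
    split_ifs with h1 h2 h3 h4 h5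
    · rw [h1]
    · omega
    · rfl
    · omega
    · omega
    · rfl

/-- The record can be sent in the words of `w` bits. -/
structure Rec.Sendable (R : Rec) (N w : ℕ) : Prop where
  anc_eq : ∀ i, 2 * N + 2 ≤ i → R.anc i = 0
  tok_eq : ∀ k, 2 * N + 2 ≤ k → R.tok k = N + 2
  lt : ∀ j, R.encode j < 2 ^ w

theorem Rec.Sendable.decode_encode {R : Rec} (h : R.Sendable N w) {u : ℕ → ℕ}
    (hu : ∀ j < wordCount N, u j = R.encode j % 2 ^ w) : decode N u = R := by
  have hu' : ∀ j < wordCount N, u j = R.encode j := fun j hj => by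
    rw [hu j hj, Nat.mod_eq_of_lt (h.lt j)]
  unfold wordCount at hu'
  apply Rec.ext
  · simp only [decode, hu' 0 (by omega), encode]
    rcases R.fst with _ | m <;> simp
  · simp only [decode, hu' 1 (by omega), encode]
    rcases R.snd with _ | m <;> simp
  · simp [decode, hu' 2 (by omega), encode]
  · funext i
    simp only [decode]
    split_ifs with hi
    · rw [hu' _ (by omega), encode, if_neg (by omega), if_neg (by omega), if_neg (by omega),
        if_pos (by omega)]
      congr 1
      omega
    · exact (h.anc_eq i (by omega)).symm
  · funext k
    simp only [decode]
    split_ifs with hk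
    · rw [hu' _ (by omega), encode, if_neg (by omega), if_neg (by omega), if_neg (by omega),
        if_neg (by omega)]
      congr 1
      omega
    · exact (h.tok_eq k (by omega)).symm

local notation "ρ" => recAt M ident f (N + 2)

theorem recAt_bounds (hid : Function.Injective ident) {B : ℕ} (hB : ∀ v, ident v + 1 ≤ B) (s : ℕ) :
    ∀ v, (ρ s v).dep ≤ s ∧ (∀ i, s < i → (ρ s v).anc i = 0) ∧ (∀ i, (ρ s v).anc i ≤ B) ∧
      (∀ k, (ρ s v).tok k ≤ N + 2) ∧ ∀ k, 2 * s + 2 ≤ k → (ρ s v).tok k = N + 2 := by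
  induction s with
  | zero =>
    intro v
    have := hB v
    simp only [recAt, Rec.start]
    split_ifs
    · refine ⟨le_rfl, fun i hi => if_neg (by omega), fun i => ?_, fun _ => le_rfl, fun _ _ => rfl⟩
      change (if i = 0 then ident v + 1 else 0) ≤ B
      split_ifs <;> omega
    · exact ⟨le_rfl, fun _ _ => rfl, fun _ => Nat.zero_le _, fun _ => le_rfl, fun _ _ => rfl⟩
  | succ s ih =>
    intro v
    have htok : (∀ k, (ρ (s + 1) v).tok k ≤ N + 2) ∧
        ∀ k, 2 * (s + 1) + 2 ≤ k → (ρ (s + 1) v).tok k = N + 2 := by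
      refine ⟨fun k => ?_, fun k hk => ?_⟩
      · rw [recAt_succ_tok]
        exact Nat.sInf_le (.inl rfl)
      · rw [recAt_succ_tok]
        have hne : ({β | β = N + 2 ∨ IsToken (ident v) (ident '' M.neighborSet v) (ρ (s + 1) v)
          (heard G ident (ρ s) v) k β} : Set ℕ).Nonempty := ⟨_, .inl rfl⟩
        rcases Nat.sInf_mem hne with h | ⟨q, R', h1, h2⟩
        · exact h
        · obtain ⟨u, hu, rfl, rfl⟩ := (heard_eq_some hid).1 h1
          rcases h2 with ⟨m, n, h3, h4, -, -, h5, -⟩ | ⟨-, h3⟩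
          · have := recAt_label_le hid h3
            have := recAt_label_le hid h4
            omega
          · rw [h3]
            exact (ih u).2.2.2.2 k (by omega)
    obtain ⟨i1, i2, i3, -⟩ := ih v
    rcases recAt_succ_cases (M := M) (f := f) (top := N + 2) hid s v with
      ⟨-, -, -, -, h1, h2⟩ | ⟨-, -, -, u, -, -, h1, h2⟩ | ⟨m, -, -, h1, h2, -⟩
    · rw [h1, h2]
      exact ⟨by omega, fun i hi => i2 i (by omega), i3, htok⟩
    · obtain ⟨j1, j2, j3, -⟩ := ih u
      refine ⟨by omega, fun i hi => ?_, fun i => ?_, htok⟩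
      · rw [h2, if_neg (by omega), j2 i (by omega)]
      · rw [h2]
        have := hB v
        have := j3 i
        split_ifs <;> omega
    · rw [h1, h2]
      exact ⟨by omega, fun i hi => i2 i (by omega), i3, htok⟩

theorem recAt_sendable (hid : Function.Injective ident) (hident : ∀ v, ident v + 1 < 2 ^ w)
    (hN : N + 2 < 2 ^ w) {s : ℕ} (hs : s ≤ N) (v : V) : (ρ s v).Sendable N w := by
  obtain ⟨h1, h2, h3, h4, h5⟩ := recAt_bounds (M := M) (f := f) (N := N) hid
    (B := 2 ^ w - 1) (fun v => by have := hident v; omega) s v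
  refine ⟨fun i hi => h2 i (by omega), fun k hk => h5 k (by omega), fun j => ?_⟩
  have hlab : ∀ n, (ρ s v).Has n → n ≤ s := fun n hn => recAt_label_le hid hn
  unfold encode
  split_ifs
  · rcases h : (ρ s v).fst with _ | m
    · change 0 < _; omega
    · have := hlab m (.inl h)
      change m + 1 < _; omega
  · rcases h : (ρ s v).snd with _ | m
    · change 0 < _; omega
    · have := hlab m (.inr h)
      change m + 1 < _; omega
  · omega
  · have := h3 ((j - 3) / 2); omega
  · have := h4 ((j - 4) / 2); omega

/-- The states in which all nodes have the records of level `s`, and have not begun to answer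
queries. -/
def AtLevel (M : G.Subgraph) (ident : V → ℕ) (f : V) (N s : ℕ) (cfg : V → NodeState) : Prop :=
  ∀ v, (cfg v).self = ident v ∧ (cfg v).lb = ident '' M.neighborSet v ∧
    (cfg v).nb = ident '' G.neighborSet v ∧ (cfg v).record = recAt M ident f (N + 2) s v ∧
    (cfg v).board = ⟨[.start], ∅⟩

theorem AtLevel.exchange (hid : Function.Injective ident) (hident : ∀ v, ident v + 1 < 2 ^ w)
    (hN : N + 2 < 2 ^ w) {s : ℕ} (hs : s ≤ N) {cfg : V → NodeState}
    (h : AtLevel M ident f N s cfg) :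
    AtLevel M ident f N s (runRounds G ident w (exchangeRounds N) cfg) ∧
    ∀ v, (runRounds G ident w (exchangeRounds N) cfg v).nbrRecs N = heard G ident (ρ s) v := by
  unfold exchangeRounds
  refine ⟨fun v => ?_, fun v => ?_⟩
  · rw [runRounds_words]
    exact h v
  · rw [runRounds_words]
    funext k
    unfold NodeState.nbrRecs
    obtain ⟨-, -, h3, -⟩ := h v
    by_cases hk : k ∈ (cfg v).nb
    · rw [if_pos hk]
      rw [h3] at hk
      obtain ⟨u, hu, rfl⟩ := hk
      have e1 : heard G ident (ρ s) v (ident u) = some (ρ s u) :=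
        (heard_eq_some hid).2 ⟨u, hu, rfl, rfl⟩
      rw [e1]
      congr 1
      refine (recAt_sendable hid hident hN hs u).decode_encode fun j hj => ?_
      have e2 : heard G ident (fun u => (cfg u).record.encode j % 2 ^ w) v (ident u) =
          some ((cfg u).record.encode j % 2 ^ w) := (heard_eq_some hid).2 ⟨u, hu, rfl, rfl⟩
      simp only [hj, if_true, e2, Option.getD_some, (h u).2.2.2.1]
    · rw [if_neg hk]
      rw [h3] at hk
      rcases e : heard G ident (ρ s) v k with _ | R
      · rfl
      · obtain ⟨u, hu, rfl, -⟩ := (heard_eq_some hid).1 e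
        exact absurd ⟨u, hu, rfl⟩ hk

theorem AtLevel.levels (hid : Function.Injective ident) (hident : ∀ v, ident v + 1 < 2 ^ w)
    (hN : N + 2 < 2 ^ w) {cfg : V → NodeState} (h : AtLevel M ident f N 0 cfg) {s : ℕ}
    (hs : s ≤ N) :
    AtLevel M ident f N s (runRounds G ident w ((List.range s).flatMap (levelRounds N)) cfg) := by
  induction s with
  | zero => exact h
  | succ s ih =>
    obtain ⟨h1, h2⟩ := (ih (by omega)).exchange hid hident hN (by omega)
    rw [List.range_succ, List.flatMap_append, runRounds_append, List.flatMap_singleton, levelRounds,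
      runRounds_append]
    set cfg' := runRounds G ident w (exchangeRounds N)
      (runRounds G ident w ((List.range s).flatMap (levelRounds N)) cfg)
    intro v
    obtain ⟨e1, e2, e3, e4, e5⟩ := h1 v
    refine ⟨e1, e2, e3, ?_, e5⟩
    change update (N + 2) (cfg' v).self (cfg' v).lb s (cfg' v).record ((cfg' v).nbrRecs N) = _
    rw [e1, e2, e4, h2 v]
    rfl

/-- The states after `i` queries. Only the nodes in the search tree have the right board. -/
def AtQuery (M : G.Subgraph) (ident : V → ℕ) (f : V) (N K : ℕ) (lone : V → Prop) (i : ℕ)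
    (cfg : V → NodeState) : Prop :=
  ∀ v, (cfg v).self = ident v ∧ (cfg v).lb = ident '' M.neighborSet v ∧
    (cfg v).record = recAt M ident f (N + 2) N v ∧
    (cfg v).nbrRecs N = heard G ident (recAt M ident f (N + 2) N) v ∧
    ((recAt M ident f (N + 2) N v).fst ≠ none →
      (cfg v).board = (advance M ident f N K lone)^[i] ⟨[.start], ∅⟩)

/-- Only nodes in the search tree offer answers. -/
theorem fst_ne_none_of_offered (hid : Function.Injective ident) {v : V} {self c : ℕ} {lb : Set ℕ}
    {p : Prop} {nbr : ℕ → Option Rec} {q : Query} (h : Offered K self lb p (ρ N v) nbr q c) :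
    (ρ N v).fst ≠ none := by
  have key : ∀ m, (ρ N v).Has m → (ρ N v).fst ≠ none := by
    intro m hm
    obtain ⟨k, hk⟩ := recAt_fst_of_has hid hm
    rw [hk]; simp
  rcases q with _ | ⟨a, x, _ | _⟩
  · obtain ⟨-, m, hm, -⟩ := h
    exact key m hm
  · obtain ⟨-, k, -, -, hk, -⟩ := h
    rw [hk]; simp
  · obtain ⟨m, -, -, -, hm, -⟩ := h
    exact key m hm

theorem AtQuery.query (hid : Function.Injective ident) (hK : 2 * N + 3 < K)
    (hident : ∀ v, ident v < K) (hw : K ^ 5 < 2 ^ w) {lone : V → Prop}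
    (hlone : ∀ v, lone v ↔ (ident '' M.neighborSet v = ∅ ∧ (ρ N v).fst ≠ some 0)) {i : ℕ}
    {cfg : V → NodeState} (h : AtQuery M ident f N K lone i cfg) :
    AtQuery M ident f N K lone (i + 1) (runRounds G ident w (queryRounds N K) cfg) := by
  have hval := finalData_valid (M := M) (f := f) hid hK hident
  unfold queryRounds
  change AtQuery M ident f N K lone (i + 1) (runRounds G ident w
    (List.replicate (2 * N) floodRound ++
      [localRound fun t => { t with board := t.board.next K t.cur }])
    (fun v => { cfg v with cur := (cfg v).offerCode N K }))
  set cfg' : V → NodeState := fun v => { cfg v with cur := (cfg v).offerCode N K } with hcfg'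
  have hle : ∀ v, (cfg' v).cur ≤ K ^ 5 := fun v => Nat.sInf_le (.inl rfl)
  have hoff : ∀ v, (cfg' v).cur = offer K (ident v) (ident '' M.neighborSet v) (lone v) (ρ N v)
      (heard G ident (ρ N) v) (cfg v).board.pending := by
    intro v
    obtain ⟨e1, e2, e3, e4, -⟩ := h v
    have e5 : (cfg v).Lone = lone v := by
      rw [eq_iff_iff, hlone v, ← e2, ← e3]
      rfl
    simp only [hcfg', NodeState.offerCode, e1, e2, e3, e4, e5]
  obtain ⟨c, h1, h2, h3⟩ := runRounds_flood (G := G) (w := w) hid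
    (fun v => (hle v).trans_lt hw) (2 * N)
  rw [runRounds_append]
  set B := (advance M ident f N K lone)^[i] ⟨[.start], ∅⟩ with hB
  -- the nodes of the search tree agree on the answer
  have hans : ∀ v, (ρ N v).fst ≠ none → c v = answer M ident f N K lone B.pending := by
    intro v hv
    have hroot : ∀ u, (ρ N u).fst ≠ none → ∃ p : G.Walk f u, p.length ≤ N := by
      intro u hu
      obtain ⟨m, hm⟩ := Option.ne_none_iff_exists'.1 hu
      have hm' : (finalData M ident f N K).lab u m := .inl hm
      obtain ⟨l, hl⟩ := hval.exists_altPath hm'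
      obtain ⟨p, -, hp, -⟩ := hl.exists_walk
      exact ⟨p, hp ▸ hval.lab_le hm'⟩
    apply le_antisymm
    · refine le_csInf ⟨_, .inl rfl⟩ ?_
      rintro a (rfl | ⟨u, q, l, h4, h5⟩)
      · exact (h3 v v .nil (Nat.zero_le _)).trans (hle v)
      · have hu := fst_ne_none_of_offered hid h5
        obtain ⟨p, hp⟩ := hroot u hu
        obtain ⟨p', hp'⟩ := hroot v hv
        refine (h3 u v (p.reverse.append p') ?_).trans ?_
        · rw [SimpleGraph.Walk.length_append, SimpleGraph.Walk.length_reverse]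
          omega
        · rw [hoff]
          refine Nat.sInf_le (.inr ⟨q, l, ?_, h5⟩)
          rw [(h u).2.2.2.2 hu]
          exact h4
    · obtain ⟨u, hu⟩ := h2 v
      rw [hu, hoff]
      have hne : ({a | a = K ^ 5 ∨ ∃ q l, (cfg u).board.pending = q :: l ∧ Offered K (ident u)
        (ident '' M.neighborSet u) (lone u) (ρ N u) (heard G ident (ρ N) u) q a} : Set ℕ).Nonempty :=
        ⟨_, .inl rfl⟩
      rcases Nat.sInf_mem hne with h4 | ⟨q, l, h4, h5⟩
      · unfold offer
        rw [h4]
        exact Nat.sInf_le (.inl rfl)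
      · have hur := fst_ne_none_of_offered hid h5
        rw [(h u).2.2.2.2 hur] at h4
        exact Nat.sInf_le (.inr ⟨u, q, l, h4, h5⟩)
  intro v
  obtain ⟨e1, e2, e3, e4, e5⟩ := h v
  change NodeState.self { (runRounds G ident w (List.replicate (2 * N) floodRound) cfg' v) with
    board := _ } = _ ∧ _
  simp only [Round.run, runRounds, localRound, h1]
  refine ⟨e1, e2, e3, e4, fun hv => ?_⟩
  rw [Function.iterate_succ_apply', ← hB]
  change (cfg v).board.next K (c v) = _
  rw [e5 hv, hans v hv]
  rfl

theorem AtQuery.queries (hid : Function.Injective ident) (hK : 2 * N + 3 < K)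
    (hident : ∀ v, ident v < K) (hw : K ^ 5 < 2 ^ w) {lone : V → Prop}
    (hlone : ∀ v, lone v ↔ (ident '' M.neighborSet v = ∅ ∧ (ρ N v).fst ≠ some 0))
    {cfg : V → NodeState} (h : AtQuery M ident f N K lone 0 cfg) (i : ℕ) :
    AtQuery M ident f N K lone i
      (runRounds G ident w (List.replicate i (queryRounds N K)).flatten cfg) := by
  induction i with
  | zero => exact h
  | succ i ih =>
    rw [List.replicate_succ', List.flatten_append, runRounds_append, List.flatten_singleton]
    exact ih.query hid hK hident hw hlone

/-- The unmatched node with the smaller identifier becomes the root. -/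
theorem atLevel_setRoot (hid : Function.Injective ident) (hident : ∀ v, ident v < K)
    (hw : K ^ 5 < 2 ^ w) {g : V} (hfg : ident f < ident g)
    (hun : ∀ v, Unmatched M v ↔ v = f ∨ v = g) (hwalk : ∃ p : G.Walk f g, p.length ≤ N) :
    AtLevel M ident f N 0 (runRounds G ident w (List.replicate N floodRound ++
      [localRound (setRoot N)]) (fun v => initState N K (ident v) (ident '' G.neighborSet v)
        (ident '' M.neighborSet v))) := by
  classical
  set cfg : V → NodeState := fun v => initState N K (ident v) (ident '' G.neighborSet v)
    (ident '' M.neighborSet v) with hcfg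
  have hlb : ∀ v, ident '' M.neighborSet v = ∅ ↔ v = f ∨ v = g := by
    intro v
    rw [← hun, Set.image_eq_empty, Set.eq_empty_iff_forall_notMem]
    rfl
  have hKpos : K ≤ K ^ 5 := Nat.le_self_pow (by omega) K
  have hcur : ∀ v, (cfg v).cur = if v = f ∨ v = g then ident v else K ^ 5 := by
    intro v
    by_cases hv : v = f ∨ v = g
    · rw [if_pos hv]; exact if_pos ((hlb v).2 hv)
    · rw [if_neg hv]; exact if_neg fun h => hv ((hlb v).1 h)
  have hlow : ∀ v, ident f ≤ (cfg v).cur := by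
    intro v
    rw [hcur]
    have := hident f
    split_ifs with hv
    · rcases hv with rfl | rfl
      · exact le_rfl
      · exact hfg.le
    · omega
  obtain ⟨c, h1, h2, h3⟩ := runRounds_flood (G := G) (w := w) hid (cfg := cfg) (by
    intro v
    rw [hcur]
    have := hident v
    split_ifs <;> omega) N
  obtain ⟨p, hp⟩ := hwalk
  rw [runRounds_append]
  intro v
  change NodeState.self (setRoot N _) = _ ∧ NodeState.lb (setRoot N _) = _ ∧
    NodeState.nb (setRoot N _) = _ ∧ NodeState.record (setRoot N _) = _ ∧
    NodeState.board (setRoot N _) = _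
  rw [h1]
  refine ⟨rfl, rfl, rfl, ?_, rfl⟩
  have hroot : (ident '' M.neighborSet v = ∅ ∧ c v = ident v) ↔ v = f := by
    rw [hlb]
    have hcf : (cfg f).cur = ident f := by rw [hcur, if_pos (.inl rfl)]
    constructor
    · rintro ⟨rfl | rfl, h4⟩
      · rfl
      · have := h3 _ _ p hp
        omega
    · rintro rfl
      refine ⟨.inl rfl, le_antisymm ?_ ?_⟩
      · rw [← hcf]
        exact h3 _ _ .nil (Nat.zero_le _)
      · obtain ⟨u, hu⟩ := h2 v
        rw [hu]
        exact hlow u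
  change Rec.start (N + 2) (ident v) (ident '' M.neighborSet v = ∅ ∧ c v = ident v) = _
  simp only [recAt]
  congr!

/-- The outcome of all rounds, for the root `f`. -/
theorem atQuery_allRounds (hid : Function.Injective ident) (hK : 2 * N + 3 < K)
    (hident : ∀ v, ident v + 1 < K) (hw : K ^ 5 < 2 ^ w) {g : V} (hfg : ident f < ident g)
    (hun : ∀ v, Unmatched M v ↔ v = f ∨ v = g) (hwalk : ∃ p : G.Walk f g, p.length ≤ N) :
    AtQuery M ident f N K (fun v => v = g) (N + 1) (runRounds G ident w (allRounds N K)
      (fun v => initState N K (ident v) (ident '' G.neighborSet v) (ident '' M.neighborSet v))) := by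
  have hident' : ∀ v, ident v < K := fun v => by have := hident v; omega
  have hKw : K < 2 ^ w := (Nat.le_self_pow (by omega) K).trans_lt hw
  have hid2 : ∀ v, ident v + 1 < 2 ^ w := fun v => (hident v).trans hKw
  have hNw : N + 2 < 2 ^ w := by omega
  have h0 := atLevel_setRoot hid hident' hw hfg hun hwalk
  obtain ⟨h1, h2⟩ := (h0.levels hid hid2 hNw le_rfl).exchange hid hid2 hNw le_rfl
  have hall : allRounds N K = (List.replicate N floodRound ++ [localRound (setRoot N)]) ++
      ((List.range N).flatMap (levelRounds N) ++ (exchangeRounds N ++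
        (List.replicate (N + 1) (queryRounds N K)).flatten)) := by
    simp [allRounds]
  rw [hall, runRounds_append, runRounds_append, runRounds_append]
  refine AtQuery.queries hid hK hident' hw ?_ ?_ _
  · intro v
    have hlb : ident '' M.neighborSet v = ∅ ↔ v = f ∨ v = g := by
      rw [← hun, Set.image_eq_empty, Set.eq_empty_iff_forall_notMem]
      rfl
    rw [hlb]
    constructor
    · rintro rfl
      refine ⟨.inr rfl, fun h => ?_⟩
      have := recAt_fst_of_le hid h (Nat.zero_le 0)
      rw [(recAt_zero_fst.1 this).1] at hfg
      omega
    · rintro ⟨rfl | rfl, h⟩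
      · exact absurd (recAt_root hid N).1 h
      · rfl
  · intro v
    obtain ⟨e1, e2, -, e4, e5⟩ := h1 v
    exact ⟨e1, e2, e4, h2 v, fun _ => e5⟩

end Rounds

/-! ### Augmenting paths and their reversal -/

section Reverse

variable {V : Type*} {G : SimpleGraph V} {M : G.Subgraph} {f g : V}

theorem IsAlternatingPath.reverse {p : G.Walk f g} (hp : IsAlternatingPath M p) :
    IsAlternatingPath M p.reverse := by
  refine ⟨hp.1.reverse, ?_⟩
  rw [SimpleGraph.Walk.edges_reverse, List.isChain_reverse]
  exact hp.2.imp fun e e' h h' => h h'.symm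

theorem IsAugmentingPath.reverse {p : G.Walk f g} (hp : IsAugmentingPath M p) :
    IsAugmentingPath M p.reverse :=
  ⟨hp.1.reverse, hp.2.1.symm, hp.2.2.2, hp.2.2.1⟩

theorem IsShortestAug.exists_walk {L : ℕ} {l : List V} (hfg : f ≠ g) (hf : Unmatched M f)
    (hg : Unmatched M g) (h : IsShortestAug M f g L l) :
    ∃ p : G.Walk f g, IsAugmentingPath M p ∧ p.length = L ∧ p.support = l.reverse := by
  obtain ⟨p, h1, h2, h3⟩ := h.1.exists_walk
  exact ⟨p, ⟨h1, hfg, hf, hg⟩, h2, h3⟩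

theorem isShortestAug_of_isLeast {L : ℕ}
    (hL : IsLeast {k | ∃ p : G.Walk f g, IsAugmentingPath M p ∧ p.length = k} L)
    {p : G.Walk f g} (hp : IsAugmentingPath M p) (hlen : p.length = L) :
    IsShortestAug M f g L p.support.reverse := by
  have h := altPath_of_isAlternatingPath hp.2.2.1 hp.1
  rw [hlen] at h
  refine ⟨h, h.odd_of_unmatched hp.2.1 hp.2.2.2, fun L' l' h' => ?_⟩
  obtain ⟨q, h1, h2, -⟩ := h'.exists_walk
  exact hL.2 ⟨q, ⟨h1, hp.2⟩, h2⟩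

theorem isLeast_augmenting_comm {L : ℕ}
    (hL : IsLeast {k | ∃ p : G.Walk f g, IsAugmentingPath M p ∧ p.length = k} L) :
    IsLeast {k | ∃ p : G.Walk g f, IsAugmentingPath M p ∧ p.length = k} L := by
  obtain ⟨⟨p, h1, h2⟩, h3⟩ := hL
  refine ⟨⟨p.reverse, h1.reverse, by simpa using h2⟩, ?_⟩
  rintro k ⟨q, h4, rfl⟩
  exact h3 ⟨q.reverse, h4.reverse, by simp⟩

end Reverse

/-! ### The algorithm -/

section Algorithm

variable {V : Type*} {G : SimpleGraph V} {M : G.Subgraph} {ident : V → ℕ} {f g : V} {b ℓ L : ℕ}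

theorem pathAlgorithm_edgeLabel (ω : V → Fin (pathAlgorithm b ℓ).coins → Bool) (v w : V) :
    (pathAlgorithm b ℓ).edgeLabel G M ident ω v w = outputLabel
      (runRounds G ident (5 * (b + 2) + 1) (allRounds (min ℓ (2 ^ b)) (2 ^ (b + 2)))
        (fun v => initState (min ℓ (2 ^ b)) (2 ^ (b + 2)) (ident v) (ident '' G.neighborSet v)
          (ident '' M.neighborSet v)) v) (ident w) :=
  congrArg (fun s : NodeState × List (Round NodeState) => outputLabel s.1 (ident w))
    (stateAfter_ofRounds _ _ _ ω _ [] (List.append_nil _).symm v)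

/-- The algorithm labels the edges of a shortest augmenting path, if the search starts from the
end `f`. -/
theorem pathAlgorithm_root (hid : Function.Injective ident) (hident : ∀ v, ident v < 2 ^ b)
    (hfg : ident f < ident g) (hun : ∀ v, Unmatched M v ↔ v = f ∨ v = g)
    (hL : IsLeast {k | ∃ p : G.Walk f g, IsAugmentingPath M p ∧ p.length = k} L)
    (hLN : L ≤ min ℓ (2 ^ b)) :
    ∃ p : G.Walk f g, IsAugmentingPath M p ∧ p.length = L ∧
      ∀ ω : V → Fin (pathAlgorithm b ℓ).coins → Bool,
        (pathAlgorithm b ℓ).OutputsPath G M ident ω p := by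
  classical
  have hne : f ≠ g := fun h => by rw [h] at hfg; omega
  have hb : 1 ≤ b := by
    by_contra hb
    obtain rfl : b = 0 := by omega
    have := hident g
    omega
  obtain ⟨p₀, hp₀, hlen₀⟩ := hL.1
  set N := min ℓ (2 ^ b) with hNdef
  set K := 2 ^ (b + 2) with hKdef
  have hK4 : K = 4 * 2 ^ b := by rw [hKdef, pow_add]; ring
  have hN2 : N ≤ 2 ^ b := min_le_right _ _
  have hb2 : 2 ≤ 2 ^ b := Nat.le_self_pow (by omega) 2
  have hK : 2 * N + 3 < K := by omega
  have hident' : ∀ v, ident v + 1 < K := fun v => by have := hident v; omega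
  have hw : K ^ 5 < 2 ^ (5 * (b + 2) + 1) := by
    rw [hKdef, ← pow_mul]
    exact Nat.pow_lt_pow_right (by omega) (by omega)
  have hstate := atQuery_allRounds (N := N) hid hK hident' hw hfg hun ⟨p₀, hlen₀.trans_le hLN⟩
  obtain ⟨l, h1, h2, h3⟩ := advance_start (N := N) (lone := fun v => v = g) hid hK
    (fun v => by have := hident' v; omega) hne (fun _ => Iff.rfl)
    ⟨_, isShortestAug_of_isLeast hL hp₀ hlen₀⟩ hLN
  obtain ⟨p, h4, h5, h6⟩ := h1.exists_walk hne ((hun f).2 (.inl rfl)) ((hun g).2 (.inr rfl))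
  refine ⟨p, h4, h5, fun ω v w _ => ?_⟩
  obtain ⟨e1, -, e2, -, e3⟩ := hstate v
  have hedges : ∀ e, e ∈ p.edges ↔ e ∈ pathEdges l := fun e => by
    rw [← pathEdges_reverse, ← h6, pathEdges_support]
    rfl
  have hmap : s(ident v, ident w) ∈ pathEdges (l.map ident) ↔ s(v, w) ∈ pathEdges l := by
    rw [pathEdges_map, ← (Sym2.map.injective hid).mem_set_image (s := pathEdges l) (a := s(v, w))]
    rfl
  rw [pathAlgorithm_edgeLabel, outputLabel, decide_eq_true_iff, e1, e2, hedges, ← hmap]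
  constructor
  · rintro ⟨hv, he⟩
    rwa [e3 hv, h3] at he
  · intro he
    have hv : v ∈ l := by
      have := p.fst_mem_support_of_mem_edges ((hedges _).2 (hmap.1 he))
      simpa [h6] using this
    obtain ⟨n, hn⟩ := h2 v hv
    have hv' : (recAt M ident f (N + 2) N v).fst ≠ none := by rw [hn]; simp
    refine ⟨hv', ?_⟩
    rwa [e3 hv', h3]

/-- The algorithm labels the edges of a shortest augmenting path. -/
theorem pathAlgorithm_outputsPath (hid : Function.Injective ident) (hident : ∀ v, ident v < 2 ^ b)
    (hfg : f ≠ g) (hun : ∀ v, Unmatched M v ↔ v = f ∨ v = g)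
    (hL : IsLeast {k | ∃ p : G.Walk f g, IsAugmentingPath M p ∧ p.length = k} L)
    (hLN : L ≤ min ℓ (2 ^ b)) :
    ∃ p : G.Walk f g, IsAugmentingPath M p ∧ p.length = L ∧
      ∀ ω : V → Fin (pathAlgorithm b ℓ).coins → Bool,
        (pathAlgorithm b ℓ).OutputsPath G M ident ω p := by
  rcases lt_or_gt_of_ne (hid.ne hfg) with h | h
  · exact pathAlgorithm_root hid hident h hun hL hLN
  · obtain ⟨p, h1, h2, h3⟩ := pathAlgorithm_root hid hident h
      (fun v => (hun v).trans or_comm) (isLeast_augmenting_comm hL) hLN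
    refine ⟨p.reverse, h1.reverse, by simpa using h2, fun ω v w hvw => ?_⟩
    rw [h3 ω v w hvw, SimpleGraph.Walk.edges_reverse, List.mem_reverse]

theorem uniformProb_eq_one {Ω : Type*} [Finite Ω] [Nonempty Ω] {E : Ω → Prop} (h : ∀ ω, E ω) :
    uniformProb E = 1 := by
  unfold uniformProb
  rw [Nat.card_congr (Equiv.subtypeUnivEquiv h)]
  exact div_self (by exact_mod_cast Nat.card_pos.ne')

end Algorithm

theorem mainTheorem4 (a c : ℕ) :
    ∃ (C : ℕ) (A : (b ℓ : ℕ) → CongestAlgorithm),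
      ∀ (V : Type*) [Fintype V] (G : SimpleGraph V) (M : G.Subgraph) (f g : V) (ℓ : ℕ)
        (b : ℕ) (ident : V → ℕ),
        G.Connected → M.IsMatching →
        f ≠ g → (∀ v, Unmatched M v ↔ v = f ∨ v = g) →
        (∃ p : G.Walk f g, IsAugmentingPath M p ∧ p.length ≤ ℓ) →
        Function.Injective ident → (∀ v, ident v < 2 ^ b) →
        b ≤ a * Nat.log 2 (Fintype.card V) →
        (A b ℓ).bandwidth ≤ C * Nat.log 2 (Fintype.card V) ∧
        (A b ℓ).rounds ≤ C * ℓ ^ 2 ∧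
        ∀ L : ℕ, IsLeast {k | ∃ p : G.Walk f g, IsAugmentingPath M p ∧ p.length = k} L →
          (∀ i P, i < L → PredecessorRun M f g L i P →
            ∃ u, PredecessorRun M f g L (i + 1) (u :: P)) ∧
          (∀ P, PredecessorRun M f g L L P →
            ∃ p : G.Walk f g, IsAugmentingPath M p ∧ p.length = L ∧ p.support = P) ∧
          1 - 1 / (Fintype.card V : ℝ) ^ c ≤
            uniformProb (fun ω : V → Fin (A b ℓ).coins → Bool =>
              ∃ p : G.Walk f g, IsAugmentingPath M p ∧ PredecessorRun M f g L L p.support ∧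
                (A b ℓ).OutputsPath G M ident ω p) := by
  -- `33 = 6 + 17 + 10` bounds the number of rounds, and messages have `5 * b + 11` bits
  refine ⟨5 * a + 33, pathAlgorithm, ?_⟩
  intro V _ G M f g ℓ b ident _ hM hfg hun ⟨p, hp, hpℓ⟩ hid hident hba
  have hf : Unmatched M f := (hun f).2 (.inl rfl)
  have hg : Unmatched M g := (hun g).2 (.inr rfl)
  have hcard : 1 < Fintype.card V := Fintype.one_lt_card_iff.2 ⟨f, g, hfg⟩
  have hlog : 1 ≤ Nat.log 2 (Fintype.card V) := Nat.log_pos (by omega) hcard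
  have hcb : Fintype.card V ≤ 2 ^ b := by
    have := Fintype.card_le_of_injective (fun v => (⟨ident v, hident v⟩ : Fin (2 ^ b)))
      fun v w h => hid (congrArg Fin.val h)
    rwa [Fintype.card_fin] at this
  refine ⟨?_, ?_, fun L hL => ?_⟩
  · change 5 * (b + 2) + 1 ≤ _
    calc 5 * (b + 2) + 1 ≤ 5 * (a * Nat.log 2 (Fintype.card V)) + 33 * 1 := by omega
      _ ≤ 5 * (a * Nat.log 2 (Fintype.card V)) + 33 * Nat.log 2 (Fintype.card V) := by gcongr
      _ = _ := by ring
  · change (allRounds _ _).length ≤ _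
    rw [length_allRounds]
    have hℓ : 1 ≤ ℓ := by
      refine le_trans (Nat.one_le_iff_ne_zero.2 fun h => hfg ?_) hpℓ
      exact SimpleGraph.Walk.eq_of_length_eq_zero h
    have hN : min ℓ (2 ^ b) ≤ ℓ := min_le_left _ _
    calc 6 * min ℓ (2 ^ b) ^ 2 + 17 * min ℓ (2 ^ b) + 10 ≤ 6 * ℓ ^ 2 + 17 * ℓ + 10 := by gcongr
      _ ≤ 33 * ℓ ^ 2 := by nlinarith
      _ ≤ (5 * a + 33) * ℓ ^ 2 := by gcongr; omega
  · obtain ⟨p₀, hp₀, hlen₀⟩ := hL.1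
    have hLN : L ≤ min ℓ (2 ^ b) := le_min ((hL.2 ⟨p, hp, rfl⟩).trans hpℓ)
      (hlen₀ ▸ hp₀.1.1.length_lt.le.trans hcb)
    have hex : ∃ l, IsShortestAug M f g L l := ⟨_, isShortestAug_of_isLeast hL hp₀ hlen₀⟩
    refine ⟨fun i P hi hP => hP.exists_extend hf hM hex hi, fun P hP => ?_, ?_⟩
    · obtain ⟨q, h1, h2, h3⟩ := (hP.altPath hf hM hex).exists_walk
      exact ⟨q, ⟨h1, hfg, hf, hg⟩, h2, by rw [h3, List.reverse_reverse]⟩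
    · obtain ⟨q, h1, h2, h3⟩ := pathAlgorithm_outputsPath hid hident hfg hun hL hLN
      have hrun : PredecessorRun M f g L L q.support := by
        simpa using (isShortestAug_of_isLeast hL h1 h2).predecessorRun hf
      rw [uniformProb_eq_one fun ω => ⟨q, h1, hrun, h3 ω⟩]
      have : 0 ≤ 1 / (Fintype.card V : ℝ) ^ c := by positivity
      linarith
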